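/- Let $\mathsf k$ be a commutative Noetherian ring. Let $G$ be a diagonalizable group acting diagonally on $\mathbb A^{N}$, given by the surjection $\mu:\mathbb Z^{N}\to\widehat G$ onto its character group; put $M=\ker\mu$, $M_{\mathbb R}=M\otimes\mathbb R\subseteq\mathbb R^N$, $\widehat G_{\mathbb R}=\mathbb R^N/M_{\mathbb R}$, and let $\mu_{\mathbb R}:\mathbb R^N\to\widehat G_{\mathbb R}$ be the induced map. Assume that the cone $\mu_{\mathbb R}(\mathbb R^N_{\ge 0})$ is strongly convex and that $\mu_{\mathbb R}(D_i)\neq0$ for every standard basis vector $D_i$. Let $$\Phi:M_{\mathbb R}/M\to\widehat G,\qquad \sum a_iD_i\mapsto\mu\Big(-\sum\lfloor a_i\rfloor D_i\Big)$$ be the Bondal–Ruan map and let $$A=A_\Phi=\operatorname{End}\Big(\bigoplus_{D\in\operatorname{im}\Phi}\mathcal O(-D)\Big)$$ be the Bondal–Ruan algebra of $[\mathbb A^N/G]$; thus $\operatorname{Hom}(\mathcal O(-D),\mathcal O(-E))$ is the part of degree $D-E$ of the Cox ring $\mathsf k[x_1,\dots,x_N]$, graded by $\deg x_i=\mu(D_i)$,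 and products are written in the order of concatenation. The vertices of the quiver of $A$ are the elements of $\operatorname{im}\Phi$, and its arrows are the indecomposable (nontrivial) monomials between vertices. Assume that $A$ is directable: there is a linear order on the variables $x_1,\dots,x_N$ such that every concatenation of arrows is equal in $A$ to a concatenation $x_{j_1}\cdots x_{j_r}$ of arrows given by single variables with $j_1\le\dots\le j_r$. Then: 1. $A$ is Koszul for path length. That is, the spans $A_n$ of the concatenations of $n$ arrows form a grading $A=\bigoplus_{n\ge0}A_n$ of the algebra $A$, and the graded left module $A_0=A/A_{>0}$ has a resolution $\cdots\to P_1\to P_0\to A_0\to0$ with maps of degree $0$ and graded projective modules $P_i$ generated in degree $i$. 2. $A$ admits a minimal cellular resolution. That is, let $X_A$ be the classifying space of the category with objects $\operatorname{im}\Phi$ and with the monomials as morphisms; its $n$-cells $\eta$ are the chains $[e_v=p_0<p_1<\dots<p_n]$ of monomials starting at a vertex $v=t(\eta)$, and $h(\eta)$ is the end of $p_n$. There is an acyclic matching of cells of $X_A$ with facets of them that is internal to $A$ (vertices and arrows are unmatched, and matched cells have the same start and the same end), such that its Morse complex of bimodules, with terms $\bigoplus_{\eta}Ae_{t(\eta)}\otimes_{\mathsf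 k}e_{h(\eta)}A$ over the critical (unmatched) $n$-cells $\eta$ and with differential $$1\otimes[\eta]\otimes1\mapsto\sum_{\sigma}\sum_{\gamma}\epsilon(\gamma)\,l(\gamma)\otimes[\sigma]\otimes r(\gamma),$$ where $\sigma$ runs over the critical $(n-1)$-cells and $\gamma$ over the discrete gradient paths from $\eta$ to $\sigma$, is a projective resolution of the $(A,A)$-bimodule $A$ and is minimal: all components of its differential lie in the ideal of $A\otimes_{\mathsf k}A^{op}$ generated by the arrows. Here $l(\gamma)$ and $r(\gamma)$ are the products of the initial and terminal factors dropped along $\gamma$, and $\epsilon(\gamma)=\pm1$ is the product of the incidence numbers $(-1)^i$ of the steps down to an $i$-th facet and of $-(-1)^j$ for the steps up along a matched edge to a cell from its $j$-th facet. -/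

import Mathlib

open scoped TensorProduct

noncomputable section

namespace BondalRuan

/-! ### The toric data

`[𝔸ᴺ / G]` is encoded by the surjection `μ : ℤᴺ → Ĝ` onto the character group `Ĝ = Γ` of `G`. -/

section Toric

variable {N : ℕ} {Γ : Type*} [AddCommGroup Γ]

/-- `M_ℝ ⊆ ℝᴺ`, the real span of `M = ker μ`. -/
def kerR (μ : (Fin N → ℤ) →+ Γ) : Submodule ℝ (Fin N → ℝ) :=
  Submodule.span ℝ ((fun (m : Fin N → ℤ) (i : Fin N) => (m i : ℝ)) '' {m | μ m = 0})

/-- `Ĝ_ℝ = Ĝ ⊗ ℝ = ℝᴺ / M_ℝ`. -/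
abbrev CharR (μ : (Fin N → ℤ) →+ Γ) : Type := (Fin N → ℝ) ⧸ kerR μ

/-- `μ_ℝ : ℝᴺ → Ĝ_ℝ`. -/
def muR (μ : (Fin N → ℤ) →+ Γ) : (Fin N → ℝ) →ₗ[ℝ] CharR μ := (kerR μ).mkQ

/-- The stack `[𝔸ᴺ / G]` is cohomologically proper: the cone `μ_ℝ(ℝᴺ_{≥ 0})` is strongly convex
(contains no line). -/
def CohomologicallyProper (μ : (Fin N → ℤ) →+ Γ) : Prop :=
  ((ConvexCone.positive ℝ (Fin N → ℝ)).map (muR μ)).Salient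

/-- The (lift to `M_ℝ` of the) Bondal–Ruan map, `∑ aᵢ Dᵢ ↦ μ(- ∑ ⌊aᵢ⌋ Dᵢ)`. -/
def bondalRuanMap (μ : (Fin N → ℤ) →+ Γ) (a : kerR μ) : Γ :=
  μ (fun i => -⌊(a : Fin N → ℝ) i⌋)

/-- The Bondal–Ruan map is `M`-periodic, so it descends to the torus `M_ℝ / M`. -/
lemma bondalRuanMap_periodic (μ : (Fin N → ℤ) →+ Γ) (a b : kerR μ) (m : Fin N → ℤ)
    (hm : μ m = 0) (h : ∀ i, (b : Fin N → ℝ) i = (a : Fin N → ℝ) i + m i) :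
    bondalRuanMap μ b = bondalRuanMap μ a := by
  have : (fun i => -⌊(b : Fin N → ℝ) i⌋) = (fun i => -⌊(a : Fin N → ℝ) i⌋) - m := by
    funext i
    simp [h i]
    ring
  rw [bondalRuanMap, this, map_sub, hm, sub_zero, bondalRuanMap]

/-- `im Φ`. -/
def imPhi (μ : (Fin N → ℤ) →+ Γ) : Set Γ := Set.range (bondalRuanMap μ)

lemma imPhi_finite (μ : (Fin N → ℤ) →+ Γ) : (imPhi μ).Finite := by
  classical
  obtain ⟨s, hs⟩ : (AddMonoidHom.toIntLinearMap μ).ker.FG := IsNoetherian.noetherian _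
  set c : (Fin N → ℤ) → (Fin N → ℝ) := fun m i => (m i : ℝ) with hc
  have hspan : kerR μ ≤ Submodule.span ℝ (Set.range (fun x : s => c x)) := by
    refine Submodule.span_le.2 ?_
    rintro _ ⟨m, hm, rfl⟩
    have hm' : m ∈ Submodule.span ℤ (s : Set (Fin N → ℤ)) := by
      rw [hs]; exact hm
    induction hm' using Submodule.span_induction with
    | mem x hx => exact Submodule.subset_span ⟨⟨x, hx⟩, rfl⟩
    | zero =>
      have : (fun i : Fin N => (((0 : Fin N → ℤ) i : ℤ) : ℝ)) = 0 := by funext i; simp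
      simp only [SetLike.mem_coe]
      rw [this]; exact Submodule.zero_mem _
    | add x y hx hy ihx ihy =>
      have hx' : μ x = 0 := by rw [hs] at hx; exact hx
      have hy' : μ y = 0 := by rw [hs] at hy; exact hy
      have : (fun i : Fin N => (((x + y) i : ℤ) : ℝ)) =
          (fun i => (x i : ℝ)) + fun i => (y i : ℝ) := by funext i; simp
      simp only [SetLike.mem_coe] at ihx ihy ⊢
      rw [this]; exact Submodule.add_mem _ (ihx hx') (ihy hy')
    | smul a x hx ihx =>
      have hx' : μ x = 0 := by rw [hs] at hx; exact hx
      have : (fun i : Fin N => (((a • x) i : ℤ) : ℝ)) = (a : ℝ) • fun i => (x i : ℝ) := by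
        funext i; simp
      simp only [SetLike.mem_coe] at ihx ⊢
      rw [this]; exact Submodule.smul_mem _ _ (ihx hx')
  have hmem : ∀ x : s, μ (x : Fin N → ℤ) = 0 := by
    intro x
    have : (x : Fin N → ℤ) ∈ (AddMonoidHom.toIntLinearMap μ).ker := by
      rw [← hs]; exact Submodule.subset_span x.2
    exact this
  set B : Fin N → ℝ := fun i => ∑ x : s, |((x : Fin N → ℤ) i : ℝ)| with hB
  refine ((Set.finite_Icc (fun i => -⌊B i⌋ - 1) (fun i => ⌈B i⌉ + 1)).image μ).subset ?_
  rintro _ ⟨a, rfl⟩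
  obtain ⟨t, ht⟩ := (Submodule.mem_span_range_iff_exists_fun ℝ).1 (hspan a.2)
  set m : Fin N → ℤ := ∑ x : s, ⌊t x⌋ • (x : Fin N → ℤ) with hm
  have hm0 : μ m = 0 := by
    rw [hm, map_sum]
    exact Finset.sum_eq_zero fun x _ => by rw [map_zsmul, hmem, smul_zero]
  refine ⟨(fun i => -⌊(a : Fin N → ℝ) i⌋) + m, ?_, by simp [bondalRuanMap, map_add, hm0]⟩
  have key : ∀ i, |(a : Fin N → ℝ) i - m i| ≤ B i := by
    intro i
    have h1 : (a : Fin N → ℝ) i - m i = ∑ x : s, Int.fract (t x) * ((x : Fin N → ℤ) i : ℝ) := by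
      rw [← ht]
      simp only [hm, hc, Finset.sum_apply, Pi.smul_apply, smul_eq_mul, Int.cast_sum,
        Int.cast_mul, ← Finset.sum_sub_distrib]
      refine Finset.sum_congr rfl fun x _ => ?_
      rw [← sub_mul, Int.fract]
    rw [h1]
    refine (Finset.abs_sum_le_sum_abs _ _).trans (Finset.sum_le_sum fun x _ => ?_)
    rw [abs_mul, abs_of_nonneg (Int.fract_nonneg _)]
    exact mul_le_of_le_one_left (abs_nonneg _) (Int.fract_lt_one _).le
  have hfl : ∀ i, (-⌊(a : Fin N → ℝ) i⌋ + m i) = -⌊(a : Fin N → ℝ) i - m i⌋ := by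
    intro i; rw [Int.floor_sub_intCast]; ring
  constructor
  · intro i
    simp only [Pi.add_apply]
    rw [hfl]
    have := Int.floor_mono ((abs_le.1 (key i)).2)
    omega
  · intro i
    simp only [Pi.add_apply]
    rw [hfl]
    have := Int.floor_mono ((abs_le.1 (key i)).1)
    rw [Int.floor_neg] at this
    omega

/-- The vertices of the quiver: the elements of `im Φ`. -/
abbrev Vertex (μ : (Fin N → ℤ) →+ Γ) : Type _ := ↥(imPhi μ)

instance (μ : (Fin N → ℤ) →+ Γ) : Fintype (Vertex μ) := (imPhi_finite μ).fintype

instance (μ : (Fin N → ℤ) →+ Γ) : DecidableEq (Vertex μ) := Classical.decEq _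

/-- The `Ĝ`-degree `μ(Dᵢ)` of the variable `xᵢ` of the Cox ring. -/
def varDeg (μ : (Fin N → ℤ) →+ Γ) (i : Fin N) : Γ := μ (Pi.single i 1)

/-- The `Ĝ`-degree of the monomial with exponent vector `e`. -/
def monDeg (μ : (Fin N → ℤ) →+ Γ) : (Fin N →₀ ℕ) →+ Γ := Finsupp.weight (varDeg μ)

/-- `Hom(𝒪(-D), 𝒪(-E))` has as basis the monomials of degree `D - E`. Thus a basis element with
source `D` is an exponent vector `e`, and its target is `D - deg e`; both have to be vertices. -/
def IsMor (μ : (Fin N → ℤ) →+ Γ) (D : Γ) (e : Fin N →₀ ℕ) : Prop :=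
  D ∈ imPhi μ ∧ D - monDeg μ e ∈ imPhi μ

/-- The arrows of the quiver: the indecomposable monomials between vertices. -/
def IsArrow (μ : (Fin N → ℤ) →+ Γ) (D : Γ) (e : Fin N →₀ ℕ) : Prop :=
  IsMor μ D e ∧ e ≠ 0 ∧
    ∀ e₁ e₂ : Fin N →₀ ℕ, e = e₁ + e₂ → IsMor μ D e₁ → e₁ = 0 ∨ e₂ = 0

/-- `w` is the list of arrows of a path of the quiver that starts at `D`. -/
def IsPath (μ : (Fin N → ℤ) →+ Γ) : Γ → List (Fin N →₀ ℕ) → Prop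
  | D, [] => D ∈ imPhi μ
  | D, e :: w => IsArrow μ D e ∧ IsPath μ (D - monDeg μ e) w

end Toric

/-! ### The Bondal–Ruan algebra -/

section Algebra

variable (k : Type*) [CommRing k] {N : ℕ} {Γ : Type*} [AddCommGroup Γ]

open Classical in
/-- The Bondal–Ruan algebra `A_Φ = End(⨁_{D ∈ im Φ} 𝒪(-D))`. As
`Hom(𝒪(-D), 𝒪(-E)) = H⁰(𝒪(D - E))` is the piece of degree `D - E` of the Cox ring
`k[x₁, …, x_N]`, these are the matrices whose `(D, E)` entry lies in that piece. The product is
written in the order of concatenation: first from `D` to `E`, then from `E` to `F`. -/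
def algebra (μ : (Fin N → ℤ) →+ Γ) :
    Subalgebra k (Matrix (Vertex μ) (Vertex μ) (MvPolynomial (Fin N) k)) where
  carrier := {a | ∀ D E : Vertex μ,
    MvPolynomial.IsWeightedHomogeneous (varDeg μ) (a D E) ((D : Γ) - E)}
  mul_mem' := by
    intro a b ha hb D F
    rw [Matrix.mul_apply]
    refine MvPolynomial.IsWeightedHomogeneous.sum _ _ _ fun E _ => ?_
    have := (ha D E).mul (hb E F)
    rwa [sub_add_sub_cancel] at this
  add_mem' := by
    intro a b ha hb D E
    exact (ha D E).add (hb D E)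
  algebraMap_mem' := by
    intro r D E
    rw [Matrix.algebraMap_matrix_apply]
    split_ifs with h
    · subst h
      rw [sub_self]
      exact MvPolynomial.isWeightedHomogeneous_C _ _
    · exact MvPolynomial.isWeightedHomogeneous_zero _ _ _

/-- `A_Φ` as a type. -/
abbrev Alg (μ : (Fin N → ℤ) →+ Γ) : Type _ := ↥(algebra k μ)

open Classical in
/-- The basis element of `A_Φ` given by the monomial `x ^ e`, from the vertex `D` to the vertex
`D - deg e` (and `0` if these are not both vertices). `mono k μ D 0` is the idempotent of `D`. -/
def mono (μ : (Fin N → ℤ) →+ Γ) (D : Γ) (e : Fin N →₀ ℕ) : Alg k μ :=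
  if h : IsMor μ D e then
    ⟨Matrix.single ⟨D, h.1⟩ ⟨D - monDeg μ e, h.2⟩ (MvPolynomial.monomial e 1), by
      intro D' E'
      rw [Matrix.single_apply]
      split_ifs with h'
      · obtain ⟨rfl, rfl⟩ := h'
        exact MvPolynomial.isWeightedHomogeneous_monomial _ _ _ (sub_sub_cancel _ _).symm
      · exact MvPolynomial.isWeightedHomogeneous_zero _ _ _⟩
  else 0

/-- The concatenation in `A_Φ` of the arrows `w`, starting at `D`. -/
def pathElem (μ : (Fin N → ℤ) →+ Γ) : Γ → List (Fin N →₀ ℕ) → Alg k μ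
  | D, [] => mono k μ D 0
  | D, e :: w => mono k μ D e * pathElem μ (D - monDeg μ e) w

/-- The part of `A_Φ` of degree `n` for path length: the span of the concatenations of `n`
arrows. -/
def pathGrading (μ : (Fin N → ℤ) →+ Γ) (n : ℕ) : Submodule k (Alg k μ) :=
  Submodule.span k {a | ∃ D w, IsPath μ D w ∧ w.length = n ∧ a = pathElem k μ D w}

/-- `A_Φ` is directable: for some linear order of the variables, every concatenation of arrows is
equal in `A_Φ` to a concatenation of arrows `x_{j₁} ⋯ x_{jᵣ}` with `j₁ ≤ ⋯ ≤ jᵣ`. -/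
def Directable (μ : (Fin N → ℤ) →+ Γ) : Prop :=
  ∃ r : LinearOrder (Fin N), ∀ (D : Γ) (w : List (Fin N →₀ ℕ)), IsPath μ D w →
    ∃ l : List (Fin N), l.Pairwise (fun i j => r.le i j) ∧
      IsPath μ D (l.map fun i => Finsupp.single i 1) ∧
      pathElem k μ D w = pathElem k μ D (l.map fun i => Finsupp.single i 1)

end Algebra

/-! ### Koszul algebras -/

universe u v

/-- The left ideal generated by the elements of positive degree. -/
def posIdeal {k : Type u} {A : Type v} [CommRing k] [Ring A] [Algebra k A]
    (𝒜 : ℕ → Submodule k A) : Submodule A A :=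
  Submodule.span A {a | ∃ n, 0 < n ∧ a ∈ 𝒜 n}

/-- `A = ⨁ₙ 𝒜ₙ` is a Koszul algebra: it is graded by the `𝒜ₙ`, and the graded left module
`A₀ = A / A_{> 0}` has a linear resolution `⋯ → P₁ → P₀ → A₀ → 0`, i.e. one by graded projective
modules `Pᵢ` that are generated in degree `i`, with maps of degree `0`. -/
structure IsKoszul {k : Type u} {A : Type v} [CommRing k] [Ring A] [Algebra k A]
    (𝒜 : ℕ → Submodule k A) : Prop where
  graded : SetLike.GradedMonoid 𝒜
  internal : DirectSum.IsInternal 𝒜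
  linear_resolution :
    ∃ (P : ℕ → Type v) (_ : ∀ i, AddCommGroup (P i)) (_ : ∀ i, Module A (P i))
      (gr : ∀ i, ℕ → AddSubgroup (P i))
      (d : ∀ i, P (i + 1) →ₗ[A] P i) (ε : P 0 →ₗ[A] A ⧸ posIdeal 𝒜),
      (∀ i, Module.Projective A (P i)) ∧
      (∀ i, DirectSum.IsInternal (gr i)) ∧
      (∀ i m n, ∀ a ∈ 𝒜 m, ∀ x ∈ gr i n, a • x ∈ gr i (m + n)) ∧
      (∀ i, Submodule.span A (gr i i : Set (P i)) = ⊤) ∧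
      (∀ i n, ∀ x ∈ gr (i + 1) n, d i x ∈ gr i n) ∧
      (∀ i, Function.Exact (d (i + 1)) (d i)) ∧
      Function.Exact (d 0) ε ∧
      Function.Surjective ε

/-! ### The cells of the geometric realization and internal matchings -/

section Cells

variable {N : ℕ} {Γ : Type*} [AddCommGroup Γ]

/-- The `n`-cells of `X_A`, through their canonical representatives `[e_D = p₀ < p₁ < ⋯ < pₙ]`,
where the `pᵢ` are monomials that start at the vertex `D`; equivalently, the nondegenerate
`n`-simplices of the nerve of the category of vertices and monomials. -/
@[ext]
structure Cell (μ : (Fin N → ℤ) →+ Γ) (n : ℕ) where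
  /-- The starting vertex. -/
  src : Γ
  /-- The chain of monomials. -/
  p : Fin (n + 1) → (Fin N →₀ ℕ)
  zero : p 0 = 0
  strictMono : StrictMono p
  vertex : ∀ i, src - monDeg μ (p i) ∈ imPhi μ

/-- The end vertex of a cell. -/
def Cell.tgt {μ : (Fin N → ℤ) →+ Γ} {n : ℕ} (η : Cell μ n) : Γ :=
  η.src - monDeg μ (η.p (Fin.last n))

/-- The `i`-th facet of a cell: `pᵢ` is left out, and the chain that remains is replaced by its
canonical representative (this makes a difference for `i = 0` only). -/
def Cell.facet {μ : (Fin N → ℤ) →+ Γ} {n : ℕ} (η : Cell μ (n + 1)) (i : Fin (n + 2)) :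
    Cell μ n where
  src := η.src - monDeg μ (η.p (i.succAbove 0))
  p j := η.p (i.succAbove j) - η.p (i.succAbove 0)
  zero := tsub_self _
  strictMono := by
    intro a b hab
    have h0 : η.p (i.succAbove 0) ≤ η.p (i.succAbove a) :=
      η.strictMono.monotone ((Fin.strictMono_succAbove i).monotone (Fin.zero_le a))
    exact tsub_lt_tsub_right_of_le h0 (η.strictMono (Fin.strictMono_succAbove i hab))
  vertex := by
    intro j
    have h0 : η.p (i.succAbove 0) ≤ η.p (i.succAbove j) :=
      η.strictMono.monotone ((Fin.strictMono_succAbove i).monotone (Fin.zero_le j))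
    rw [sub_sub, ← map_add, add_tsub_cancel_of_le h0]
    exact η.vertex _

/-- All cells of `X_A`. -/
abbrev AnyCell (μ : (Fin N → ℤ) →+ Γ) : Type _ := Σ n, Cell μ n

/-- `y` is a facet of `x`. -/
def IsFacet {μ : (Fin N → ℤ) →+ Γ} (x y : AnyCell μ) : Prop :=
  ∃ (n : ℕ) (η : Cell μ (n + 1)) (i : Fin (n + 2)), x = ⟨n + 1, η⟩ ∧ y = ⟨n, η.facet i⟩

/-- A matching on the cells of `X_A`: a set of pairs (cell, facet of it) in which every cell occurs
at most once. -/
structure IsMatching {μ : (Fin N → ℤ) →+ Γ} (M : Set (AnyCell μ × AnyCell μ)) : Prop where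
  facet : ∀ x y, (x, y) ∈ M → IsFacet x y
  top_unique : ∀ x y y', (x, y) ∈ M → (x, y') ∈ M → y = y'
  bot_unique : ∀ x x' y, (x, y) ∈ M → (x', y) ∈ M → x = x'
  disjoint : ∀ x y z, (x, y) ∈ M → (y, z) ∉ M

/-- A cell is critical if it is unmatched. -/
def IsCritical {μ : (Fin N → ℤ) →+ Γ} (M : Set (AnyCell μ × AnyCell μ)) (x : AnyCell μ) : Prop :=
  ∀ y, (x, y) ∉ M ∧ (y, x) ∉ M

/-- The edges of the Hasse diagram of the cells, where the unmatched edges are directed towards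
the facet and the matched edges are reversed. -/
def HasseStep {μ : (Fin N → ℤ) →+ Γ} (M : Set (AnyCell μ × AnyCell μ)) (x y : AnyCell μ) : Prop :=
  (IsFacet x y ∧ (x, y) ∉ M) ∨ (y, x) ∈ M

/-- A matching is acyclic if the directed Hasse diagram has no oriented cycles. -/
def IsAcyclic {μ : (Fin N → ℤ) →+ Γ} (M : Set (AnyCell μ × AnyCell μ)) : Prop :=
  ∀ x, ¬ Relation.TransGen (HasseStep M) x x

/-- A matching is internal to `A` if the cells of `Q₀` and `Q₁` are unmatched, and matched cells
have the same start and the same end. -/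
structure IsInternal {μ : (Fin N → ℤ) →+ Γ} (M : Set (AnyCell μ × AnyCell μ)) : Prop where
  vertices : ∀ η : Cell μ 0, IsCritical M ⟨0, η⟩
  arrows : ∀ η : Cell μ 1, IsArrow μ η.src (η.p 1) → IsCritical M ⟨1, η⟩
  ends : ∀ x y, (x, y) ∈ M → x.2.src = y.2.src ∧ x.2.tgt = y.2.tgt

/-- The discrete gradient paths from an `(n+1)`-cell `η` to an `n`-cell `σ`: directed paths
`η → σ₀ → η₁ → σ₁ → ⋯ → σᵣ = σ` in the directed Hasse diagram, which go down along unmatched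
edges and up along matched edges. -/
inductive GradPath {μ : (Fin N → ℤ) →+ Γ} (M : Set (AnyCell μ × AnyCell μ)) {n : ℕ} :
    Cell μ (n + 1) → Cell μ n → Type _
  | down (η : Cell μ (n + 1)) (i : Fin (n + 2))
      (h : ((⟨n + 1, η⟩ : AnyCell μ), (⟨n, η.facet i⟩ : AnyCell μ)) ∉ M) :
      GradPath M η (η.facet i)
  | step (η : Cell μ (n + 1)) (i : Fin (n + 2))
      (h : ((⟨n + 1, η⟩ : AnyCell μ), (⟨n, η.facet i⟩ : AnyCell μ)) ∉ M)
      (τ : Cell μ (n + 1)) (j : Fin (n + 2)) (hj : τ.facet j = η.facet i)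
      (hM : ((⟨n + 1, τ⟩ : AnyCell μ), (⟨n, τ.facet j⟩ : AnyCell μ)) ∈ M)
      (σ : Cell μ n) (γ : GradPath M τ σ) : GradPath M η σ

end Cells

/-! ### The Morse complex of projective bimodules -/

section Morse

variable (k : Type*) [CommRing k] {N : ℕ} {Γ : Type*} [AddCommGroup Γ]

/-- The enveloping algebra `A ⊗ₖ Aᵒᵖ` of `A = A_Φ`; its left modules are the `A`-`A`-bimodules. -/
abbrev Env (μ : (Fin N → ℤ) →+ Γ) : Type _ := Alg k μ ⊗[k] (Alg k μ)ᵐᵒᵖ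

/-- `l ⊗ r`, where `l` is the factor lost at the start and `r` the factor lost at the end in
passing from `η` to its `i`-th facet (an idempotent if nothing is lost). -/
def facetCoeff {μ : (Fin N → ℤ) →+ Γ} {n : ℕ} (η : Cell μ (n + 1)) (i : Fin (n + 2)) : Env k μ :=
  mono k μ η.src (η.p (i.succAbove 0)) ⊗ₜ[k]
    MulOpposite.op (mono k μ (η.src - monDeg μ (η.p (i.succAbove (Fin.last n))))
      (η.p (Fin.last (n + 1)) - η.p (i.succAbove (Fin.last n))))

/-- The coefficient `ε(γ) l(γ) ⊗ r(γ)` of a gradient path: a step down to the `i`-th facet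
contributes the sign `(-1)ⁱ` and the factors that are lost, a step up along a matched edge with
incidence number `(-1)ʲ` contributes `-(-1)ʲ`. -/
def GradPath.coeff {μ : (Fin N → ℤ) →+ Γ} {M : Set (AnyCell μ × AnyCell μ)} {n : ℕ}
    {η : Cell μ (n + 1)} {σ : Cell μ n} : GradPath M η σ → Env k μ
  | .down η i _ => (-1 : ℤ) ^ (i : ℕ) • facetCoeff k η i
  | .step η i _ _ j _ _ _ γ =>
      ((-1 : ℤ) ^ (i : ℕ) * -(-1 : ℤ) ^ (j : ℕ)) • (facetCoeff k η i * γ.coeff)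

/-- The critical `n`-cells. -/
abbrev Crit {μ : (Fin N → ℤ) →+ Γ} (M : Set (AnyCell μ × AnyCell μ)) (n : ℕ) : Type _ :=
  {η : Cell μ n // IsCritical M ⟨n, η⟩}

/-- The `n`-th term `⨁_η P_{t(η)} ⊠ P_{h(η)}ᵒᵖ` of the Morse complex, `η` running through the
critical `n`-cells. Here `P_v ⊠ P_wᵒᵖ = A e_v ⊗ₖ e_w A` is realized as the left ideal of
`A ⊗ₖ Aᵒᵖ` generated by `e_v ⊗ e_w`. -/
def morseTerm {μ : (Fin N → ℤ) →+ Γ} (M : Set (AnyCell μ × AnyCell μ)) (n : ℕ) :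
    Submodule (Env k μ) (Crit M n →₀ Env k μ) :=
  Finsupp.submodule fun η =>
    Submodule.span (Env k μ)
      {mono k μ η.1.src 0 ⊗ₜ[k] MulOpposite.op (mono k μ η.1.tgt 0)}

/-- The component of the differential of the Morse complex from `η` to `σ`, the sum of the
coefficients of the gradient paths. For an acyclic matching (`X_A` has finitely many cells) this
is a finite sum. -/
def morseCoeff {μ : (Fin N → ℤ) →+ Γ} (M : Set (AnyCell μ × AnyCell μ)) {n : ℕ}
    (η : Cell μ (n + 1)) (σ : Cell μ n) : Env k μ :=
  ∑ᶠ γ : GradPath M η σ, γ.coeff k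

/-- The differential of the Morse complex,
`1 ⊗ [η] ⊗ 1 ↦ ∑_σ ∑_γ ε(γ) l(γ) ⊗ [σ] ⊗ r(γ)`. -/
def morseDiff {μ : (Fin N → ℤ) →+ Γ} (M : Set (AnyCell μ × AnyCell μ)) (n : ℕ) :
    (Crit M (n + 1) →₀ Env k μ) →ₗ[Env k μ] (Crit M n → Env k μ) :=
  Finsupp.linearCombination (Env k μ)
    (fun (η : Crit M (n + 1)) (σ : Crit M n) => morseCoeff k M η.1 σ.1)

/-- The augmentation, the sum of the multiplication maps
`A e_v ⊗ₖ e_v A → A`, `a ⊗ b ↦ a b`. -/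
def augmentation {μ : (Fin N → ℤ) →+ Γ} (M : Set (AnyCell μ × AnyCell μ)) :
    letI : Module (Env k μ) (Alg k μ) := instModuleTensorProductMop k (Alg k μ)
    (Crit M 0 →₀ Env k μ) →ₗ[Env k μ] Alg k μ :=
  letI : Module (Env k μ) (Alg k μ) := instModuleTensorProductMop k (Alg k μ)
  Finsupp.linearCombination (Env k μ) (fun _ => (1 : Alg k μ))

/-- The two-sided ideal of `A ⊗ₖ Aᵒᵖ` generated by the arrows `a ⊗ 1` and `1 ⊗ a`. -/
def arrowIdeal (μ : (Fin N → ℤ) →+ Γ) : TwoSidedIdeal (Env k μ) :=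
  TwoSidedIdeal.span
    {z | ∃ D e, IsArrow μ D e ∧
      (z = mono k μ D e ⊗ₜ[k] 1 ∨ z = 1 ⊗ₜ[k] MulOpposite.op (mono k μ D e))}

/-- The Morse complex of `M` is a projective resolution of the diagonal bimodule `A`: its terms
are projective, the differential preserves them, and the augmented complex is exact. -/
structure IsProjectiveResolution {μ : (Fin N → ℤ) →+ Γ} (M : Set (AnyCell μ × AnyCell μ)) :
    Prop where
  projective : ∀ n, Module.Projective (Env k μ) (morseTerm k M n)
  mapsTo : ∀ n, ∀ x ∈ morseTerm k M (n + 1), ∃ y ∈ morseTerm k M n, ⇑y = morseDiff k M n x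
  exact : ∀ n, ∀ x ∈ morseTerm k M (n + 1),
    morseDiff k M n x = 0 ↔ ∃ y ∈ morseTerm k M (n + 2), morseDiff k M (n + 1) y = ⇑x
  exact_zero : ∀ x ∈ morseTerm k M 0,
    augmentation k M x = 0 ↔ ∃ y ∈ morseTerm k M 1, morseDiff k M 0 y = ⇑x
  surjective : ∀ a : Alg k μ, ∃ x ∈ morseTerm k M 0, augmentation k M x = a

/-- The Morse complex of `M` is minimal: all components of the differential lie in the ideal
generated by the arrows. -/
def IsMinimal {μ : (Fin N → ℤ) →+ Γ} (M : Set (AnyCell μ × AnyCell μ)) : Prop :=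
  ∀ n (η : Crit M (n + 1)) (σ : Crit M n), morseCoeff k M η.1 σ.1 ∈ arrowIdeal k μ

end Morse

end BondalRuan

end

/-! The proof is algebraic discrete Morse theory on the normalized bar complex of the category of
vertices and monomials. Directability enters only through `IsDirected`: every arrow is a variable,
and the smallest variable of a nontrivial monomial between vertices splits off at a vertex. In
particular path length is polynomial degree.

A cell is a word of nontrivial monomials, its blocks. Read it as long as the blocks are single
variables that strictly decrease. If the next block has degree at least two and its smallest
variable is smaller still, split the block after that variable; if its smallest variable is not
smaller than the preceding one, merge the block with its predecessor. The two operations are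
mutually inverse and pair all cells except the strictly decreasing words of variables. So critical
`n`-cells have total degree `n`, as in the Koszul complex of a polynomial ring.

The potential, total degree plus number of inversions between blocks, does not increase on facets
and is constant on matched pairs; a bottom that is a facet of a non-bottom of the same potential is
its partner (`facet_bot`). This triangularity gives acyclicity, and it lets the projection to the
Morse complex be defined by recursion (`MorseData.exists_linearMap`). Exactness then passes from the
bar complex, which is contracted by prepending monomials (`RightData.D_htpy_add`), to the Morse
complex (`MorseData.morse_exact`), and `RightData.finsum_pathCo` identifies the differential with
the sum over gradient paths.

Degree is lost only through the factors dropped at the two ends, so every entry of the differential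
between critical cells is homogeneous of degree one (`RightData.finsum_pathCo_mem`). This is at once
minimality and linearity. `RightData` allows two choices of right coefficients: the opposite algebra
gives the bimodule resolution, and `k`, where nontrivial monomials act by zero, gives the linear
resolution of `A₀`. -/

noncomputable section

namespace BondalRuan

/-! ### The monomial basis of the algebra. -/

section Mono

variable (k : Type*) [CommRing k] {N : ℕ} {Γ : Type*} [AddCommGroup Γ] {μ : (Fin N → ℤ) →+ Γ}

lemma isMor_zero {D : Γ} (h : D ∈ imPhi μ) : IsMor μ D 0 := ⟨h, by simpa using h⟩

lemma IsMor.add {D : Γ} {e f : Fin N →₀ ℕ} (h : IsMor μ D e)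
    (h' : IsMor μ (D - monDeg μ e) f) : IsMor μ D (e + f) :=
  ⟨h.1, by rw [map_add, ← sub_sub]; exact h'.2⟩

lemma IsMor.of_add {D : Γ} {e f : Fin N →₀ ℕ} (h : IsMor μ D (e + f))
    (he : D - monDeg μ e ∈ imPhi μ) : IsMor μ (D - monDeg μ e) f :=
  ⟨he, by rw [sub_sub, ← map_add]; exact h.2⟩

lemma mono_eq_zero {D : Γ} {e : Fin N →₀ ℕ} (h : ¬ IsMor μ D e) : mono k μ D e = 0 := dif_neg h

lemma coe_mono {D : Γ} {e : Fin N →₀ ℕ} (h : IsMor μ D e) :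
    (mono k μ D e : Matrix (Vertex μ) (Vertex μ) (MvPolynomial (Fin N) k)) =
      Matrix.single ⟨D, h.1⟩ ⟨D - monDeg μ e, h.2⟩ (MvPolynomial.monomial e 1) := by
  classical
  rw [mono, dif_pos h]

/-- The hypothesis on `e` matters: if `D - monDeg μ e` is not a vertex, the left side is zero while
`e + f` may still be a morphism from `D`. -/
lemma mono_mul {D : Γ} {e : Fin N →₀ ℕ} (h : IsMor μ D e) (f : Fin N →₀ ℕ) :
    mono k μ D e * mono k μ (D - monDeg μ e) f = mono k μ D (e + f) := by
  by_cases hf : IsMor μ (D - monDeg μ e) f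
  · have hef := h.add hf
    apply Subtype.ext
    rw [Subalgebra.coe_mul, coe_mono k h, coe_mono k hf, coe_mono k hef, Matrix.single_mul_single_same, MvPolynomial.monomial_mul, one_mul]
    congr 1
    simp [sub_sub]
  · rw [mono_eq_zero k hf, mono_eq_zero k fun h' => hf (h'.of_add h.2), mul_zero]

lemma mono_mul_of_ne {D D' : Γ} {e : Fin N →₀ ℕ} (h : D - monDeg μ e ≠ D') (f : Fin N →₀ ℕ) :
    mono k μ D e * mono k μ D' f = 0 := by
  by_cases he : IsMor μ D e
  · by_cases hf : IsMor μ D' f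
    · apply Subtype.ext
      rw [Subalgebra.coe_mul, coe_mono k he, coe_mono k hf, Matrix.single_mul_single_of_ne]
      · rfl
      · simpa using h
    · rw [mono_eq_zero k hf, mul_zero]
  · rw [mono_eq_zero k he, zero_mul]

lemma mono_mul_eq {D D' : Γ} {e : Fin N →₀ ℕ} (he : IsMor μ D e) (h : D - monDeg μ e = D')
    (f : Fin N →₀ ℕ) : mono k μ D e * mono k μ D' f = mono k μ D (e + f) := by
  subst h; exact mono_mul k he f

lemma mono_zero_mul {D : Γ} (e : Fin N →₀ ℕ) : mono k μ D 0 * mono k μ D e = mono k μ D e := by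
  by_cases h : D ∈ imPhi μ
  · rw [mono_mul_eq k (isMor_zero h) (by simp), zero_add]
  · rw [mono_eq_zero k fun h' => h h'.1, mono_eq_zero k fun h' => h h'.1, mul_zero]

lemma mono_mul_zero {D D' : Γ} {e : Fin N →₀ ℕ} (h : D - monDeg μ e = D') :
    mono k μ D e * mono k μ D' 0 = mono k μ D e := by
  by_cases he : IsMor μ D e
  · rw [mono_mul_eq k he h, add_zero]
  · rw [mono_eq_zero k he, zero_mul]

/-- The coefficient at the monomial `x ^ e` from `D` to `D - deg e`. -/
def monoCoeff (x : {x : Γ × (Fin N →₀ ℕ) // IsMor μ x.1 x.2}) : Alg k μ →ₗ[k] k where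
  toFun a := (a.1 ⟨x.1.1, x.2.1⟩ ⟨_, x.2.2⟩).coeff x.1.2
  map_add' a b := by simp
  map_smul' c a := by simp

open Classical in
lemma monoCoeff_mono (x y : {x : Γ × (Fin N →₀ ℕ) // IsMor μ x.1 x.2}) :
    monoCoeff k x (mono k μ y.1.1 y.1.2) = if x = y then 1 else 0 := by
  rw [mono, dif_pos y.2]
  simp only [monoCoeff, LinearMap.coe_mk, AddHom.coe_mk, Matrix.single_apply, Subtype.mk.injEq]
  split_ifs with h1 h2 h2
  · rw [h2, MvPolynomial.coeff_monomial, if_pos rfl]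
  · rw [MvPolynomial.coeff_monomial, if_neg]
    intro h; exact h2 (Subtype.ext (Prod.ext h1.1.symm h.symm))
  · exact absurd ⟨by rw [h2], by rw [h2]⟩ h1
  · simp

open Classical in
lemma mono_span : ⊤ ≤ Submodule.span k (Set.range fun x : {x : Γ × (Fin N →₀ ℕ) //
    IsMor μ x.1 x.2} => mono k μ x.1.1 x.1.2) := by
  rintro a -
  have key : a = ∑ D : Vertex μ, ∑ E : Vertex μ, ∑ e ∈ (a.1 D E).support,
      (a.1 D E).coeff e • mono k μ (D : Γ) e := by
    have h1 : ∀ D E : Vertex μ, ∀ e ∈ (a.1 D E).support, (mono k μ (D : Γ) e).1 =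
        Matrix.single D E (MvPolynomial.monomial e 1) := by
      intro D E e he
      -- Homogeneity of the entry forces the degree of each monomial occurring in it, hence its end
      -- vertex.
      have h := a.2 D E (MvPolynomial.mem_support_iff.1 he)
      have hE : (D : Γ) - monDeg μ e = E := by
        have : monDeg μ e = (D : Γ) - E := h
        rw [this, sub_sub_cancel]
      have hm : IsMor μ (D : Γ) e := ⟨D.2, by rw [hE]; exact E.2⟩
      rw [mono, dif_pos hm]
      simp only [hE]
    apply Subtype.ext
    simp only [AddSubmonoidClass.coe_finsetSum]
    conv_lhs => rw [Matrix.matrix_eq_sum_single a.1]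
    refine Finset.sum_congr rfl fun D _ => Finset.sum_congr rfl fun E _ => ?_
    conv_lhs => rw [(a.1 D E).as_sum]
    rw [show Matrix.single D E = ⇑(Matrix.singleAddMonoidHom D E) from rfl, map_sum]
    refine Finset.sum_congr rfl fun e he => ?_
    rw [Subalgebra.coe_smul, h1 D E e he]
    simp [Matrix.smul_single, MvPolynomial.smul_monomial]
  rw [key]
  refine Submodule.sum_mem _ fun D _ => Submodule.sum_mem _ fun E _ => Submodule.sum_mem _
    fun e _ => Submodule.smul_mem _ _ ?_
  by_cases h : IsMor μ (D : Γ) e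
  · exact Submodule.subset_span ⟨⟨(D, e), h⟩, rfl⟩
  · rw [mono_eq_zero k h]; exact zero_mem _

lemma mono_linearIndependent : LinearIndependent k (fun x : {x : Γ × (Fin N →₀ ℕ) //
    IsMor μ x.1 x.2} => mono k μ x.1.1 x.1.2) := by
  classical
  rw [linearIndependent_iff']
  intro s g hg x hx
  have := congrArg (monoCoeff k x) hg
  simpa [map_sum, monoCoeff_mono, hx] using this

/-- The monomials between vertices form a basis of `A_Φ`. -/
def monoBasis (μ : (Fin N → ℤ) →+ Γ) :
    Module.Basis {x : Γ × (Fin N →₀ ℕ) // IsMor μ x.1 x.2} k (Alg k μ) :=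
  Module.Basis.mk (mono_linearIndependent k) (mono_span k)

lemma monoBasis_apply (x : {x : Γ × (Fin N →₀ ℕ) // IsMor μ x.1 x.2}) :
    monoBasis k μ x = mono k μ x.1.1 x.1.2 := by simp [monoBasis]

lemma mono_induction {P : Alg k μ → Prop} (h0 : P 0) (hadd : ∀ a b, P a → P b → P (a + b))
    (hmono : ∀ (c : k) D e, IsMor μ D e → P (c • mono k μ D e)) (a : Alg k μ) : P a := by
  have ha := mono_span k (μ := μ) (Submodule.mem_top (x := a))
  -- The statement is strengthened to all scalar multiples, because `P` is not assumed to be closed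
  -- under scalars.
  have := Submodule.span_induction (p := fun a _ => ∀ c : k, P (c • a)) ?_ ?_ ?_ ?_ ha
  · simpa using this 1
  · rintro _ ⟨x, rfl⟩ c; exact hmono c _ _ x.2
  · intro c; simpa using h0
  · intro x y _ _ hx hy c; rw [smul_add]; exact hadd _ _ (hx c) (hy c)
  · intro c x _ hx c'; rw [smul_smul]; exact hx _

lemma sum_mono_zero : ∑ D : Vertex μ, mono k μ (D : Γ) 0 = 1 := by
  classical
  apply Subtype.ext
  rw [AddSubmonoidClass.coe_finsetSum]
  apply Matrix.ext
  intro D E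
  have : ∀ D : Vertex μ, (mono k μ (D : Γ) 0).1 = Matrix.single D D (1 : MvPolynomial (Fin N) k) := by
    intro D
    rw [mono, dif_pos (isMor_zero D.2)]
    simp
  simp only [this]
  rw [Matrix.sum_apply]
  simp only [Matrix.single_apply]
  change _ = (1 : Matrix (Vertex μ) (Vertex μ) (MvPolynomial (Fin N) k)) D E
  rw [Matrix.one_apply]
  split_ifs with h
  · subst h; simp
  · exact Finset.sum_eq_zero fun x _ => if_neg fun h' => h (h'.1.symm.trans h'.2)

lemma mono_injective [Nontrivial k] {D : Γ} {e f : Fin N →₀ ℕ} (h : IsMor μ D e)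
    (hf : IsMor μ D f) (hef : mono k μ D e = mono k μ D f) : e = f := by
  rw [← monoBasis_apply k ⟨(D, e), h⟩, ← monoBasis_apply k ⟨(D, f), hf⟩] at hef
  exact congrArg (fun x => x.1.2) ((monoBasis k μ).injective hef)

end Mono

end BondalRuan

/-! ### Algebraic discrete Morse theory -/

/-- A based complex over a ring, where the basis element `x` is cut down by the idempotent `e x`,
together with a matching of basis elements: `U` are the basis elements that are matched with a basis
element `up u` of larger degree, `C` are the critical ones. -/
structure MorseData (R : Type*) [Ring R] (X : ℕ → Type*) where
  e : ∀ {n}, X n → R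
  d : ∀ {n}, X (n + 1) → (X n →₀ R)
  C : ∀ {n}, X n → Prop
  U : ∀ {n}, X n → Prop
  up : ∀ {n} (u : X n), U u → X (n + 1)
  sg : ∀ {n}, X n → ℤˣ
  pot : ∀ {n}, X n → ℕ
  idem : ∀ {n} (x : X n), e x * e x = e x
  smul_d : ∀ {n} (x : X (n + 1)), e x • d x = d x
  d_mul : ∀ {n} (x : X (n + 1)) (y : X n), d x y * e y = d x y
  crit_zero : ∀ x : X 0, C x
  not_crit_of_bot : ∀ {n} (x : X n), U x → ¬ C x
  up_not_crit : ∀ {n} (u : X n) (hu : U u), ¬ C (up u hu)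
  up_not_bot : ∀ {n} (u : X n) (hu : U u), ¬ U (up u hu)
  exists_up : ∀ {n} (x : X (n + 1)), ¬ C x → ¬ U x → ∃ (u : X n) (hu : U u), up u hu = x
  e_up : ∀ {n} (u : X n) (hu : U u), e (up u hu) = e u
  -- Taking `v = u` forces the coefficient of `u` to be exactly `± e u`, since `pot u < pot u` is
  -- absurd; the other `v` give triangularity.
  pot_lt : ∀ {n} (u : X n) (hu : U u), ∀ v, U v →
    (d (up u hu) - Finsupp.single u ((sg u : ℤ) • e u)) v ≠ 0 → pot v < pot u

namespace MorseData

variable {R : Type*} [Ring R] {X : ℕ → Type*} (𝓜 : MorseData R X)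

/-- The submodule `⨁ R e_x` of the free module. -/
def sub (n : ℕ) : Submodule R (X n →₀ R) where
  carrier := {x | ∀ y, x y * 𝓜.e y = x y}
  add_mem' := by
    intro a b ha hb y
    rw [Finsupp.add_apply, add_mul, ha y, hb y]
  zero_mem' := by intro y; simp
  smul_mem' := by
    intro c a ha y
    rw [Finsupp.smul_apply, smul_eq_mul, mul_assoc, ha y]

/-- The differential. -/
def D (n : ℕ) : (X (n + 1) →₀ R) →ₗ[R] (X n →₀ R) :=
  Finsupp.linearCombination R 𝓜.d

lemma D_single {n : ℕ} (x : X (n + 1)) (r : R) : 𝓜.D n (Finsupp.single x r) = r • 𝓜.d x := by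
  simp [D]

lemma D_mem {n : ℕ} (x : X (n + 1) →₀ R) : 𝓜.D n x ∈ 𝓜.sub n := by
  induction x using Finsupp.induction_linear with
  | zero => rw [map_zero]; exact zero_mem _
  | add x y hx hy => rw [map_add]; exact add_mem hx hy
  | single x r => rw [D_single]; exact Submodule.smul_mem _ _ (𝓜.d_mul x)

lemma sub_eq_sum {n : ℕ} {x : X n →₀ R} (hx : x ∈ 𝓜.sub n) :
    x = x.sum fun y r => r • Finsupp.single y (𝓜.e y) := by
  conv_lhs => rw [← Finsupp.sum_single x]
  refine Finsupp.sum_congr fun y _ => ?_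
  rw [Finsupp.smul_single, smul_eq_mul, hx y]

lemma single_mem {n : ℕ} (x : X n) : Finsupp.single x (𝓜.e x) ∈ 𝓜.sub n := by
  classical
  intro y
  rw [Finsupp.single_apply]
  split_ifs with h
  · rw [h, 𝓜.idem]
  · rw [zero_mul]

section Recursion

variable {Y : Type*} [AddCommGroup Y] [Module R Y] {n : ℕ} (w : X n → Y) (v : X (n + 1) → Y)

/-- The part of the differential of `up u` away from `u`. -/
def rest (u : X n) (hu : 𝓜.U u) : X n →₀ R :=
  𝓜.d (𝓜.up u hu) - Finsupp.single u ((𝓜.sg u : ℤ) • 𝓜.e u)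

open Classical in
/-- The values on basis elements of the map of `exists_linearMap`. -/
def recAux (x : X n) : Y :=
  if hx : 𝓜.U x then
    (𝓜.sg x : ℤ) • (v (𝓜.up x hx) - ∑ y ∈ (𝓜.rest x hx).support,
      -- The test makes the recursion well founded. By `pot_lt` every bottom in the support passes
      -- it, so the default value is never used for a bottom.
      𝓜.rest x hx y • (if _h : 𝓜.pot y < 𝓜.pot x then recAux y else if 𝓜.C y then w y else 0))
  else if 𝓜.C x then w x else 0
termination_by 𝓜.pot x

/-- A linear map may be prescribed on the critical basis elements and on the boundaries of the
tops, when it is to vanish on the tops. -/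
lemma exists_linearMap (hv : ∀ u hu, 𝓜.e u • v (𝓜.up u hu) = v (𝓜.up u hu)) :
    ∃ F : (X n →₀ R) →ₗ[R] Y, (∀ c r, 𝓜.C c → F (Finsupp.single c r) = r • w c) ∧
      (∀ t r, ¬ 𝓜.C t → ¬ 𝓜.U t → F (Finsupp.single t r) = 0) ∧
      ∀ u hu, F (𝓜.d (𝓜.up u hu)) = v (𝓜.up u hu) := by
  classical
  set f : X n → Y := 𝓜.recAux w v with hf
  refine ⟨Finsupp.linearCombination R f, ?_, ?_, ?_⟩
  · intro c r hc
    rw [Finsupp.linearCombination_single, hf, recAux, dif_neg fun h => 𝓜.not_crit_of_bot c h hc,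
      if_pos hc]
  · intro t r ht ht'
    rw [Finsupp.linearCombination_single, hf, recAux, dif_neg ht', if_neg ht, smul_zero]
  · intro u hu
    have h1 : f u = (𝓜.sg u : ℤ) • (v (𝓜.up u hu) - Finsupp.linearCombination R f (𝓜.rest u hu)) := by
      conv_lhs => rw [hf, recAux, dif_pos hu]
      rw [Finsupp.linearCombination_apply, Finsupp.sum]
      congr 2
      refine Finset.sum_congr rfl fun y hy => ?_
      split_ifs with h2 h3
      · rfl
      · rw [hf, recAux, dif_neg fun h => 𝓜.not_crit_of_bot y h h3, if_pos h3]
      · by_cases h4 : 𝓜.U y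
        · exact absurd (𝓜.pot_lt u hu y h4 (Finsupp.mem_support_iff.1 hy)) h2
        · rw [hf, recAux, dif_neg h4, if_neg h3]
    have h2 : 𝓜.d (𝓜.up u hu) = 𝓜.rest u hu + Finsupp.single u ((𝓜.sg u : ℤ) • 𝓜.e u) := by
      rw [rest, sub_add_cancel]
    -- The coefficient of `u` in its boundary is `± e u` and not a unit, so solving for the value at
    -- `u` gives the prescribed value only up to `e u`; this identity and `hv` absorb the
    -- idempotent.
    have h3 : 𝓜.e u • 𝓜.rest u hu = 𝓜.rest u hu := by
      rw [rest, smul_sub, ← 𝓜.e_up u hu, 𝓜.smul_d, Finsupp.smul_single, smul_eq_mul,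
        mul_smul_comm, 𝓜.idem]
    have hs : (𝓜.sg u : ℤ) * (𝓜.sg u : ℤ) = 1 := by
      rw [← Units.val_mul, Int.units_mul_self, Units.val_one]
    rw [h2, map_add, Finsupp.linearCombination_single, h1, smul_assoc, smul_comm (𝓜.e u), smul_smul,
      hs, one_smul, smul_sub, hv u hu, ← map_smul, h3, add_sub_cancel]

end Recursion

/-- The basis of the Morse complex. -/
abbrev Critical (n : ℕ) : Type _ := {x : X n // 𝓜.C x}

/-- `Φ` is the projection to the Morse complex. -/
structure IsProj {n : ℕ} (Φ : (X n →₀ R) →ₗ[R] (𝓜.Critical n →₀ R)) : Prop where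
  crit : ∀ (c : 𝓜.Critical n) r, Φ (Finsupp.single c.1 r) = Finsupp.single c r
  top : ∀ t r, ¬ 𝓜.C t → ¬ 𝓜.U t → Φ (Finsupp.single t r) = 0
  d_up : ∀ u hu, Φ (𝓜.d (𝓜.up u hu)) = 0

lemma exists_isProj (n : ℕ) : ∃ Φ, 𝓜.IsProj (n := n) Φ := by
  classical
  obtain ⟨F, h1, h2, h3⟩ := 𝓜.exists_linearMap (n := n)
    (fun x => if h : 𝓜.C x then Finsupp.single (⟨x, h⟩ : 𝓜.Critical n) (1 : R) else 0)
    (fun _ => 0) (fun _ _ => smul_zero _)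
  refine ⟨F, ?_, h2, h3⟩
  intro c r
  rw [h1 _ _ c.2, dif_pos c.2, Finsupp.smul_single, smul_eq_mul, mul_one]

/-- The projection `Φ`. -/
def proj (n : ℕ) : (X n →₀ R) →ₗ[R] (𝓜.Critical n →₀ R) := (𝓜.exists_isProj n).choose

lemma isProj_proj (n : ℕ) : 𝓜.IsProj (𝓜.proj n) := (𝓜.exists_isProj n).choose_spec

/-- The inclusion of the critical basis elements. -/
def incl (n : ℕ) : (𝓜.Critical n →₀ R) →ₗ[R] (X n →₀ R) := Finsupp.lmapDomain R R Subtype.val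

lemma incl_single {n : ℕ} (c : 𝓜.Critical n) (r : R) :
    𝓜.incl n (Finsupp.single c r) = Finsupp.single c.1 r := by
  simp [incl, Finsupp.mapDomain_single]

lemma proj_incl {n : ℕ} (x : 𝓜.Critical n →₀ R) : 𝓜.proj n (𝓜.incl n x) = x := by
  induction x using Finsupp.induction_linear with
  | zero => simp
  | add x y hx hy => rw [map_add, map_add, hx, hy]
  | single c r => rw [incl_single, (𝓜.isProj_proj n).crit]

/-- The differential of the Morse complex. -/
def morseD (n : ℕ) : (𝓜.Critical (n + 1) →₀ R) →ₗ[R] (𝓜.Critical n →₀ R) :=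
  𝓜.proj n ∘ₗ 𝓜.D n ∘ₗ 𝓜.incl (n + 1)

lemma morseD_single {n : ℕ} (c : 𝓜.Critical (n + 1)) (r : R) :
    𝓜.morseD n (Finsupp.single c r) = r • 𝓜.proj n (𝓜.d c.1) := by
  rw [morseD, LinearMap.comp_apply, LinearMap.comp_apply, incl_single, D_single, map_smul]

/-- The submodule `⨁ R e_x` over the critical basis elements. -/
def critSub (n : ℕ) : Submodule R (𝓜.Critical n →₀ R) where
  carrier := {x | ∀ y, x y * 𝓜.e y.1 = x y}
  add_mem' := by
    intro a b ha hb y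
    rw [Finsupp.add_apply, add_mul, ha y, hb y]
  zero_mem' := by intro y; simp
  smul_mem' := by
    intro c a ha y
    rw [Finsupp.smul_apply, smul_eq_mul, mul_assoc, ha y]

lemma critSub_eq_sum {n : ℕ} {x : 𝓜.Critical n →₀ R} (hx : x ∈ 𝓜.critSub n) :
    x = x.sum fun y r => r • Finsupp.single y (𝓜.e y.1) := by
  conv_lhs => rw [← Finsupp.sum_single x]
  refine Finsupp.sum_congr fun y _ => ?_
  rw [Finsupp.smul_single, smul_eq_mul, hx y]

lemma critSingle_mem {n : ℕ} (x : 𝓜.Critical n) : Finsupp.single x (𝓜.e x.1) ∈ 𝓜.critSub n := by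
  classical
  intro y
  rw [Finsupp.single_apply]
  split_ifs with h
  · rw [h, 𝓜.idem]
  · rw [zero_mul]

lemma incl_mem {n : ℕ} {x : 𝓜.Critical n →₀ R} (hx : x ∈ 𝓜.critSub n) : 𝓜.incl n x ∈ 𝓜.sub n := by
  rw [𝓜.critSub_eq_sum hx, map_finsuppSum]
  refine Submodule.sum_mem _ fun y _ => ?_
  dsimp only
  rw [map_smul, incl_single]
  exact Submodule.smul_mem _ _ (𝓜.single_mem _)

/-- Induction on the generators of `sub` by the potential. -/
lemma bot_induction {n : ℕ} {P : X n → Prop} (hc : ∀ c, 𝓜.C c → P c)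
    (ht : ∀ t, ¬ 𝓜.C t → ¬ 𝓜.U t → P t)
    (hu : ∀ u hu, (∀ y, 𝓜.rest u hu y ≠ 0 → P y) → P u) (x : X n) : P x := by
  induction hp : 𝓜.pot x using Nat.strong_induction_on generalizing x with
  | _ m ih =>
    by_cases h1 : 𝓜.U x
    · refine hu x h1 fun y hy => ?_
      by_cases h2 : 𝓜.U y
      · exact ih _ (hp ▸ 𝓜.pot_lt x h1 y h2 hy) y rfl
      · by_cases h3 : 𝓜.C y
        · exact hc y h3
        · exact ht y h3 h2
    · by_cases h3 : 𝓜.C x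
      · exact hc x h3
      · exact ht x h3 h1

/-- Solves the boundary of `up u` for `u`. Together with `bot_induction` this expresses bottoms
through critical cells, tops and boundaries of tops. -/
lemma single_bot {n : ℕ} (u : X n) (hu : 𝓜.U u) : Finsupp.single u (𝓜.e u) =
    (𝓜.sg u : ℤ) • (𝓜.d (𝓜.up u hu) - (𝓜.rest u hu).sum fun y r => r • Finsupp.single y (1 : R)) := by
  have hs : (𝓜.sg u : ℤ) * (𝓜.sg u : ℤ) = 1 := by
    rw [← Units.val_mul, Int.units_mul_self, Units.val_one]
  have : ((𝓜.rest u hu).sum fun y r => r • Finsupp.single y (1 : R)) = 𝓜.rest u hu := by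
    simp only [Finsupp.smul_single, smul_eq_mul, mul_one]
    exact Finsupp.sum_single _
  rw [this, rest, sub_sub_cancel, Finsupp.smul_single, smul_smul, hs, one_smul]

lemma rest_mul {n : ℕ} {u : X n} (hu : 𝓜.U u) (y : X n) : 𝓜.rest u hu y * 𝓜.e y = 𝓜.rest u hu y := by
  have h : 𝓜.rest u hu ∈ 𝓜.sub n := by
    refine sub_mem (𝓜.d_mul _) ?_
    rw [← Finsupp.smul_single]
    exact zsmul_mem (𝓜.single_mem u) _
  exact h y

lemma single_bot' {n : ℕ} (u : X n) (hu : 𝓜.U u) : Finsupp.single u (𝓜.e u) =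
    (𝓜.sg u : ℤ) • (𝓜.d (𝓜.up u hu) - (𝓜.rest u hu).sum fun y r => r • Finsupp.single y (𝓜.e y)) := by
  conv_lhs => rw [𝓜.single_bot u hu]
  congr 2
  refine Finsupp.sum_congr fun y _ => ?_
  rw [Finsupp.smul_single, Finsupp.smul_single, smul_eq_mul, smul_eq_mul, rest_mul, mul_one]

lemma proj_mem {n : ℕ} {x : X n →₀ R} (hx : x ∈ 𝓜.sub n) : 𝓜.proj n x ∈ 𝓜.critSub n := by
  have key : ∀ x : X n, 𝓜.proj n (Finsupp.single x (𝓜.e x)) ∈ 𝓜.critSub n := by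
    intro x
    induction x using 𝓜.bot_induction with
    | hc c hc => rw [(𝓜.isProj_proj n).crit ⟨c, hc⟩]; exact 𝓜.critSingle_mem ⟨c, hc⟩
    | ht t h1 h2 => rw [(𝓜.isProj_proj n).top t _ h1 h2]; exact zero_mem _
    | hu u hu ih =>
      rw [𝓜.single_bot' u hu, map_zsmul, map_sub, (𝓜.isProj_proj n).d_up u hu, zero_sub, map_finsuppSum]
      refine zsmul_mem (neg_mem (Submodule.sum_mem _ fun y hy => ?_)) _
      dsimp only
      rw [map_smul]
      exact Submodule.smul_mem _ _ (ih y (Finsupp.mem_support_iff.1 hy))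
  rw [𝓜.sub_eq_sum hx, map_finsuppSum]
  refine Submodule.sum_mem _ fun y _ => ?_
  dsimp only
  rw [map_smul]
  exact Submodule.smul_mem _ _ (key y)

lemma morseD_mem {n : ℕ} (x : 𝓜.Critical (n + 1) →₀ R) : 𝓜.morseD n x ∈ 𝓜.critSub n :=
  𝓜.proj_mem (𝓜.D_mem _)

/-- The span of the tops. -/
def topSub (n : ℕ) : Submodule R (X n →₀ R) :=
  Submodule.span R {x | ∃ t, ¬ 𝓜.C t ∧ ¬ 𝓜.U t ∧ x = Finsupp.single t (𝓜.e t)}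

lemma topSub_le (n : ℕ) : 𝓜.topSub n ≤ 𝓜.sub n := by
  refine Submodule.span_le.2 ?_
  rintro _ ⟨t, -, -, rfl⟩
  exact 𝓜.single_mem t

lemma proj_top {n : ℕ} {x : X n →₀ R} (hx : x ∈ 𝓜.topSub n) : 𝓜.proj n x = 0 := by
  have : 𝓜.topSub n ≤ LinearMap.ker (𝓜.proj n) := by
    refine Submodule.span_le.2 ?_
    rintro _ ⟨t, h1, h2, rfl⟩
    exact (𝓜.isProj_proj n).top t _ h1 h2
  exact this hx

/-- A top serves as its own `t`; a bottom is traded for the boundary of a top and the terms of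
`rest`, which are covered by `bot_induction`. -/
lemma exists_decomp {n : ℕ} {x : X n →₀ R} (hx : x ∈ 𝓜.sub n) :
    ∃ t ∈ 𝓜.topSub n, ∃ t' ∈ 𝓜.topSub (n + 1), x = 𝓜.incl n (𝓜.proj n x) + t + 𝓜.D n t' := by
  let T : Submodule R (X n →₀ R) := 𝓜.topSub n ⊔ (𝓜.topSub (n + 1)).map (𝓜.D n)
  let f : (X n →₀ R) →ₗ[R] (X n →₀ R) := LinearMap.id - 𝓜.incl n ∘ₗ 𝓜.proj n
  have key : ∀ x : X n, f (Finsupp.single x (𝓜.e x)) ∈ T := by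
    intro x
    induction x using 𝓜.bot_induction with
    | hc c hc =>
      have : f (Finsupp.single c (𝓜.e c)) = 0 := by
        simp [f, (𝓜.isProj_proj n).crit ⟨c, hc⟩, incl_single]
      rw [this]; exact zero_mem _
    | ht t h1 h2 =>
      have : f (Finsupp.single t (𝓜.e t)) = Finsupp.single t (𝓜.e t) := by
        simp [f, (𝓜.isProj_proj n).top t _ h1 h2]
      rw [this]
      exact Submodule.mem_sup_left (Submodule.subset_span ⟨t, h1, h2, rfl⟩)
    | hu u hu ih =>
      rw [𝓜.single_bot' u hu, map_zsmul, map_sub]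
      refine zsmul_mem (sub_mem ?_ ?_) _
      · have : f (𝓜.d (𝓜.up u hu)) = 𝓜.d (𝓜.up u hu) := by
          simp [f, (𝓜.isProj_proj n).d_up u hu]
        rw [this]
        refine Submodule.mem_sup_right ⟨Finsupp.single (𝓜.up u hu) (𝓜.e (𝓜.up u hu)), ?_, ?_⟩
        · exact Submodule.subset_span ⟨_, 𝓜.up_not_crit u hu, 𝓜.up_not_bot u hu, rfl⟩
        · rw [D_single, 𝓜.smul_d]
      · rw [map_finsuppSum]
        refine Submodule.sum_mem _ fun y hy => ?_
        dsimp only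
        rw [map_smul]
        exact Submodule.smul_mem _ _ (ih y (Finsupp.mem_support_iff.1 hy))
  have h : f x ∈ T := by
    rw [𝓜.sub_eq_sum hx, map_finsuppSum]
    refine Submodule.sum_mem _ fun y _ => ?_
    dsimp only
    rw [map_smul]
    exact Submodule.smul_mem _ _ (key y)
  obtain ⟨t, ht, _, ⟨t', ht', rfl⟩, h'⟩ := Submodule.mem_sup.1 h
  refine ⟨t, ht, t', ht', ?_⟩
  have : f x = x - 𝓜.incl n (𝓜.proj n x) := rfl
  rw [add_assoc, h', this, add_sub_cancel]

/-- Triangularity makes the differential injective on tops: the recursion yields a left inverse `θ`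
that sends the boundary of each top back to that top. -/
lemma top_eq_zero {n : ℕ} {x : X (n + 1) →₀ R} (hx : x ∈ 𝓜.topSub (n + 1)) (h : 𝓜.D n x = 0) :
    x = 0 := by
  obtain ⟨θ, -, -, h3⟩ := 𝓜.exists_linearMap (n := n) (fun _ => (0 : X (n + 1) →₀ R))
    (fun t => Finsupp.single t (𝓜.e t)) (fun u hu => by
      rw [Finsupp.smul_single, 𝓜.e_up u hu, smul_eq_mul, 𝓜.idem])
  have : ∀ x ∈ 𝓜.topSub (n + 1), θ (𝓜.D n x) = x := by
    intro x hx
    induction hx using Submodule.span_induction with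
    | mem x hx =>
      obtain ⟨t, h1, h2, rfl⟩ := hx
      obtain ⟨u, hu, rfl⟩ := 𝓜.exists_up t h1 h2
      rw [D_single, 𝓜.smul_d, h3 u hu]
    | zero => simp
    | add x y _ _ hx hy => rw [map_add, map_add, hx, hy]
    | smul r x _ hx => rw [map_smul, map_smul, hx]
  rw [← this x hx, h, map_zero]

lemma topSub_zero {x : X 0 →₀ R} (hx : x ∈ 𝓜.topSub 0) : x = 0 := by
  have : 𝓜.topSub 0 ≤ ⊥ := by
    refine Submodule.span_le.2 ?_
    rintro _ ⟨t, h1, -, -⟩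
    exact absurd (𝓜.crit_zero t) h1
  simpa using this hx

section Complex

variable (hdd : ∀ n (x : X (n + 2) →₀ R), x ∈ 𝓜.sub (n + 2) → 𝓜.D n (𝓜.D (n + 1) x) = 0)

include hdd

/-- In the decomposition of `x`, the term `t` does not contribute because `proj` kills boundaries of
tops, and `D t'` does not because the differential squares to zero. -/
lemma morseD_proj {n : ℕ} {x : X (n + 1) →₀ R} (hx : x ∈ 𝓜.sub (n + 1)) :
    𝓜.morseD n (𝓜.proj (n + 1) x) = 𝓜.proj n (𝓜.D n x) := by
  obtain ⟨t, ht, t', ht', h⟩ := 𝓜.exists_decomp hx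
  have h1 : 𝓜.proj n (𝓜.D n t) = 0 := by
    have : 𝓜.topSub (n + 1) ≤ LinearMap.ker (𝓜.proj n ∘ₗ 𝓜.D n) := by
      refine Submodule.span_le.2 ?_
      rintro _ ⟨t, h1, h2, rfl⟩
      obtain ⟨u, hu, rfl⟩ := 𝓜.exists_up t h1 h2
      simp [D_single, 𝓜.smul_d, (𝓜.isProj_proj n).d_up u hu]
    exact this ht
  conv_rhs => rw [h, map_add, map_add, hdd n t' (𝓜.topSub_le _ ht'), map_add, map_add, map_zero,
    h1, add_zero, add_zero]
  rfl

lemma morseD_morseD {n : ℕ} {x : 𝓜.Critical (n + 2) →₀ R} (hx : x ∈ 𝓜.critSub (n + 2)) :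
    𝓜.morseD n (𝓜.morseD (n + 1) x) = 0 := by
  rw [show 𝓜.morseD (n + 1) x = 𝓜.proj (n + 1) (𝓜.D (n + 1) (𝓜.incl (n + 2) x)) from rfl,
    𝓜.morseD_proj hdd (𝓜.D_mem _), hdd n _ (𝓜.incl_mem hx), map_zero]

/-- A Morse cycle need not be a cycle of the large complex, but its boundary there equals that of a
combination `t'` of tops. Subtracting `t'`, which `proj` kills, corrects this. -/
lemma morse_exact {n : ℕ} (hex : ∀ x ∈ 𝓜.sub (n + 1), 𝓜.D n x = 0 →
    ∃ y ∈ 𝓜.sub (n + 2), 𝓜.D (n + 1) y = x) {x : 𝓜.Critical (n + 1) →₀ R}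
    (hx : x ∈ 𝓜.critSub (n + 1)) (h : 𝓜.morseD n x = 0) :
    ∃ y ∈ 𝓜.critSub (n + 2), 𝓜.morseD (n + 1) y = x := by
  set z := 𝓜.D n (𝓜.incl (n + 1) x) with hz
  obtain ⟨t, ht, t', ht', h1⟩ := 𝓜.exists_decomp (𝓜.D_mem (𝓜.incl (n + 1) x))
  rw [show 𝓜.proj n (𝓜.D n (𝓜.incl (n + 1) x)) = 0 from h, map_zero, zero_add] at h1
  -- The differential is injective on tops and `t` is a cycle; in degree zero there are no tops.
  have ht0 : t = 0 := by
    cases n with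
    | zero => exact 𝓜.topSub_zero ht
    | succ n =>
      refine 𝓜.top_eq_zero ht ?_
      have h2 := congrArg (𝓜.D n) h1
      rwa [hdd n _ (𝓜.incl_mem hx), map_add, hdd n _ (𝓜.topSub_le _ ht'), add_zero, eq_comm] at h2
  rw [ht0, zero_add] at h1
  obtain ⟨y, hy, hy'⟩ := hex (𝓜.incl (n + 1) x - t') (sub_mem (𝓜.incl_mem hx) (𝓜.topSub_le _ ht'))
    (by rw [map_sub, h1, sub_self])
  refine ⟨𝓜.proj (n + 2) y, 𝓜.proj_mem hy, ?_⟩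
  rw [𝓜.morseD_proj hdd hy, hy', map_sub, proj_incl, 𝓜.proj_top ht', sub_zero]

end Complex

lemma proj_zero_eq (x : X 0 →₀ R) : 𝓜.incl 0 (𝓜.proj 0 x) = x := by
  induction x using Finsupp.induction_linear with
  | zero => simp
  | add x y hx hy => rw [map_add, map_add, hx, hy]
  | single c r => rw [(𝓜.isProj_proj 0).crit ⟨c, 𝓜.crit_zero c⟩, incl_single]

end MorseData

namespace BondalRuan

/-! ### Words of monomials -/

section Words

variable {N : ℕ} (ord : Fin N → ℕ)

lemma exists_head {e : Fin N →₀ ℕ} (he : e ≠ 0) :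
    ∃ i ∈ e.support, ∀ j ∈ e.support, ord i ≤ ord j :=
  Finset.exists_min_image _ _ (Finsupp.support_nonempty_iff.2 he)

open Classical in
/-- The smallest variable of a monomial. -/
def headMon (e : Fin N →₀ ℕ) : Fin N →₀ ℕ :=
  if h : e ≠ 0 then Finsupp.single (exists_head ord h).choose 1 else 0

open Classical in
/-- The position of the smallest variable of a monomial. -/
def headOrd (e : Fin N →₀ ℕ) : ℕ :=
  if h : e ≠ 0 then ord (exists_head ord h).choose else 0

lemma head_spec {e : Fin N →₀ ℕ} (he : e ≠ 0) : ∃ i ∈ e.support,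
    headMon ord e = Finsupp.single i 1 ∧ headOrd ord e = ord i ∧ ∀ j ∈ e.support, ord i ≤ ord j := by
  refine ⟨_, (exists_head ord he).choose_spec.1, ?_, ?_, (exists_head ord he).choose_spec.2⟩
  · rw [headMon, dif_pos he]
  · rw [headOrd, dif_pos he]

lemma headOrd_le {e : Fin N →₀ ℕ} {j : Fin N} (hj : j ∈ e.support) : headOrd ord e ≤ ord j := by
  have he : e ≠ 0 := by rintro rfl; simp at hj
  obtain ⟨i, -, -, h, h'⟩ := head_spec ord he
  rw [h]; exact h' j hj

lemma le_headOrd {e : Fin N →₀ ℕ} (he : e ≠ 0) {m : ℕ} (h : ∀ j ∈ e.support, m ≤ ord j) :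
    m ≤ headOrd ord e := by
  obtain ⟨i, hi, -, h', -⟩ := head_spec ord he
  rw [h']; exact h i hi

lemma headMon_le {e : Fin N →₀ ℕ} : headMon ord e ≤ e := by
  by_cases he : e = 0
  · simp [headMon, he]
  · obtain ⟨i, hi, h, -⟩ := head_spec ord he
    rw [h, Finsupp.single_le_iff]
    exact Nat.one_le_iff_ne_zero.2 (Finsupp.mem_support_iff.1 hi)

lemma degree_headMon {e : Fin N →₀ ℕ} (he : e ≠ 0) : (headMon ord e).degree = 1 := by
  obtain ⟨i, hi, h, -⟩ := head_spec ord he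
  rw [h, Finsupp.degree_single]

lemma headMon_ne_zero {e : Fin N →₀ ℕ} (he : e ≠ 0) : headMon ord e ≠ 0 := by
  intro h
  have := degree_headMon ord he
  simp [h] at this

lemma headOrd_headMon {e : Fin N →₀ ℕ} (he : e ≠ 0) :
    headOrd ord (headMon ord e) = headOrd ord e := by
  obtain ⟨i, hi, h, h', -⟩ := head_spec ord he
  obtain ⟨j, hj, -, h3, -⟩ := head_spec ord (headMon_ne_zero ord he)
  rw [h3, h']
  rw [h] at hj
  have : j = i := by simpa [eq_comm] using Finsupp.support_single_subset hj
  rw [this]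

lemma headMon_add {e : Fin N →₀ ℕ} : headMon ord e + (e - headMon ord e) = e :=
  add_tsub_cancel_of_le (headMon_le ord)

lemma degree_pos {e : Fin N →₀ ℕ} (he : e ≠ 0) : 0 < e.degree := by
  rw [Nat.pos_iff_ne_zero, Ne, Finsupp.degree_eq_zero_iff]; exact he

lemma headMon_of_degree {e : Fin N →₀ ℕ} (he : e.degree = 1) : headMon ord e = e := by
  have h0 : e ≠ 0 := by rintro rfl; simp at he
  have h1 := headMon_add ord (e := e)
  have h2 := congrArg Finsupp.degree h1
  rw [map_add, degree_headMon _ h0, he] at h2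
  have h3 : e - headMon ord e = 0 := (Finsupp.degree_eq_zero_iff _).1 (by omega)
  rw [h3, add_zero] at h1
  exact h1

/-- The number of inversions between the letters of `e` and those of `f`. -/
def bil (e f : Fin N →₀ ℕ) : ℕ :=
  ∑ a, ∑ b, if ord b < ord a then e a * f b else 0

lemma bil_add_left (e e' f : Fin N →₀ ℕ) : bil ord (e + e') f = bil ord e f + bil ord e' f := by
  simp only [bil, ← Finset.sum_add_distrib]
  refine Finset.sum_congr rfl fun a _ => Finset.sum_congr rfl fun b _ => ?_
  split_ifs <;> simp [add_mul]

lemma bil_add_right (e f f' : Fin N →₀ ℕ) : bil ord e (f + f') = bil ord e f + bil ord e f' := by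
  simp only [bil, ← Finset.sum_add_distrib]
  refine Finset.sum_congr rfl fun a _ => Finset.sum_congr rfl fun b _ => ?_
  split_ifs <;> simp [mul_add]

lemma bil_mono_right (e : Fin N →₀ ℕ) {f f' : Fin N →₀ ℕ} (h : f ≤ f') :
    bil ord e f ≤ bil ord e f' := by
  rw [← add_tsub_cancel_of_le h, bil_add_right]; exact Nat.le_add_right _ _

lemma bil_eq_zero {e f : Fin N →₀ ℕ} :
    bil ord e f = 0 ↔ ∀ a ∈ e.support, ∀ b ∈ f.support, ord a ≤ ord b := by
  simp only [bil, Finset.sum_eq_zero_iff, Finset.mem_univ, true_implies, Finsupp.mem_support_iff]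
  constructor
  · intro h a ha b hb
    by_contra! hab
    have := h a b
    rw [if_pos hab, mul_eq_zero] at this
    tauto
  · intro h a b
    split_ifs with hab
    · by_contra h0
      have := h a (left_ne_zero_of_mul h0) b (right_ne_zero_of_mul h0)
      omega
    · rfl

/-- This is why splitting off the smallest variable creates no inversion and preserves the
potential. -/
lemma bil_headMon {e : Fin N →₀ ℕ} : bil ord (headMon ord e) (e - headMon ord e) = 0 := by
  by_cases he : e = 0
  · simp [he, headMon, bil]
  obtain ⟨i, hi, h, -, h'⟩ := head_spec ord he
  rw [bil_eq_zero]
  intro a ha b hb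
  rw [h] at ha
  have : a = i := by simpa [eq_comm] using Finsupp.support_single_subset ha
  rw [this]
  exact h' b (Finsupp.support_mono tsub_le_self hb)

/-- The number of inversions between distinct blocks. -/
def inv : List (Fin N →₀ ℕ) → ℕ
  | [] => 0
  | e :: L => bil ord e L.sum + inv L

/-- The blocks are single variables, strictly decreasing and below `b`. -/
def CritWord : ℕ → List (Fin N →₀ ℕ) → Prop
  | _, [] => True
  | b, e :: L => headOrd ord e < b ∧ e.degree = 1 ∧ CritWord (headOrd ord e) L

/-- After a strictly decreasing sequence of variables below `b` there is a block of degree at least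
two whose smallest variable is still smaller. -/
def BotWord : ℕ → List (Fin N →₀ ℕ) → Prop
  | _, [] => False
  | b, e :: L => headOrd ord e < b ∧ (2 ≤ e.degree ∨ e.degree = 1 ∧ BotWord (headOrd ord e) L)

/-- The first block of degree at least two is split after its smallest variable. -/
def upWord : List (Fin N →₀ ℕ) → List (Fin N →₀ ℕ)
  | [] => []
  | e :: L => if 2 ≤ e.degree then headMon ord e :: (e - headMon ord e) :: L else e :: upWord L

/-- The facets in terms of blocks. -/
def facetWord : ℕ → List (Fin N →₀ ℕ) → List (Fin N →₀ ℕ)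
  | 0, L => L.tail
  | _ + 1, [] => []
  | _ + 1, [_] => []
  | 1, e :: f :: L => (e + f) :: L
  | i + 2, e :: f :: L => e :: facetWord (i + 1) (f :: L)

variable {ord}

lemma sub_headMon_ne_zero {e : Fin N →₀ ℕ} (h : 2 ≤ e.degree) : e - headMon ord e ≠ 0 := by
  have he : e ≠ 0 := by rintro rfl; simp at h
  intro h0
  have h2 := congrArg Finsupp.degree (headMon_add ord (e := e))
  rw [map_add, degree_headMon _ he, h0] at h2
  simp at h2
  omega

lemma BotWord.not_crit {b : ℕ} {L : List (Fin N →₀ ℕ)} (h : BotWord ord b L) :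
    ¬ CritWord ord b L := by
  induction L generalizing b with
  | nil => exact absurd h id
  | cons e L ih =>
    rintro ⟨-, h1, h2⟩
    rcases h.2 with h3 | h3
    · omega
    · exact ih h3.2 h2

lemma length_upWord {b : ℕ} {L : List (Fin N →₀ ℕ)} (h : BotWord ord b L) :
    (upWord ord L).length = L.length + 1 := by
  induction L generalizing b with
  | nil => exact absurd h id
  | cons e L ih =>
    rw [upWord]
    split_ifs with h2
    · rfl
    · rw [List.length_cons, ih (h.2.resolve_left h2).2, List.length_cons]

lemma exists_facetWord_upWord {b : ℕ} {L : List (Fin N →₀ ℕ)} (h : BotWord ord b L) :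
    ∃ i, 0 < i ∧ i ≤ L.length ∧ facetWord i (upWord ord L) = L := by
  induction L generalizing b with
  | nil => exact absurd h id
  | cons e L ih =>
    rw [upWord]
    split_ifs with h2
    · exact ⟨1, Nat.one_pos, by simp, by rw [facetWord, headMon_add]⟩
    · have h3 := (h.2.resolve_left h2).2
      obtain ⟨i, hi, hi', h4⟩ := ih h3
      refine ⟨i + 1, Nat.succ_pos _, by simpa using hi', ?_⟩
      obtain ⟨i, rfl⟩ := Nat.exists_eq_succ_of_ne_zero hi.ne'
      rcases hL : upWord ord L with - | ⟨f, L'⟩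
      · have := length_upWord h3
        simp [hL] at this
      · rw [facetWord, ← hL, h4]

lemma sum_upWord (L : List (Fin N →₀ ℕ)) : (upWord ord L).sum = L.sum := by
  induction L with
  | nil => rfl
  | cons e L ih =>
    rw [upWord]
    split_ifs
    · rw [List.sum_cons, List.sum_cons, ← add_assoc, headMon_add, List.sum_cons]
    · rw [List.sum_cons, ih, List.sum_cons]

lemma inv_upWord (L : List (Fin N →₀ ℕ)) : inv ord (upWord ord L) = inv ord L := by
  induction L with
  | nil => rfl
  | cons e L ih =>
    rw [upWord]
    split_ifs
    · rw [inv, inv, inv, List.sum_cons, bil_add_right, bil_headMon, zero_add, ← add_assoc,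
        ← bil_add_left, headMon_add]
    · rw [inv, sum_upWord, ih, inv]

lemma headOrd_le_of_le {e f : Fin N →₀ ℕ} (he : e ≠ 0) (h : e ≤ f) :
    headOrd ord f ≤ headOrd ord e :=
  le_headOrd ord he fun _ hj => headOrd_le ord (Finsupp.support_mono h hj)

/-- After the split the remainder of the block starts at a variable not below the one split off, so
the decreasing prefix stops there. -/
lemma upWord_not_crit {b : ℕ} {L : List (Fin N →₀ ℕ)} (h : BotWord ord b L) :
    ¬ CritWord ord b (upWord ord L) ∧ ¬ BotWord ord b (upWord ord L) := by
  induction L generalizing b with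
  | nil => exact absurd h id
  | cons e L ih =>
    rw [upWord]
    split_ifs with h2
    · have he : e ≠ 0 := by rintro rfl; simp at h2
      have h3 : headOrd ord (headMon ord e) ≤ headOrd ord (e - headMon ord e) := by
        rw [headOrd_headMon ord he]
        exact headOrd_le_of_le (sub_headMon_ne_zero h2) tsub_le_self
      constructor
      · rintro ⟨-, -, h4, -⟩
        omega
      · rintro ⟨-, h4 | ⟨-, h4, -⟩⟩
        · rw [degree_headMon ord he] at h4; omega
        · omega
    · have h3 := (h.2.resolve_left h2)
      refine ⟨fun h4 => (ih h3.2).1 h4.2.2, fun h4 => (ih h3.2).2 ?_⟩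
      exact (h4.2.resolve_left h2).2

/-- The word that is refined can be recovered from the refinement. -/
lemma upWord_injOn {b : ℕ} {L L' : List (Fin N →₀ ℕ)} (h : upWord ord L = upWord ord L')
    (hL : BotWord ord b L) (hL' : BotWord ord b L') : L = L' := by
  induction L generalizing b L' with
  | nil => exact absurd hL id
  | cons e L ih =>
    rcases L' with - | ⟨e', L'⟩
    · exact absurd hL' id
    -- Suppose one word splits a block where the other has its smallest variable as a whole block.
    -- The next block of the second refinement then starts below that variable, whereas the
    -- remainder of the split block does not.
    have aux : ∀ {b : ℕ} {e f : Fin N →₀ ℕ} {L L' : List (Fin N →₀ ℕ)}, 2 ≤ e.degree →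
        headMon ord e = f → BotWord ord (headOrd ord f) L' →
        (e - headMon ord e) :: L ≠ upWord ord L' := by
      intro b e f L L' he hf hL' h
      have he0 : e ≠ 0 := by rintro rfl; simp at he
      have h1 : headOrd ord f ≤ headOrd ord (e - headMon ord e) := by
        rw [← hf, headOrd_headMon ord he0]
        exact headOrd_le_of_le (sub_headMon_ne_zero he) tsub_le_self
      rcases L' with - | ⟨g, L'⟩
      · exact hL'
      · have h2 := hL'.1
        rw [upWord] at h
        split_ifs at h with h3
        · have hg0 : g ≠ 0 := by rintro rfl; simp at h3
          rw [(List.cons.inj h).1, headOrd_headMon ord hg0] at h1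
          omega
        · rw [(List.cons.inj h).1] at h1
          omega
    rw [upWord, upWord] at h
    split_ifs at h with h1 h2 h2
    · simp only [List.cons.injEq] at h
      have h3 : e = e' := by rw [← headMon_add ord (e := e), h.2.1, h.1, headMon_add]
      rw [h3, h.2.2]
    · obtain ⟨h3, h4⟩ := List.cons.inj h
      exact absurd h4 (aux (b := b) h1 h3 (hL'.2.resolve_left h2).2)
    · obtain ⟨h3, h4⟩ := List.cons.inj h
      exact absurd h4.symm (aux (b := b) h2 h3.symm (hL.2.resolve_left h1).2)
    · obtain ⟨rfl, h4⟩ := List.cons.inj h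
      rw [ih h4 (hL.2.resolve_left h1).2 (hL'.2.resolve_left h2).2]

lemma headOrd_add_of_le {e f : Fin N →₀ ℕ} (he : e ≠ 0)
    (h : headOrd ord e ≤ headOrd ord f) : headOrd ord (e + f) = headOrd ord e := by
  refine le_antisymm (headOrd_le_of_le he le_self_add) (le_headOrd ord ?_ ?_)
  · exact fun h0 => he (by simpa using (add_eq_zero.1 h0).1)
  · intro j hj
    rcases Finset.mem_union.1 (Finsupp.support_add hj) with h1 | h1
    · exact headOrd_le ord h1
    · exact h.trans (headOrd_le ord h1)

lemma headMon_add_eq (hinj : Function.Injective ord) {e f : Fin N →₀ ℕ} (he : e.degree = 1)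
    (h : headOrd ord e ≤ headOrd ord f) : headMon ord (e + f) = e := by
  have he0 : e ≠ 0 := by rintro rfl; simp at he
  have hef : e + f ≠ 0 := fun h0 => he0 (by simpa using (add_eq_zero.1 h0).1)
  obtain ⟨i, -, h1, h2, -⟩ := head_spec ord hef
  obtain ⟨j, -, h3, h4, -⟩ := head_spec ord he0
  rw [headOrd_add_of_le he0 h, h4] at h2
  rw [h1, ← hinj h2, ← h3, headMon_of_degree ord he]

lemma two_le_degree_add {e f : Fin N →₀ ℕ} (he : e ≠ 0) (hf : f ≠ 0) : 2 ≤ (e + f).degree := by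
  have h1 := degree_pos he
  have h2 := degree_pos hf
  rw [map_add]; omega

/-- Follow the decreasing prefix to the first block whose smallest variable is not below its
predecessor, and merge the two. The predecessor is then the smallest variable of the merged block,
so splitting undoes the merger. -/
lemma exists_facetWord_bot (hinj : Function.Injective ord) {b : ℕ} {L : List (Fin N →₀ ℕ)}
    (h0 : ∀ e ∈ L, e ≠ 0) (hb : ∀ e ∈ L.head?, headOrd ord e < b) (hC : ¬ CritWord ord b L)
    (hU : ¬ BotWord ord b L) : ∃ i, 0 < i ∧ i < L.length ∧ BotWord ord b (facetWord i L) ∧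
      upWord ord (facetWord i L) = L := by
  induction L generalizing b with
  | nil => exact absurd trivial hC
  | cons e L ih =>
    have he0 := h0 e List.mem_cons_self
    have hbe := hb e (by simp)
    have he : e.degree = 1 := by
      by_contra h
      have := degree_pos he0
      exact hU ⟨hbe, Or.inl (by omega)⟩
    have hC' : ¬ CritWord ord (headOrd ord e) L := fun h => hC ⟨hbe, he, h⟩
    have hU' : ¬ BotWord ord (headOrd ord e) L := fun h => hU ⟨hbe, Or.inr ⟨he, h⟩⟩
    rcases L with - | ⟨f, L⟩
    · exact absurd trivial hC'
    by_cases hf : headOrd ord f < headOrd ord e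
    · obtain ⟨i, hi, hi', h1, h2⟩ := ih (fun x hx => h0 x (List.mem_cons_of_mem _ hx))
        (by simpa using hf) hC' hU'
      obtain ⟨i, rfl⟩ := Nat.exists_eq_succ_of_ne_zero hi.ne'
      refine ⟨i + 2, by omega, by simpa using hi', ⟨hbe, Or.inr ⟨he, h1⟩⟩, ?_⟩
      rw [facetWord, upWord, if_neg (by omega), h2]
    · have hf0 := h0 f (by simp)
      have h2 := two_le_degree_add he0 hf0
      push Not at hf
      refine ⟨1, Nat.one_pos, by simp, ⟨?_, Or.inl h2⟩, ?_⟩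
      · rwa [headOrd_add_of_le he0 hf]
      · rw [facetWord, upWord, if_pos h2, headMon_add_eq hinj he hf, add_tsub_cancel_left]

lemma sum_facetWord {L : List (Fin N →₀ ℕ)} {i : ℕ} (hi : 0 < i) (hi' : i < L.length) :
    (facetWord i L).sum = L.sum := by
  induction L generalizing i with
  | nil => simp at hi'
  | cons e L ih =>
    rcases L with - | ⟨f, L⟩
    · simp at hi'; omega
    rcases i with - | - | i
    · omega
    · simp [facetWord, add_assoc]
    · rw [facetWord, List.sum_cons, ih (by omega) (by simpa using hi'), ← List.sum_cons]

/-- Merging forgets the inversions between two neighbours; by bilinearity all others are counted as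
before. -/
lemma inv_facetWord_le {L : List (Fin N →₀ ℕ)} {i : ℕ} (hi : 0 < i) (hi' : i < L.length) :
    inv ord (facetWord i L) ≤ inv ord L := by
  induction L generalizing i with
  | nil => simp at hi'
  | cons e L ih =>
    rcases L with - | ⟨f, L⟩
    · simp at hi'; omega
    rcases i with - | - | i
    · omega
    · simp only [facetWord, inv, bil_add_left, List.sum_cons, bil_add_right]
      omega
    · have h1 := ih (i := i + 1) (by omega) (by simpa using hi')
      rw [facetWord, inv, sum_facetWord (by omega) (by simpa using hi')]
      rw [inv]
      exact Nat.add_le_add_left h1 _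

lemma inv_tail_le (L : List (Fin N →₀ ℕ)) : inv ord (facetWord 0 L) ≤ inv ord L := by
  rcases L with - | ⟨e, L⟩
  · exact le_rfl
  · exact Nat.le_add_left _ _

lemma facetWord_length_le (L : List (Fin N →₀ ℕ)) :
    (facetWord L.length L).sum ≤ L.sum ∧ inv ord (facetWord L.length L) ≤ inv ord L := by
  induction L with
  | nil => exact ⟨le_rfl, le_rfl⟩
  | cons e L ih =>
    rcases L with - | ⟨f, L⟩
    · exact ⟨by simp [facetWord], by simp [facetWord, inv]⟩
    · simp only [List.length_cons, facetWord] at ih ⊢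
      refine ⟨?_, ?_⟩
      · rw [List.sum_cons, List.sum_cons (a := e)]
        exact add_le_add_right ih.1 _
      · rw [inv, inv]
        exact add_le_add (bil_mono_right ord _ ih.1) ih.2

/-- A facet of a word that is not a bottom has less inversions or is not a bottom, except when the
word is matched with it. -/
lemma upWord_facetWord (hinj : Function.Injective ord) {b : ℕ} {L : List (Fin N →₀ ℕ)}
    (h0 : ∀ e ∈ L, e ≠ 0) (hU : ¬ BotWord ord b L) {i : ℕ} (hi : 0 < i) (hi' : i < L.length)
    (hU' : BotWord ord b (facetWord i L)) (hinv : inv ord (facetWord i L) = inv ord L) :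
    upWord ord (facetWord i L) = L := by
  induction L generalizing b i with
  | nil => simp at hi'
  | cons e L ih =>
    rcases L with - | ⟨f, L⟩
    · simp at hi'; omega
    have he0 := h0 e List.mem_cons_self
    have hf0 := h0 f (by simp)
    rcases i with - | - | i
    · omega
    · have hbil : bil ord e f = 0 := by
        simp only [facetWord, inv, bil_add_left, List.sum_cons, bil_add_right] at hinv
        omega
      have hef : headOrd ord e ≤ headOrd ord f := by
        obtain ⟨i, hi, -, h, -⟩ := head_spec ord he0
        rw [h]
        exact le_headOrd ord hf0 fun j hj => (bil_eq_zero ord).1 hbil i hi j hj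
      -- Otherwise the unmerged word would already be a bottom, at the block `e`.
      have he : e.degree = 1 := by
        by_contra h
        have := degree_pos he0
        refine hU ⟨?_, Or.inl (by omega)⟩
        have := hU'.1
        rwa [headOrd_add_of_le he0 hef] at this
      rw [facetWord, upWord, if_pos (two_le_degree_add he0 hf0), headMon_add_eq hinj he hef,
        add_tsub_cancel_left]
    · rw [facetWord] at hU' hinv ⊢
      have hd : e.degree = 1 := by
        by_contra h
        have := degree_pos he0
        exact hU ⟨hU'.1, Or.inl (by omega)⟩
      have hU1 : BotWord ord (headOrd ord e) (facetWord (i + 1) (f :: L)) :=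
        (hU'.2.resolve_left (by omega)).2
      rw [inv, inv, sum_facetWord (by omega) (by simpa using hi')] at hinv
      rw [upWord, if_neg (by omega), ih (fun x hx => h0 x (List.mem_cons_of_mem _ hx))
        (fun h => hU ⟨hU'.1, Or.inr ⟨hd, h⟩⟩) (by omega) (by simpa using hi') hU1 (by omega)]

/-- The source of both linearity and minimality: the total degree of a critical cell is its
dimension. -/
lemma CritWord.sum_degree {b : ℕ} {L : List (Fin N →₀ ℕ)} (h : CritWord ord b L) :
    L.sum.degree = L.length := by
  induction L generalizing b with
  | nil => simp
  | cons e L ih => rw [List.sum_cons, map_add, h.2.1, ih h.2.2, List.length_cons, add_comm]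

end Words

/-! ### Cells as words -/

section CellWords

variable {N : ℕ} {Γ : Type*} [AddCommGroup Γ] {μ : (Fin N → ℤ) →+ Γ} {n : ℕ}

lemma Cell.src_mem (η : Cell μ n) : η.src ∈ imPhi μ := by
  have := η.vertex 0
  rwa [η.zero, map_zero, sub_zero] at this

/-- The cell `[e_D < a < a p₁ < ⋯ < a pₙ]`. -/
def Cell.cons (D : Γ) (a : Fin N →₀ ℕ) (η : Cell μ n) (hD : D ∈ imPhi μ) (ha : a ≠ 0)
    (h : D - monDeg μ a = η.src) : Cell μ (n + 1) where
  src := D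
  p := Fin.cons 0 fun j => a + η.p j
  zero := rfl
  strictMono := by
    intro i j hij
    obtain ⟨j, rfl⟩ := Fin.exists_succ_eq.2 (Fin.ne_zero_of_lt hij)
    induction i using Fin.cases with
    | zero =>
      simp only [Fin.cons_zero, Fin.cons_succ]
      exact (pos_iff_ne_zero.2 ha).trans_le le_self_add
    | succ i =>
      simp only [Fin.cons_succ]
      have := η.strictMono (Fin.succ_lt_succ_iff.1 hij)
      gcongr
  vertex := by
    intro i
    induction i using Fin.cases with
    | zero => simpa using hD
    | succ i =>
      simp only [Fin.cons_succ]
      rw [map_add, ← sub_sub, h]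
      exact η.vertex i

lemma Cell.cons_p_succ {D : Γ} {a : Fin N →₀ ℕ} {η : Cell μ n} {hD : D ∈ imPhi μ} {ha : a ≠ 0}
    {h : D - monDeg μ a = η.src} (j : Fin (n + 1)) :
    (Cell.cons D a η hD ha h).p j.succ = a + η.p j := by simp [Cell.cons]

lemma Cell.cons_congr {D D' : Γ} {a a' : Fin N →₀ ℕ} {η η' : Cell μ n} (hD : D ∈ imPhi μ)
    (ha : a ≠ 0) (h : D - monDeg μ a = η.src) (hD' : D' ∈ imPhi μ) (ha' : a' ≠ 0)
    (h' : D' - monDeg μ a' = η'.src) (h1 : D = D') (h2 : a = a') (h3 : η = η') :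
    Cell.cons D a η hD ha h = Cell.cons D' a' η' hD' ha' h' := by
  subst h1 h2 h3; rfl

lemma Cell.cons_facet_zero {D : Γ} {a : Fin N →₀ ℕ} {η : Cell μ n} {hD : D ∈ imPhi μ} {ha : a ≠ 0}
    {h : D - monDeg μ a = η.src} : (Cell.cons D a η hD ha h).facet 0 = η := by
  have h1 : ∀ j, (Cell.cons D a η hD ha h).p ((0 : Fin (n + 2)).succAbove j) = a + η.p j := by
    intro j
    rw [Fin.succAbove_zero, cons_p_succ]
  apply Cell.ext
  · simp only [Cell.facet, h1, η.zero, add_zero]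
    exact h
  · funext j
    simp only [Cell.facet, h1, η.zero, add_zero, add_tsub_cancel_left]

lemma Cell.p_succAbove_zero_zero (η : Cell μ (n + 1)) : η.p ((0 : Fin (n + 2)).succAbove 0) = η.p 1 := by
  rw [Fin.succAbove_zero]; rfl

lemma Cell.p_succAbove_zero {i : Fin (n + 2)} (hi : i ≠ 0) (η : Cell μ (n + 1)) :
    η.p (i.succAbove 0) = 0 := by
  rw [Fin.succAbove_ne_zero_zero hi, η.zero]

lemma Cell.p_one_ne_zero (η : Cell μ (n + 1)) : η.p 1 ≠ 0 := by
  have h : η.p 0 < η.p 1 := η.strictMono (by simp)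
  rw [η.zero] at h
  exact h.ne'

lemma Cell.facet_zero_src (η : Cell μ (n + 1)) :
    η.src - monDeg μ (η.p 1) = (η.facet 0).src := rfl

/-- Supports induction on the dimension, and shows that prepending a monomial inverts facet `0`, as
the contracting homotopy requires. -/
lemma Cell.eq_cons (η : Cell μ (n + 1)) :
    η = Cell.cons η.src (η.p 1) (η.facet 0) η.src_mem η.p_one_ne_zero η.facet_zero_src := by
  apply Cell.ext
  · rfl
  · funext j
    induction j using Fin.cases with
    | zero => exact η.zero
    | succ j =>
      rw [cons_p_succ]
      simp only [Cell.facet, Fin.succAbove_zero]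
      exact (add_tsub_cancel_of_le (η.strictMono.monotone (Fin.succ_le_succ_iff.2 (Fin.zero_le j)))).symm

lemma Cell.exists_cons (η : Cell μ (n + 1)) : ∃ (D : Γ) (a : Fin N →₀ ℕ) (θ : Cell μ n)
    (hD : D ∈ imPhi μ) (ha : a ≠ 0) (h : D - monDeg μ a = θ.src), η = Cell.cons D a θ hD ha h :=
  ⟨_, _, _, _, _, _, η.eq_cons⟩

/-- The summand `η.p (i.succAbove 0)` is the first block of `η` for `i = 0`, where it is merged into
`a`, and it is zero for every other `i`. -/
lemma Cell.cons_facet_succ {D : Γ} {a : Fin N →₀ ℕ} {η : Cell μ (n + 1)} {hD : D ∈ imPhi μ}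
    {ha : a ≠ 0} {h : D - monDeg μ a = η.src} (i : Fin (n + 2)) :
    (Cell.cons D a η hD ha h).facet i.succ =
      Cell.cons D (a + η.p (i.succAbove 0)) (η.facet i) hD (fun h => ha (add_eq_zero.1 h).1)
        (by rw [map_add, ← sub_sub, h]; rfl) := by
  have h0 : (Cell.cons D a η hD ha h).p (i.succ.succAbove 0) = 0 :=
    Cell.p_succAbove_zero (Fin.succ_ne_zero i) _
  apply Cell.ext
  · simp only [Cell.facet, h0, map_zero, sub_zero]
    rfl
  · funext j
    simp only [Cell.facet, h0, tsub_zero]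
    induction j using Fin.cases with
    | zero => rw [h0]; rfl
    | succ j =>
      rw [cons_p_succ, Fin.succ_succAbove_succ, cons_p_succ, add_assoc]
      simp only
      rw [add_tsub_cancel_of_le]
      exact η.strictMono.monotone ((Fin.strictMono_succAbove i).monotone (Fin.zero_le j))

/-- The blocks of a cell. -/
def Cell.word (η : Cell μ n) : List (Fin N →₀ ℕ) :=
  List.ofFn fun i : Fin n => η.p i.succ - η.p i.castSucc

lemma Cell.length_word (η : Cell μ n) : η.word.length = n := by simp [word]

lemma Cell.word_cons {D : Γ} {a : Fin N →₀ ℕ} {η : Cell μ n} {hD : D ∈ imPhi μ} {ha : a ≠ 0}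
    {h : D - monDeg μ a = η.src} : (Cell.cons D a η hD ha h).word = a :: η.word := by
  rw [word, List.ofFn_succ, word]
  congr 1
  · rw [cons_p_succ, η.zero, add_zero, Fin.castSucc_zero, Cell.zero, tsub_zero]
  · congr 1
    funext i
    rw [← Fin.succ_castSucc, cons_p_succ, cons_p_succ, add_tsub_add_eq_tsub_left]

lemma Cell.sum_word (η : Cell μ n) : η.word.sum = η.p (Fin.last n) := by
  induction n with
  | zero => rw [word, List.ofFn_zero, List.sum_nil]; exact η.zero.symm
  | succ n ih =>
    obtain ⟨D, a, θ, hD, ha, h, rfl⟩ := η.exists_cons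
    rw [word_cons, List.sum_cons, ih, ← Fin.succ_last, cons_p_succ]

lemma Cell.word_ne_zero (η : Cell μ n) : ∀ e ∈ η.word, e ≠ 0 := by
  intro e he
  rw [word, List.mem_ofFn] at he
  obtain ⟨i, rfl⟩ := he
  exact (tsub_pos_of_lt (η.strictMono (Fin.castSucc_lt_succ (i := i)))).ne'

lemma Cell.ext_word {η η' : Cell μ n} (h : η.src = η'.src) (h' : η.word = η'.word) : η = η' := by
  induction n with
  | zero =>
    refine Cell.ext h ?_
    funext i
    rw [Subsingleton.elim (α := Fin 1) i 0]
    exact η.zero.trans η'.zero.symm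
  | succ n ih =>
    obtain ⟨D, a, θ, hD, ha, h1, rfl⟩ := η.exists_cons
    obtain ⟨D', a', θ', hD', ha', h1', rfl⟩ := η'.exists_cons
    rw [word_cons, word_cons, List.cons.injEq] at h'
    refine Cell.cons_congr _ _ _ _ _ _ h h'.1 (ih ?_ h'.2)
    rw [← h1, ← h1', h'.1, show D = D' from h]

lemma Cell.word_facet (η : Cell μ (n + 1)) (i : Fin (n + 2)) :
    (η.facet i).word = facetWord i η.word := by
  induction n with
  | zero =>
    have h1 : ∀ η : Cell μ 0, η.word = [] := fun η => List.ofFn_zero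
    obtain ⟨D, a, θ, hD, ha, h, rfl⟩ := η.exists_cons
    rw [h1, word_cons, h1]
    fin_cases i <;> rfl
  | succ n ih =>
    obtain ⟨D, a, θ, hD, ha, h, rfl⟩ := η.exists_cons
    rw [word_cons]
    induction i using Fin.cases with
    | zero => rw [cons_facet_zero]; rfl
    | succ i =>
      rw [cons_facet_succ, word_cons, ih]
      obtain ⟨D', a', θ', hD', ha', h', rfl⟩ := θ.exists_cons
      rw [word_cons]
      induction i using Fin.cases with
      | zero =>
        rw [Cell.p_succAbove_zero_zero, ← Fin.succ_zero_eq_one, cons_p_succ, θ'.zero, add_zero]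
        rfl
      | succ i =>
        rw [Cell.p_succAbove_zero (Fin.succ_ne_zero i), add_zero]
        rfl

/-- The word `L` is the word of a cell that starts at `D`. -/
def IsChain (μ : (Fin N → ℤ) →+ Γ) : Γ → List (Fin N →₀ ℕ) → Prop
  | D, [] => D ∈ imPhi μ
  | D, e :: L => D ∈ imPhi μ ∧ e ≠ 0 ∧ IsChain μ (D - monDeg μ e) L

lemma IsChain.mem {D : Γ} {L : List (Fin N →₀ ℕ)} (h : IsChain μ D L) : D ∈ imPhi μ := by
  cases L with
  | nil => exact h
  | cons e L => exact h.1

lemma Cell.isChain (η : Cell μ n) : IsChain μ η.src η.word := by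
  induction n with
  | zero => rw [word, List.ofFn_zero]; exact η.src_mem
  | succ n ih =>
    obtain ⟨D, a, θ, hD, ha, h, rfl⟩ := η.exists_cons
    rw [word_cons]
    refine ⟨hD, ha, ?_⟩
    change IsChain μ (D - monDeg μ a) _
    rw [h]
    exact ih θ

lemma IsChain.exists_cell {D : Γ} {L : List (Fin N →₀ ℕ)} (h : IsChain μ D L)
    (hn : L.length = n) : ∃ η : Cell μ n, η.src = D ∧ η.word = L := by
  induction L generalizing D n with
  | nil =>
    subst hn
    refine ⟨⟨D, fun _ => 0, rfl, fun i j h => absurd h (by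
      rw [Subsingleton.elim (α := Fin 1) i j]; exact lt_irrefl _), fun _ => ?_⟩, rfl, List.ofFn_zero⟩
    rw [map_zero, sub_zero]; exact h
  | cons e L ih =>
    subst hn
    obtain ⟨η, h1, h2⟩ := ih h.2.2 rfl
    exact ⟨Cell.cons D e η h.1 h.2.1 h1.symm, rfl, by rw [Cell.word_cons, h2]⟩

end CellWords

/-! ### The matching -/

section Matching

variable {N : ℕ} {Γ : Type*} [AddCommGroup Γ] {μ : (Fin N → ℤ) →+ Γ} {n : ℕ} (ord : Fin N → ℕ)

/-- The cell is a strictly decreasing sequence of variables. -/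
def Cell.IsCrit (η : Cell μ n) : Prop := CritWord ord N η.word

/-- The cell is matched with a cell of larger dimension. -/
def Cell.IsBot (η : Cell μ n) : Prop := BotWord ord N η.word

/-- The matching of a cell with its refinement by the first block of degree at least two. -/
def matching (μ : (Fin N → ℤ) →+ Γ) : Set (AnyCell μ × AnyCell μ) :=
  {x | ∃ (n : ℕ) (τ : Cell μ (n + 1)) (u : Cell μ n), x = (⟨n + 1, τ⟩, ⟨n, u⟩) ∧ u.IsBot ord ∧
    τ.src = u.src ∧ τ.word = upWord ord u.word}

lemma mem_matching {τ : Cell μ (n + 1)} {u : Cell μ n} :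
    ((⟨n + 1, τ⟩ : AnyCell μ), (⟨n, u⟩ : AnyCell μ)) ∈ matching ord μ ↔
      u.IsBot ord ∧ τ.src = u.src ∧ τ.word = upWord ord u.word := by
  constructor
  · rintro ⟨m, τ', u', h, h1⟩
    obtain ⟨h2, h3⟩ := Prod.mk.inj h
    obtain ⟨rfl, h4⟩ := Sigma.mk.inj_iff.1 h3
    obtain ⟨-, h5⟩ := Sigma.mk.inj_iff.1 h2
    obtain rfl := eq_of_heq h4
    obtain rfl := eq_of_heq h5
    exact h1
  · intro h
    exact ⟨n, τ, u, rfl, h⟩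

/-- The potential, which does not increase in the directed Hasse diagram. -/
def Cell.pot (η : Cell μ n) : ℕ := (η.p (Fin.last n)).degree + inv ord η.word

variable {ord}

/-- The facet undoes a split inside a block, so it is neither the first nor the last one; a matched
pair loses no factor at either end. -/
lemma matched_facet {τ : Cell μ (n + 1)} {u : Cell μ n}
    (h : u.IsBot ord ∧ τ.src = u.src ∧ τ.word = upWord ord u.word) :
    ∃ i : Fin (n + 2), i ≠ 0 ∧ i ≠ Fin.last _ ∧ τ.facet i = u := by
  obtain ⟨h1, h2, h3⟩ := h
  obtain ⟨i, hi, hi', h4⟩ := exists_facetWord_upWord h1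
  rw [u.length_word] at hi'
  have hi0 : (⟨i, by omega⟩ : Fin (n + 2)) ≠ 0 := by
    intro h; have := congrArg Fin.val h; simp at this; omega
  refine ⟨⟨i, by omega⟩, hi0, ?_, Cell.ext_word ?_ ?_⟩
  · intro h; have := congrArg Fin.val h; simp at this; omega
  · simp only [Cell.facet, Cell.p_succAbove_zero hi0, map_zero, sub_zero, h2]
  · rw [Cell.word_facet, h3, h4]

lemma matched_pot {τ : Cell μ (n + 1)} {u : Cell μ n}
    (h : u.IsBot ord ∧ τ.src = u.src ∧ τ.word = upWord ord u.word) : τ.pot ord = u.pot ord := by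
  rw [Cell.pot, Cell.pot, ← Cell.sum_word, ← Cell.sum_word, h.2.2, sum_upWord, inv_upWord]

lemma Cell.facet_p_last (η : Cell μ (n + 1)) {i : Fin (n + 2)} (hi : i ≠ 0)
    (hi' : i ≠ Fin.last _) : (η.facet i).p (Fin.last n) = η.p (Fin.last (n + 1)) := by
  simp only [facet, p_succAbove_zero hi, tsub_zero]
  rw [Fin.succAbove_ne_last_last hi']

lemma Cell.degree_facet_lt (η : Cell μ (n + 1)) {i : Fin (n + 2)}
    (hi : i = 0 ∨ i = Fin.last _) :
    ((η.facet i).p (Fin.last n)).degree < (η.p (Fin.last (n + 1))).degree := by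
  have : (η.facet i).p (Fin.last n) < η.p (Fin.last (n + 1)) := by
    by_cases h0 : i = 0
    · subst h0
      simp only [facet, Fin.succAbove_zero, Fin.succ_last]
      refine lt_of_le_of_ne tsub_le_self fun h => η.p_one_ne_zero ?_
      have h1 := add_tsub_cancel_of_le
        (η.strictMono.monotone (Fin.succ_le_succ_iff.2 (Fin.zero_le (Fin.last n))))
      rw [Fin.succ_last] at h1
      rw [h] at h1
      exact add_eq_right.1 h1
    · have hl := hi.resolve_left h0
      simp only [facet, p_succAbove_zero h0, tsub_zero]
      subst hl
      rw [Fin.succAbove_last]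
      exact η.strictMono (Fin.castSucc_lt_last _)
  rw [← add_tsub_cancel_of_le this.le, map_add]
  have := degree_pos (tsub_pos_of_lt this).ne'
  omega

lemma Cell.inv_facet_le (η : Cell μ (n + 1)) (i : Fin (n + 2)) :
    inv ord (η.facet i).word ≤ inv ord η.word := by
  rw [word_facet]
  rcases eq_or_ne i 0 with rfl | hi
  · exact inv_tail_le _
  rcases eq_or_ne i (Fin.last _) with rfl | hi'
  · have := (facetWord_length_le (ord := ord) η.word).2
    rwa [length_word] at this
  · refine inv_facetWord_le (Nat.pos_of_ne_zero fun h => hi (Fin.ext h)) ?_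
    rw [length_word]
    have := i.2
    have : (i : ℕ) ≠ n + 1 := fun h => hi' (Fin.ext h)
    omega

lemma Cell.pot_facet_le (η : Cell μ (n + 1)) (i : Fin (n + 2)) :
    (η.facet i).pot ord ≤ η.pot ord := by
  refine add_le_add ?_ (η.inv_facet_le i)
  by_cases h : i = 0 ∨ i = Fin.last _
  · exact (η.degree_facet_lt h).le
  · rw [not_or] at h
    rw [η.facet_p_last h.1 h.2]

/-- The key to acyclicity. The first and last facets lose degree; an inner facet that is a bottom
and keeps all inversions is undone by the split, by `upWord_facetWord`. -/
lemma facet_bot (hinj : Function.Injective ord) {η : Cell μ (n + 1)} (hη : ¬ η.IsBot ord)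
    {i : Fin (n + 2)} (hi : (η.facet i).IsBot ord) (hpot : η.pot ord ≤ (η.facet i).pot ord) :
    ((⟨n + 1, η⟩ : AnyCell μ), (⟨n, η.facet i⟩ : AnyCell μ)) ∈ matching ord μ := by
  rw [mem_matching]
  have h1 : i ≠ 0 ∧ i ≠ Fin.last _ := by
    by_contra! h
    have h2 : i = 0 ∨ i = Fin.last _ := by tauto
    have h3 := η.degree_facet_lt h2
    have h4 := η.inv_facet_le (ord := ord) i
    simp only [Cell.pot] at hpot
    omega
  have h2 := η.facet_p_last h1.1 h1.2
  have h3 : inv ord (facetWord i η.word) = inv ord η.word := by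
    have h4 := η.inv_facet_le (ord := ord) i
    rw [Cell.pot, Cell.pot, h2] at hpot
    rw [← Cell.word_facet]
    omega
  refine ⟨hi, ?_, ?_⟩
  · simp only [Cell.facet, Cell.p_succAbove_zero h1.1, map_zero, sub_zero]
  · rw [Cell.IsBot, Cell.word_facet] at hi
    rw [Cell.word_facet]
    refine (upWord_facetWord hinj η.word_ne_zero hη (Nat.pos_of_ne_zero fun h => h1.1 (Fin.ext h))
      ?_ hi h3).symm
    rw [Cell.length_word]
    have := i.2
    have : (i : ℕ) ≠ n + 1 := fun h => h1.2 (Fin.ext h)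
    omega

lemma exists_matched_bot (hinj : Function.Injective ord) (hlt : ∀ i, ord i < N)
    {η : Cell μ (n + 1)} (hC : ¬ η.IsCrit ord) (hU : ¬ η.IsBot ord) :
    ∃ u : Cell μ n, u.IsBot ord ∧ η.src = u.src ∧ η.word = upWord ord u.word := by
  obtain ⟨i, hi, hi', h1, h2⟩ := exists_facetWord_bot hinj η.word_ne_zero (by
    intro e he
    have he0 : e ≠ 0 := η.word_ne_zero e (List.mem_of_mem_head? he)
    obtain ⟨i, -, -, h, -⟩ := head_spec ord he0
    rw [h]; exact hlt i) hC hU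
  rw [Cell.length_word] at hi'
  have hi0 : (⟨i, by omega⟩ : Fin (n + 2)) ≠ 0 := by
    intro h; have := congrArg Fin.val h; simp at this; omega
  refine ⟨η.facet ⟨i, by omega⟩, ?_, ?_, ?_⟩
  · rw [Cell.IsBot, Cell.word_facet]; exact h1
  · simp only [Cell.facet, Cell.p_succAbove_zero hi0, map_zero, sub_zero]
  · rw [Cell.word_facet]; exact h2.symm

lemma matched_top {τ : Cell μ (n + 1)} {u : Cell μ n}
    (h : u.IsBot ord ∧ τ.src = u.src ∧ τ.word = upWord ord u.word) :
    ¬ τ.IsCrit ord ∧ ¬ τ.IsBot ord := by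
  rw [Cell.IsCrit, Cell.IsBot, h.2.2]
  exact upWord_not_crit h.1

/-- Here directability enters the matching: `hS` makes the point at which a block is split a vertex.
-/
lemma isChain_upWord (hS : ∀ D e, IsMor μ D e → e ≠ 0 → D - monDeg μ (headMon ord e) ∈ imPhi μ)
    {D : Γ} {L : List (Fin N →₀ ℕ)} (h : IsChain μ D L) : IsChain μ D (upWord ord L) := by
  induction L generalizing D with
  | nil => exact h
  | cons e L ih =>
    rw [upWord]
    split_ifs with h2
    · refine ⟨h.1, headMon_ne_zero ord h.2.1, hS D e ⟨h.1, h.2.2.mem⟩ h.2.1,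
        sub_headMon_ne_zero h2, ?_⟩
      rw [sub_sub, ← map_add, headMon_add]
      exact h.2.2
    · exact ⟨h.1, h.2.1, ih h.2.2⟩

lemma exists_matched_top
    (hS : ∀ D e, IsMor μ D e → e ≠ 0 → D - monDeg μ (headMon ord e) ∈ imPhi μ)
    {u : Cell μ n} (hu : u.IsBot ord) : ∃ τ : Cell μ (n + 1), τ.src = u.src ∧
      τ.word = upWord ord u.word :=
  (isChain_upWord hS u.isChain).exists_cell (by rw [length_upWord hu, Cell.length_word])

lemma isCrit_zero (η : Cell μ 0) : η.IsCrit ord := by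
  rw [Cell.IsCrit, Cell.word, List.ofFn_zero]; trivial

/-- A bottom has its split as partner, and a cell that is neither a bottom nor a decreasing word of
variables is itself the split of a bottom. -/
lemma isCritical_iff (hinj : Function.Injective ord) (hlt : ∀ i, ord i < N)
    (hS : ∀ D e, IsMor μ D e → e ≠ 0 → D - monDeg μ (headMon ord e) ∈ imPhi μ) (η : Cell μ n) :
    IsCritical (matching ord μ) ⟨n, η⟩ ↔ η.IsCrit ord := by
  constructor
  · intro h
    by_contra hC
    by_cases hU : η.IsBot ord
    · obtain ⟨τ, hτ⟩ := exists_matched_top hS hU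
      exact (h ⟨n + 1, τ⟩).2 ((mem_matching ord).2 ⟨hU, hτ⟩)
    · cases n with
      | zero => exact hC (isCrit_zero η)
      | succ n =>
        obtain ⟨u, hu⟩ := exists_matched_bot hinj hlt hC hU
        exact (h ⟨n, u⟩).1 ((mem_matching ord).2 hu)
  · intro hC y
    constructor
    · rintro ⟨m, τ, u, h, h1⟩
      obtain ⟨h2, -⟩ := Prod.mk.inj h
      obtain ⟨rfl, h3⟩ := Sigma.mk.inj_iff.1 h2
      obtain rfl := eq_of_heq h3
      exact (matched_top h1).1 hC
    · rintro ⟨m, τ, u, h, h1⟩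
      obtain ⟨-, h2⟩ := Prod.mk.inj h
      obtain ⟨rfl, h3⟩ := Sigma.mk.inj_iff.1 h2
      obtain rfl := eq_of_heq h3
      exact h1.1.not_crit hC

lemma matching_isMatching : IsMatching (matching ord μ) where
  facet := by
    rintro _ _ ⟨n, τ, u, ⟨rfl, rfl⟩, h⟩
    obtain ⟨i, -, -, rfl⟩ := matched_facet h
    exact ⟨n, τ, i, rfl, rfl⟩
  top_unique := by
    rintro _ _ y ⟨n, τ, u, ⟨rfl, rfl⟩, h⟩ h'
    obtain ⟨m, τ', u', h1, h2⟩ := h'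
    obtain ⟨h3, rfl⟩ := Prod.mk.inj h1
    obtain ⟨h4, h5⟩ := Sigma.mk.inj_iff.1 h3
    obtain rfl := Nat.succ_injective h4
    obtain rfl := eq_of_heq h5
    have := upWord_injOn (h.2.2.symm.trans h2.2.2) h.1 h2.1
    rw [Cell.ext_word (h.2.1.symm.trans h2.2.1) this]
  bot_unique := by
    rintro _ x _ ⟨n, τ, u, ⟨rfl, rfl⟩, h⟩ h'
    obtain ⟨m, τ', u', h1, h2⟩ := h'
    obtain ⟨rfl, h3⟩ := Prod.mk.inj h1
    obtain ⟨rfl, h4⟩ := Sigma.mk.inj_iff.1 h3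
    obtain rfl := eq_of_heq h4
    rw [Cell.ext_word (h.2.1.trans h2.2.1.symm) (h.2.2.trans h2.2.2.symm)]
  disjoint := by
    rintro _ _ z ⟨n, τ, u, ⟨rfl, rfl⟩, h⟩ h'
    obtain ⟨m, τ', u', h1, h2⟩ := h'
    obtain ⟨h3, -⟩ := Prod.mk.inj h1
    obtain ⟨rfl, h4⟩ := Sigma.mk.inj_iff.1 h3
    obtain rfl := eq_of_heq h4
    exact (matched_top h2).2 h.1

lemma matching_isInternal (hinj : Function.Injective ord) (hlt : ∀ i, ord i < N)
    (hS : ∀ D e, IsMor μ D e → e ≠ 0 → D - monDeg μ (headMon ord e) ∈ imPhi μ)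
    (hA : ∀ D e, IsArrow μ D e → e.degree = 1) : IsInternal (matching ord μ) where
  vertices η := (isCritical_iff hinj hlt hS η).2 (isCrit_zero η)
  arrows η h := by
    rw [isCritical_iff hinj hlt hS, Cell.IsCrit, η.eq_cons, Cell.word_cons]
    obtain ⟨i, -, -, h', -⟩ := head_spec ord η.p_one_ne_zero
    refine ⟨by rw [h']; exact hlt i, hA _ _ h, ?_⟩
    rw [Cell.word, List.ofFn_zero]
    trivial
  ends := by
    rintro _ _ ⟨n, τ, u, ⟨rfl, rfl⟩, h⟩
    refine ⟨h.2.1, ?_⟩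
    obtain ⟨i, hi, hi', rfl⟩ := matched_facet h
    simp only [Cell.tgt]
    rw [h.2.1, Cell.facet_p_last _ hi hi']

open Classical in
/-- A measure that decreases along the edges of the directed Hasse diagram that preserve the
potential. -/
def level (ord : Fin N → ℕ) (x : AnyCell μ) : ℕ :=
  -- The offset `3` puts a bottom of dimension `n` strictly above its partner, of level `2 * (n +
  -- 1)`, and strictly below a bottom of dimension `n + 1`.
  if x.2.IsBot ord then 2 * x.1 + 3 else 2 * x.1

lemma matching_isAcyclic (hinj : Function.Injective ord) : IsAcyclic (matching ord μ) := by
  -- Along a downward step of constant potential from a non-bottom, the facet is no bottom either,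
  -- since otherwise the edge would be matched by `facet_bot`.
  let rk : AnyCell μ → ℕ ×ₗ ℕ := fun x => toLex (x.2.pot ord, level ord x)
  have key : ∀ x y, HasseStep (matching ord μ) x y → rk y < rk x := by
    intro x y h
    rw [Prod.Lex.toLex_lt_toLex]
    rcases h with ⟨⟨n, η, i, rfl, rfl⟩, h⟩ | ⟨n, τ, u, ⟨rfl, rfl⟩, h⟩
    · rcases (η.pot_facet_le (ord := ord) i).lt_or_eq with h1 | h1
      · exact Or.inl h1
      · refine Or.inr ⟨h1, ?_⟩
        by_cases h2 : η.IsBot ord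
        · simp only [level, if_pos h2]
          split_ifs <;> omega
        · have h3 : ¬ (η.facet i).IsBot ord := fun h3 => h (facet_bot hinj h2 h3 h1.ge)
          simp only [level, if_neg h2, if_neg h3]
          omega
    · refine Or.inr ⟨matched_pot h, ?_⟩
      simp only [level, if_pos h.1, if_neg (matched_top h).2]
      omega
  have key' : ∀ x y, Relation.TransGen (HasseStep (matching ord μ)) x y → rk y < rk x := by
    intro x y h
    induction h with
    | single h => exact key _ _ h
    | tail _ h ih => exact (key _ _ h).trans ih
  exact fun x h => lt_irrefl _ (key' x x h)

end Matching

/-! ### Directable algebras -/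

section Paths

variable (k : Type*) [CommRing k] {N : ℕ} {Γ : Type*} [AddCommGroup Γ] {μ : (Fin N → ℤ) →+ Γ}

lemma IsPath.isMor {D : Γ} {w : List (Fin N →₀ ℕ)} (h : IsPath μ D w) : IsMor μ D w.sum := by
  induction w generalizing D with
  | nil => exact isMor_zero h
  | cons e w ih => rw [List.sum_cons]; exact h.1.1.add (ih h.2)

lemma IsPath.pathElem_eq {D : Γ} {w : List (Fin N →₀ ℕ)} (h : IsPath μ D w) :
    pathElem k μ D w = mono k μ D w.sum := by
  induction w generalizing D with
  | nil => rfl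
  | cons e w ih => rw [pathElem, ih h.2, mono_mul k h.1.1, List.sum_cons]

lemma IsPath.append {D : Γ} {w w' : List (Fin N →₀ ℕ)} (h : IsPath μ D w)
    (h' : IsPath μ (D - monDeg μ w.sum) w') : IsPath μ D (w ++ w') := by
  induction w generalizing D with
  | nil => simpa using h'
  | cons e w ih =>
    refine ⟨h.1, ih h.2 ?_⟩
    rwa [List.sum_cons, map_add, ← sub_sub] at h'

/-- A nontrivial monomial that is not an arrow factors at a vertex into two monomials of smaller
degree. -/
lemma IsMor.exists_path {D : Γ} {e : Fin N →₀ ℕ} (h : IsMor μ D e) :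
    ∃ w, IsPath μ D w ∧ w.sum = e := by
  induction hd : e.degree using Nat.strong_induction_on generalizing D e with
  | _ m ih =>
    by_cases he : e = 0
    · exact ⟨[], h.1, he.symm⟩
    by_cases ha : IsArrow μ D e
    · exact ⟨[e], ⟨ha, h.2⟩, by simp⟩
    · have h1 : ∃ e₁ e₂ : Fin N →₀ ℕ, e = e₁ + e₂ ∧ IsMor μ D e₁ ∧ e₁ ≠ 0 ∧ e₂ ≠ 0 := by
        by_contra! hc
        refine ha ⟨h, he, fun e₁ e₂ h1 h2 => ?_⟩
        by_contra! h3
        exact h3.2 (hc e₁ e₂ h1 h2 h3.1)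
      obtain ⟨e₁, e₂, rfl, h1, h2, h3⟩ := h1
      have h4 := degree_pos h2
      have h5 := degree_pos h3
      rw [map_add] at hd
      obtain ⟨w₁, hw₁, hs₁⟩ := ih _ (by omega) h1 rfl
      obtain ⟨w₂, hw₂, hs₂⟩ := ih _ (by omega) (h.of_add h1.2) rfl
      exact ⟨w₁ ++ w₂, hw₁.append (by rwa [hs₁]), by rw [List.sum_append, hs₁, hs₂]⟩

lemma isArrow_of_degree {D : Γ} {e : Fin N →₀ ℕ} (h : IsMor μ D e) (he : e.degree = 1) :
    IsArrow μ D e := by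
  refine ⟨h, by rintro rfl; simp at he, fun e₁ e₂ h1 _ => ?_⟩
  by_contra! hc
  have h2 := degree_pos hc.1
  have h3 := degree_pos hc.2
  rw [h1, map_add] at he
  omega

/-- Turns the order of the variables into a numbering below `N`, so that `N` can serve as initial
bound in `CritWord` and `BotWord`. -/
lemma exists_ord {α : Type*} [LinearOrder α] [Fintype α] :
    ∃ ord : α → ℕ, StrictMono ord ∧ ∀ i, ord i < Fintype.card α := by
  let f := Fintype.orderIsoFinOfCardEq α rfl
  exact ⟨fun i => f.symm i, fun i j hij => f.symm.strictMono hij, fun i => (f.symm i).2⟩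

/-- The combinatorial content of directability: the smallest variable of a monomial splits off, and
all arrows are variables. -/
structure IsDirected (μ : (Fin N → ℤ) →+ Γ) (ord : Fin N → ℕ) : Prop where
  inj : Function.Injective ord
  lt : ∀ i, ord i < N
  split : ∀ D e, IsMor μ D e → e ≠ 0 → D - monDeg μ (headMon ord e) ∈ imPhi μ
  arrow : ∀ D e, IsArrow μ D e → e.degree = 1

/-- Over a nontrivial ring, equality in the algebra gives equality of monomials. The first letter of
the sorted path is then the smallest variable of the monomial, and it ends at a vertex; for an
arrow, indecomposability leaves only one letter. -/
lemma Directable.exists_isDirected [Nontrivial k] (h : Directable k μ) :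
    ∃ ord, IsDirected μ ord := by
  obtain ⟨r, hr⟩ := h
  obtain ⟨ord, hmono, hlt⟩ := @exists_ord (Fin N) r _
  rw [Fintype.card_fin] at hlt
  have key : ∀ D e, IsMor μ D e → ∃ l : List (Fin N), l.Pairwise (fun i j => r.le i j) ∧
      IsPath μ D (l.map fun i => Finsupp.single i 1) ∧
      (l.map fun i => (Finsupp.single i 1 : Fin N →₀ ℕ)).sum = e := by
    intro D e he
    obtain ⟨w, hw, hs⟩ := he.exists_path
    obtain ⟨l, h1, h2, h3⟩ := hr D w hw
    refine ⟨l, h1, h2, ?_⟩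
    rw [hw.pathElem_eq k, h2.pathElem_eq k, hs] at h3
    exact (mono_injective k he h2.isMor h3).symm
  have hinj : Function.Injective ord := (@StrictMono.injective _ _ r _ _ hmono)
  refine ⟨ord, hinj, hlt, ?_, ?_⟩
  · intro D e he he0
    obtain ⟨l, h1, h2, h3⟩ := key D e he
    rcases l with - | ⟨i, l⟩
    · exact absurd h3.symm he0
    have hle : ∀ j ∈ e.support, ord i ≤ ord j := by
      intro j hj
      rw [← h3] at hj
      have h4 : j ∈ i :: l := by
        by_contra hc
        have : ∀ l : List (Fin N), j ∉ l →
            (l.map fun i => (Finsupp.single i 1 : Fin N →₀ ℕ)).sum j = 0 := by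
          intro l
          induction l with
          | nil => exact fun _ => rfl
          | cons a l ih =>
            intro hc
            rw [List.mem_cons, not_or] at hc
            rw [List.map_cons, List.sum_cons, Finsupp.add_apply, ih hc.2,
              Finsupp.single_eq_of_ne hc.1]
        exact (Finsupp.mem_support_iff.1 hj) (this _ hc)
      rcases List.mem_cons.1 h4 with rfl | h5
      · exact le_rfl
      · exact (@StrictMono.monotone _ _ r.toPartialOrder _ _ hmono) ((List.pairwise_cons.1 h1).1 j h5)
    have hi : i ∈ e.support := by
      rw [← h3]
      simp
    obtain ⟨j, hj, h4, -, h5⟩ := head_spec ord he0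
    have : j = i := hinj (le_antisymm (h5 i hi) (hle j hj))
    rw [h4, this]
    exact h2.1.1.2
  · intro D e he
    obtain ⟨l, h1, h2, h3⟩ := key D e he.1
    rcases l with - | ⟨i, l⟩
    · exact absurd h3.symm he.2.1
    · rw [List.map_cons, List.sum_cons] at h3
      rcases he.2.2 _ _ h3.symm h2.1.1 with h4 | h4
      · simp at h4
      · rw [← h3, h4, add_zero, Finsupp.degree_single]

end Paths

/-! ### The bar resolution and its Morse data -/

section FacetIndex

variable {N : ℕ} {Γ : Type*} [AddCommGroup Γ] {μ : (Fin N → ℤ) →+ Γ} {n : ℕ}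

/-- Outer facets have smaller degree than inner ones, and strict monotonicity of the chain recovers
the omitted index. Hence a matched pair has a single incidence number. -/
lemma Cell.facet_inj (η : Cell μ (n + 1)) {i j : Fin (n + 2)} (hj : j ≠ 0)
    (hj' : j ≠ Fin.last _) (h : η.facet i = η.facet j) : i = j := by
  have h1 : i ≠ 0 ∧ i ≠ Fin.last _ := by
    by_contra! hc
    have h2 : i = 0 ∨ i = Fin.last _ := by tauto
    have h3 := η.degree_facet_lt h2
    rw [h, η.facet_p_last hj hj'] at h3
    exact lt_irrefl _ h3
  refine Fin.succAbove_left_injective (funext fun l => η.strictMono.injective ?_)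
  have h2 := congrFun (congrArg Cell.p h) l
  simpa only [facet, p_succAbove_zero h1.1, p_succAbove_zero hj, tsub_zero] using h2

lemma matched_unique {ord : Fin N → ℕ} {τ : Cell μ (n + 1)} {u v : Cell μ n}
    (h : u.IsBot ord ∧ τ.src = u.src ∧ τ.word = upWord ord u.word)
    (h' : v.IsBot ord ∧ τ.src = v.src ∧ τ.word = upWord ord v.word) : u = v :=
  Cell.ext_word (h.2.1.symm.trans h'.2.1) (upWord_injOn (h.2.2.symm.trans h'.2.2) h.1 h'.1)

lemma IsDirected.isCritical_iff {ord : Fin N → ℕ} (hord : IsDirected μ ord) (η : Cell μ n) :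
    IsCritical (matching ord μ) ⟨n, η⟩ ↔ η.IsCrit ord :=
  BondalRuan.isCritical_iff hord.inj hord.lt hord.split η

end FacetIndex

/-- Coefficients on the right for the bar complex: a ring `R ≅ A ⊗ B`, an idempotent of `B` for every
cell and an element of `B` for every facet of a cell. -/
structure RightData (k : Type*) [CommRing k] {N : ℕ} {Γ : Type*} [AddCommGroup Γ]
    (μ : (Fin N → ℤ) →+ Γ) (B R : Type*) [Ring B] [Algebra k B] [Ring R] [Algebra k R] where
  Θ : Alg k μ ⊗[k] B ≃ₐ[k] R
  f : ∀ {n}, Cell μ n → B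
  rc : ∀ {n}, Cell μ (n + 1) → Fin (n + 2) → B
  f_mul_f : ∀ {n} (η : Cell μ n), f η * f η = f η
  f_mul_rc : ∀ {n} (η : Cell μ (n + 1)) i, f η * rc η i = rc η i
  rc_mul_f : ∀ {n} (η : Cell μ (n + 1)) i, rc η i * f (η.facet i) = rc η i
  rc_of_ne : ∀ {n} (η : Cell μ (n + 1)) i, i ≠ Fin.last _ → rc η i = f η
  f_facet : ∀ {n} (η : Cell μ (n + 1)) i, i ≠ Fin.last _ → f (η.facet i) = f η
  -- Right coefficients ignore what is prepended, so the homotopy can act on the left factor alone.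
  rc_cons : ∀ {n} D a (η : Cell μ (n + 1)) hD ha h i,
    rc (Cell.cons D a η hD ha h) i.succ = rc η i

namespace RightData

variable {k : Type*} [CommRing k] {N : ℕ} {Γ : Type*} [AddCommGroup Γ]
    {μ : (Fin N → ℤ) →+ Γ} {B R : Type*} [Ring B] [Algebra k B] [Ring R] [Algebra k R]
    (𝓑 : RightData k μ B R) {n : ℕ}

lemma f_cons {D : Γ} {a : Fin N →₀ ℕ} {η : Cell μ n} {hD : D ∈ imPhi μ} {ha : a ≠ 0}
    {h : D - monDeg μ a = η.src} : 𝓑.f (Cell.cons D a η hD ha h) = 𝓑.f η := by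
  rw [← 𝓑.f_facet _ 0 (Fin.last_pos (n := n)).ne, Cell.cons_facet_zero]

/-- The element `a ⊗ b`. -/
abbrev tm (a : Alg k μ) (b : B) : R := 𝓑.Θ (a ⊗ₜ[k] b)

lemma tm_mul (a a' : Alg k μ) (b b' : B) : 𝓑.tm a b * 𝓑.tm a' b' = 𝓑.tm (a * a') (b * b') := by
  rw [tm, tm, ← map_mul, Algebra.TensorProduct.tmul_mul_tmul]

/-- The idempotent of a cell. -/
def idem (η : Cell μ n) : R := 𝓑.tm (mono k μ η.src 0) (𝓑.f η)

/-- The coefficient of a facet, without the sign. -/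
def facetCo (η : Cell μ (n + 1)) (i : Fin (n + 2)) : R :=
  𝓑.tm (mono k μ η.src (η.p (i.succAbove 0))) (𝓑.rc η i)

/-- The differential of the bar complex. -/
def barD (η : Cell μ (n + 1)) : Cell μ n →₀ R :=
  ∑ i : Fin (n + 2), Finsupp.single (η.facet i) ((-1 : ℤ) ^ (i : ℕ) • 𝓑.facetCo η i)

lemma idem_mul_idem (η : Cell μ n) : 𝓑.idem η * 𝓑.idem η = 𝓑.idem η := by
  rw [idem, tm_mul, mono_zero_mul, 𝓑.f_mul_f]

lemma idem_mul_facetCo (η : Cell μ (n + 1)) (i : Fin (n + 2)) :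
    𝓑.idem η * 𝓑.facetCo η i = 𝓑.facetCo η i := by
  rw [idem, facetCo, tm_mul, mono_zero_mul, 𝓑.f_mul_rc]

lemma facetCo_mul_idem (η : Cell μ (n + 1)) (i : Fin (n + 2)) :
    𝓑.facetCo η i * 𝓑.idem (η.facet i) = 𝓑.facetCo η i := by
  rw [idem, facetCo, tm_mul, 𝓑.rc_mul_f, mono_mul_zero]
  rfl

lemma facetCo_of_ne (η : Cell μ (n + 1)) {i : Fin (n + 2)} (hi : i ≠ 0) (hi' : i ≠ Fin.last _) :
    𝓑.facetCo η i = 𝓑.idem η := by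
  rw [facetCo, Cell.p_succAbove_zero hi, 𝓑.rc_of_ne η i hi', idem]

lemma idem_facet (η : Cell μ (n + 1)) {i : Fin (n + 2)} (hi : i ≠ 0) (hi' : i ≠ Fin.last _) :
    𝓑.idem (η.facet i) = 𝓑.idem η := by
  rw [idem, idem, 𝓑.f_facet η i hi']
  simp only [Cell.facet, Cell.p_succAbove_zero hi, map_zero, sub_zero]

open Classical in
lemma barD_apply_eq_zero {η : Cell μ (n + 1)} {v : Cell μ n} (h : ∀ i, η.facet i ≠ v) :
    𝓑.barD η v = 0 := by
  rw [barD, Finsupp.finsetSum_apply]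
  exact Finset.sum_eq_zero fun i _ => Finsupp.single_eq_of_ne (h i).symm

lemma barD_apply_facet (η : Cell μ (n + 1)) {i : Fin (n + 2)} (hi : i ≠ 0)
    (hi' : i ≠ Fin.last _) : 𝓑.barD η (η.facet i) = (-1 : ℤ) ^ (i : ℕ) • 𝓑.idem η := by
  rw [barD, Finsupp.finsetSum_apply, Finset.sum_eq_single i]
  · rw [Finsupp.single_eq_same, 𝓑.facetCo_of_ne η hi hi']
  · intro j _ hj
    exact Finsupp.single_eq_of_ne fun h => hj (η.facet_inj hi hi' h.symm)
  · simp

variable {ord : Fin N → ℕ} (hord : IsDirected μ ord)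

include hord in
lemma exists_up {u : Cell μ n} (hu : u.IsBot ord) : ∃ (τ : Cell μ (n + 1)) (i : Fin (n + 2)),
    (τ.src = u.src ∧ τ.word = upWord ord u.word) ∧ i ≠ 0 ∧ i ≠ Fin.last _ ∧ τ.facet i = u := by
  obtain ⟨τ, hτ⟩ := exists_matched_top hord.split hu
  obtain ⟨i, hi⟩ := matched_facet ⟨hu, hτ⟩
  exact ⟨τ, i, hτ, hi⟩

open Classical in
/-- The bar complex with the matching of its cells. -/
@[reducible]
def morse : MorseData R (Cell μ) where
  e := 𝓑.idem
  d := 𝓑.barD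
  C := fun {n} η => IsCritical (matching ord μ) ⟨n, η⟩
  U := Cell.IsBot ord
  up u hu := (exists_up hord hu).choose
  sg u := if hu : u.IsBot ord then (-1) ^ ((exists_up hord hu).choose_spec.choose : ℕ) else 1
  pot := Cell.pot ord
  idem := 𝓑.idem_mul_idem
  smul_d η := by
    rw [barD, Finset.smul_sum]
    refine Finset.sum_congr rfl fun i _ => ?_
    rw [Finsupp.smul_single, smul_eq_mul, mul_smul_comm, idem_mul_facetCo]
  d_mul η v := by
    rw [barD, Finsupp.finsetSum_apply, Finset.sum_mul]
    refine Finset.sum_congr rfl fun i _ => ?_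
    rw [Finsupp.single_apply]
    split_ifs with h
    · rw [← h, smul_mul_assoc, facetCo_mul_idem]
    · rw [zero_mul]
  crit_zero η := (hord.isCritical_iff η).2 (isCrit_zero η)
  not_crit_of_bot u hu h := hu.not_crit ((hord.isCritical_iff u).1 h)
  up_not_crit u hu h := (matched_top ⟨hu, (exists_up hord hu).choose_spec.choose_spec.1⟩).1
    ((hord.isCritical_iff _).1 h)
  up_not_bot u hu := (matched_top ⟨hu, (exists_up hord hu).choose_spec.choose_spec.1⟩).2
  exists_up τ h1 h2 := by
    obtain ⟨u, hu, h3, h4⟩ := exists_matched_bot hord.inj hord.lt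
      (fun h => h1 ((hord.isCritical_iff τ).2 h)) h2
    have h5 := (exists_up hord hu).choose_spec.choose_spec.1
    exact ⟨u, hu, Cell.ext_word (h5.1.trans h3.symm) (h5.2.trans h4.symm)⟩
  e_up u hu := by
    obtain ⟨h1, h2, h3, h4⟩ := (exists_up hord hu).choose_spec.choose_spec
    conv_rhs => rw [← h4, 𝓑.idem_facet _ h2 h3]
  pot_lt u hu v hv hne := by
    obtain ⟨h1, h2, h3, h4⟩ := (exists_up hord hu).choose_spec.choose_spec
    rw [dif_pos hu] at hne
    generalize (exists_up hord hu).choose_spec.choose = j at *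
    generalize (exists_up hord hu).choose = τ at *
    -- A bottom in the boundary of `τ` whose potential is not smaller is matched with `τ`, so it is
    -- `u`; there the coefficient cancels against the subtracted term.
    by_contra! hpot
    rw [← matched_pot ⟨hu, h1⟩] at hpot
    refine hne ?_
    rw [Finsupp.sub_apply]
    by_cases huv : v = u
    · subst huv
      rw [Finsupp.single_eq_same]
      conv_lhs => rw [← h4]
      rw [𝓑.barD_apply_facet τ h2 h3, 𝓑.idem_facet τ h2 h3]
      simp
    · rw [Finsupp.single_eq_of_ne huv, sub_zero, 𝓑.barD_apply_eq_zero]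
      rintro i rfl
      have h5 := (mem_matching ord).1
        (facet_bot hord.inj (matched_top ⟨hu, h1⟩).2 hv hpot)
      exact huv (matched_unique h5 ⟨hu, h1⟩)

/-- The homotopy of the bar complex, on the summand of a cell. -/
def htpyAux (η : Cell μ n) : Alg k μ →ₗ[k] B →ₗ[k] (Cell μ (n + 1) →₀ R) :=
  open Classical in
  (monoBasis k μ).constr k fun x =>
    if h : x.1.2 ≠ 0 ∧ x.1.1 - monDeg μ x.1.2 = η.src then
      Finsupp.lsingle (Cell.cons x.1.1 x.1.2 η x.2.1 h.1 h.2) ∘ₗ 𝓑.Θ.toLinearMap ∘ₗ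
        TensorProduct.mk k _ _ (mono k μ x.1.1 0)
    else 0

/-- The contracting homotopy of the bar complex, `a ⊗ [η] ⊗ b ↦ 1 ⊗ [a | η] ⊗ b`. -/
def htpy (n : ℕ) : (Cell μ n →₀ R) →ₗ[k] (Cell μ (n + 1) →₀ R) :=
  Finsupp.lsum k fun η => TensorProduct.lift (𝓑.htpyAux η) ∘ₗ 𝓑.Θ.symm.toLinearMap

lemma htpy_single {η : Cell μ n} {D : Γ} {e : Fin N →₀ ℕ} (b : B) (hD : D ∈ imPhi μ) (he : e ≠ 0)
    (h : D - monDeg μ e = η.src) : 𝓑.htpy n (Finsupp.single η (𝓑.tm (mono k μ D e) b)) =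
      Finsupp.single (Cell.cons D e η hD he h) (𝓑.tm (mono k μ D 0) b) := by
  have hm : IsMor μ D e := ⟨hD, by rw [h]; exact η.src_mem⟩
  have h1 : 𝓑.htpyAux η (mono k μ D e) b =
      Finsupp.single (Cell.cons D e η hD he h) (𝓑.tm (mono k μ D 0) b) := by
    rw [htpyAux, ← monoBasis_apply k ⟨(D, e), hm⟩, Module.Basis.constr_basis, dif_pos ⟨he, h⟩]
    rfl
  rw [← h1]
  simp [htpy]

lemma htpy_single_zero (η : Cell μ n) {D : Γ} (hD : D ∈ imPhi μ) (b : B) :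
    𝓑.htpy n (Finsupp.single η (𝓑.tm (mono k μ D 0) b)) = 0 := by
  have h1 : 𝓑.htpyAux η (mono k μ D 0) b = 0 := by
    rw [htpyAux, ← monoBasis_apply k ⟨(D, 0), isMor_zero hD⟩, Module.Basis.constr_basis,
      dif_neg (by simp)]
    rfl
  rw [← h1]
  simp [htpy]

/-- The idempotent of a cell kills monomials that do not end at its start, so only compatible
tensors remain. -/
lemma sub_induction {P : (Cell μ n →₀ R) → Prop} (h0 : P 0) (hadd : ∀ x y, P x → P y → P (x + y))
    (hs : ∀ (η : Cell μ n) D e b, IsMor μ D e → D - monDeg μ e = η.src → b * 𝓑.f η = b →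
      P (Finsupp.single η (𝓑.tm (mono k μ D e) b)))
    {x : Cell μ n →₀ R} (hx : x ∈ (𝓑.morse hord).sub n) : P x := by
  have h1 : ∀ (η : Cell μ n) (r : R), P (Finsupp.single η (r * 𝓑.idem η)) := by
    intro η r
    obtain ⟨t, rfl⟩ := 𝓑.Θ.surjective r
    induction t using TensorProduct.induction_on with
    | zero => simpa using h0
    | add s t hs ht => rw [map_add, add_mul, Finsupp.single_add]; exact hadd _ _ hs ht
    | tmul a b =>
      induction a using mono_induction with
      | h0 => simpa using h0
      | hadd a a' ha ha' =>
        rw [TensorProduct.add_tmul, map_add, add_mul, Finsupp.single_add]; exact hadd _ _ ha ha'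
      | hmono c D e he =>
        rw [TensorProduct.smul_tmul, idem, tm_mul]
        by_cases h : D - monDeg μ e = η.src
        · rw [mono_mul_zero k h]
          exact hs η D e _ he h (by rw [mul_assoc, 𝓑.f_mul_f])
        · rw [mono_mul_of_ne k h, tm, TensorProduct.zero_tmul, map_zero, Finsupp.single_zero]
          exact h0
  rw [(𝓑.morse hord).sub_eq_sum hx]
  refine Finset.sum_induction _ P hadd h0 fun η _ => ?_
  simp only [Finsupp.smul_single, smul_eq_mul]
  exact h1 η _

lemma single_tm_mem {η : Cell μ n} {D : Γ} {e : Fin N →₀ ℕ} {b : B}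
    (h : D - monDeg μ e = η.src) (hb : b * 𝓑.f η = b) :
    Finsupp.single η (𝓑.tm (mono k μ D e) b) ∈ (𝓑.morse hord).sub n := by
  have h1 : 𝓑.tm (mono k μ D e) b = 𝓑.tm (mono k μ D e) b * 𝓑.idem η := by
    rw [idem, tm_mul, mono_mul_zero k h, hb]
  rw [h1, ← smul_eq_mul, ← Finsupp.smul_single]
  exact Submodule.smul_mem _ _ ((𝓑.morse hord).single_mem η)

lemma htpy_mem {x : Cell μ n →₀ R} (hx : x ∈ (𝓑.morse hord).sub n) :
    𝓑.htpy n x ∈ (𝓑.morse hord).sub (n + 1) := by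
  refine 𝓑.sub_induction hord (P := fun x => 𝓑.htpy n x ∈ (𝓑.morse hord).sub (n + 1)) ?_ ?_ ?_ hx
  · rw [map_zero]; exact zero_mem _
  · intro x y hx hy
    rw [map_add]; exact add_mem hx hy
  · intro η D e b he h hb
    by_cases he0 : e = 0
    · subst he0
      rw [htpy_single_zero 𝓑 η he.1]
      exact zero_mem _
    · rw [𝓑.htpy_single b he.1 he0 h]
      refine 𝓑.single_tm_mem hord ?_ ?_
      · rw [map_zero, sub_zero]; rfl
      · rw [f_cons, hb]

lemma tm_smul_barD (a : Alg k μ) (b : B) (η : Cell μ (n + 1)) :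
    𝓑.tm a b • 𝓑.barD η = ∑ i : Fin (n + 2), (-1 : ℤ) ^ (i : ℕ) • Finsupp.single (η.facet i)
      (𝓑.tm (a * mono k μ η.src (η.p (i.succAbove 0))) (b * 𝓑.rc η i)) := by
  rw [barD, Finset.smul_sum]
  refine Finset.sum_congr rfl fun i _ => ?_
  rw [Finsupp.smul_single, smul_eq_mul, mul_smul_comm, facetCo, tm_mul, Finsupp.smul_single]

/-- The bar complex is contractible in positive degrees. -/
lemma D_htpy_add {x : Cell μ (n + 1) →₀ R} (hx : x ∈ (𝓑.morse hord).sub (n + 1)) :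
    (𝓑.morse hord).D (n + 1) (𝓑.htpy (n + 1) x) + 𝓑.htpy n ((𝓑.morse hord).D n x) = x := by
  refine 𝓑.sub_induction hord (P := fun x => (𝓑.morse hord).D (n + 1) (𝓑.htpy (n + 1) x) +
    𝓑.htpy n ((𝓑.morse hord).D n x) = x) (by simp) ?_ ?_ hx
  · intro x y hx hy
    rw [map_add, map_add, map_add, map_add, add_add_add_comm, hx, hy]
  · intro η D e b he h hb
    rw [MorseData.D_single]
    change _ + 𝓑.htpy n (𝓑.tm (mono k μ D e) b • 𝓑.barD η) = _
    rw [tm_smul_barD, map_sum]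
    -- For `e = 0` the homotopy kills the element, and in its boundary only facet `0` has a
    -- nontrivial left factor; prepending that factor rebuilds `η`. For `e ≠ 0` facet `0` of the
    -- prepended cell returns the element, and facet `i + 1` cancels the prepended facet `i`.
    by_cases he0 : e = 0
    · subst he0
      rw [map_zero, sub_zero] at h
      subst h
      rw [𝓑.htpy_single_zero η he.1, map_zero, zero_add, Fin.sum_univ_succ, Finset.sum_eq_zero,
        add_zero]
      · rw [mono_zero_mul, Fin.val_zero, pow_zero, one_smul, 𝓑.rc_of_ne η 0 (Fin.last_pos (n := n)).ne,
          Cell.p_succAbove_zero_zero, hb, 𝓑.htpy_single b η.src_mem η.p_one_ne_zero η.facet_zero_src,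
          ← η.eq_cons]
      · intro i _
        rw [Cell.p_succAbove_zero (Fin.succ_ne_zero i), mono_zero_mul, map_zsmul,
          𝓑.htpy_single_zero _ he.1, smul_zero]
    · rw [𝓑.htpy_single b he.1 he0 h, MorseData.D_single]
      change 𝓑.tm (mono k μ D 0) b • 𝓑.barD _ + _ = _
      rw [tm_smul_barD, Fin.sum_univ_succ, add_assoc, ← Finset.sum_add_distrib, Finset.sum_eq_zero,
        add_zero]
      · rw [Cell.cons_facet_zero, 𝓑.rc_of_ne _ 0 (Fin.last_pos (n := n + 1)).ne, f_cons, hb, Fin.val_zero,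
          pow_zero, one_smul, Cell.p_succAbove_zero_zero, ← Fin.succ_zero_eq_one, Cell.cons_p_succ,
          η.zero, add_zero]
        rw [show (Cell.cons D e η he.1 he0 h).src = D from rfl, mono_zero_mul]
      · intro i _
        have hei : e + η.p (i.succAbove 0) ≠ 0 := fun h => he0 (add_eq_zero.1 h).1
        have hsrc : D - monDeg μ (e + η.p (i.succAbove 0)) = (η.facet i).src := by
          rw [map_add, ← sub_sub, h]; rfl
        rw [Cell.cons_facet_succ, 𝓑.rc_cons, Cell.p_succAbove_zero (Fin.succ_ne_zero i),
          show (Cell.cons D e η he.1 he0 h).src = D from rfl, mono_zero_mul,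
          mono_mul_eq k he h, map_zsmul, 𝓑.htpy_single _ he.1 hei hsrc, Fin.val_succ, pow_succ,
          mul_neg_one, neg_smul, neg_add_cancel]

section Exact

variable (q : (Cell μ 0 →₀ R) → (Cell μ 0 →₀ R))
  (hq : ∀ x ∈ (𝓑.morse hord).sub 0, (𝓑.morse hord).D 0 (𝓑.htpy 0 x) + q x = x)
  (hqD : ∀ x ∈ (𝓑.morse hord).sub 1, q ((𝓑.morse hord).D 0 x) = 0)

/-- The image of the homotopy generates in positive degrees, so identities of linear maps may be
checked on it. -/
lemma single_idem_eq (η : Cell μ (n + 1)) :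
    ∃ x ∈ (𝓑.morse hord).sub n, Finsupp.single η (𝓑.idem η) = 𝓑.htpy n x := by
  refine ⟨Finsupp.single (η.facet 0) (𝓑.tm (mono k μ η.src (η.p 1)) (𝓑.f η)), ?_, ?_⟩
  · refine 𝓑.single_tm_mem hord η.facet_zero_src ?_
    rw [𝓑.f_facet η 0 (Fin.last_pos (n := n)).ne, 𝓑.f_mul_f]
  · rw [𝓑.htpy_single _ η.src_mem η.p_one_ne_zero η.facet_zero_src, ← η.eq_cons]
    rfl

include hq hqD

/-- On the image of the homotopy `h`, the relation `D h = 1 - h D` turns `D D h` into `h D D` one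
degree lower. The induction starts from the vanishing of `q` on boundaries. -/
lemma D_D : ∀ n, ∀ x ∈ (𝓑.morse hord).sub (n + 2),
    (𝓑.morse hord).D n ((𝓑.morse hord).D (n + 1) x) = 0 := by
  have key : ∀ n, (∀ x ∈ (𝓑.morse hord).sub (n + 1), (𝓑.morse hord).D n ((𝓑.morse hord).D (n + 1)
      (𝓑.htpy (n + 1) x)) = 0) → ∀ x ∈ (𝓑.morse hord).sub (n + 2),
      (𝓑.morse hord).D n ((𝓑.morse hord).D (n + 1) x) = 0 := by
    intro n hn x hx
    rw [(𝓑.morse hord).sub_eq_sum hx, map_finsuppSum, map_finsuppSum]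
    refine Finset.sum_eq_zero fun η _ => ?_
    dsimp only
    obtain ⟨y, hy, h⟩ := 𝓑.single_idem_eq hord η
    rw [map_smul, map_smul]
    change _ • (𝓑.morse hord).D n ((𝓑.morse hord).D (n + 1) (Finsupp.single η (𝓑.idem η))) = 0
    rw [h, hn y hy, smul_zero]
  intro n
  induction n with
  | zero =>
    refine key 0 fun x hx => ?_
    rw [eq_sub_of_add_eq (𝓑.D_htpy_add hord hx), map_sub,
      eq_sub_of_add_eq (hq _ ((𝓑.morse hord).D_mem x)), hqD x hx, sub_zero, sub_self]
  | succ n ih =>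
    refine key (n + 1) fun x hx => ?_
    rw [eq_sub_of_add_eq (𝓑.D_htpy_add hord hx), map_sub,
      eq_sub_of_add_eq (𝓑.D_htpy_add hord ((𝓑.morse hord).D_mem x)), ih x hx, map_zero, sub_zero,
      sub_self]

omit hq hqD in
lemma bar_exact {x : Cell μ (n + 1) →₀ R} (hx : x ∈ (𝓑.morse hord).sub (n + 1))
    (h : (𝓑.morse hord).D n x = 0) :
    ∃ y ∈ (𝓑.morse hord).sub (n + 2), (𝓑.morse hord).D (n + 1) y = x := by
  refine ⟨𝓑.htpy (n + 1) x, 𝓑.htpy_mem hord hx, ?_⟩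
  have := 𝓑.D_htpy_add hord hx
  rwa [h, map_zero, add_zero] at this

end Exact

end RightData

/-! ### Sums over gradient paths -/

section Idx

variable {N : ℕ} {Γ : Type*} [AddCommGroup Γ] {μ : (Fin N → ℤ) →+ Γ} {n : ℕ}

/-- The index of the first facet of a gradient path. -/
def GradPath.idx {M : Set (AnyCell μ × AnyCell μ)} {η : Cell μ (n + 1)} {σ : Cell μ n} :
    GradPath M η σ → Fin (n + 2)
  | .down _ i _ => i
  | .step _ i _ _ _ _ _ _ _ => i

end Idx

namespace RightData

variable {k : Type*} [CommRing k] {N : ℕ} {Γ : Type*} [AddCommGroup Γ]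
    {μ : (Fin N → ℤ) →+ Γ} {B R : Type*} [Ring B] [Algebra k B] [Ring R] [Algebra k R]
    (𝓑 : RightData k μ B R) {n : ℕ}

/-- The coefficient of a gradient path. -/
def pathCo {M : Set (AnyCell μ × AnyCell μ)} {n : ℕ} {η : Cell μ (n + 1)} {σ : Cell μ n} :
    GradPath M η σ → R
  | .down η i _ => (-1 : ℤ) ^ (i : ℕ) • 𝓑.facetCo η i
  | .step η i _ _ j _ _ _ γ =>
      ((-1 : ℤ) ^ (i : ℕ) * -(-1 : ℤ) ^ (j : ℕ)) • (𝓑.facetCo η i * pathCo γ)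

variable {ord : Fin N → ℕ} (hord : IsDirected μ ord)

lemma not_crit_of_mem {τ : Cell μ (n + 1)} {u : Cell μ n}
    (h : ((⟨n + 1, τ⟩ : AnyCell μ), (⟨n, u⟩ : AnyCell μ)) ∈ matching ord μ) :
    ¬ IsCritical (matching ord μ) ⟨n, u⟩ :=
  fun h' => (h' _).2 h

/-- The sum over the gradient paths that start with the `i`-th facet. -/
lemma finsum_idx (η : Cell μ (n + 1)) (i : Fin (n + 2)) (σ : (𝓑.morse hord).Critical n)
    (hM : ((⟨n + 1, η⟩ : AnyCell μ), (⟨n, η.facet i⟩ : AnyCell μ)) ∉ matching ord μ)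
    (ih : ∀ (τ : Cell μ (n + 1)),
      ((⟨n + 1, τ⟩ : AnyCell μ), (⟨n, η.facet i⟩ : AnyCell μ)) ∈ matching ord μ →
      Finite (GradPath (matching ord μ) τ σ.1) ∧
      ∑ᶠ γ : GradPath (matching ord μ) τ σ.1, 𝓑.pathCo γ =
        ∑ᶠ (l : Fin (n + 2)) (_ : ((⟨n + 1, τ⟩ : AnyCell μ), (⟨n, τ.facet l⟩ : AnyCell μ)) ∉
          matching ord μ), (-1 : ℤ) ^ (l : ℕ) • (𝓑.facetCo τ l *
          (𝓑.morse hord).proj n (Finsupp.single (τ.facet l) 1) σ)) :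
    {γ : GradPath (matching ord μ) η σ.1 | γ.idx = i}.Finite ∧
    ∑ᶠ γ ∈ {γ : GradPath (matching ord μ) η σ.1 | γ.idx = i}, 𝓑.pathCo γ =
      (-1 : ℤ) ^ (i : ℕ) • (𝓑.facetCo η i *
          (𝓑.morse hord).proj n (Finsupp.single (η.facet i) 1) σ) := by
  classical
  -- A bottom is not critical, so the path must go up to its unique partner `τ` and leave `τ`
  -- through a facet other than the matched facet `j`.
  by_cases hU : (η.facet i).IsBot ord
  · obtain ⟨τ, j, h1, h2, h3, h4⟩ := exists_up hord hU
    have hτ : ((⟨n + 1, τ⟩ : AnyCell μ), (⟨n, η.facet i⟩ : AnyCell μ)) ∈ matching ord μ :=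
      (mem_matching ord).2 ⟨hU, h1⟩
    have hτ' : ((⟨n + 1, τ⟩ : AnyCell μ), (⟨n, τ.facet j⟩ : AnyCell μ)) ∈ matching ord μ := by
      rw [h4]; exact hτ
    obtain ⟨hfin, hsum⟩ := ih τ hτ
    let g : GradPath (matching ord μ) τ σ.1 → GradPath (matching ord μ) η σ.1 :=
      fun γ => .step η i hM τ j h4 hτ' σ.1 γ
    have hg : Function.Injective g := by
      intro γ γ' h
      simpa [g] using h
    have hrange : {γ : GradPath (matching ord μ) η σ.1 | γ.idx = i} = Set.range g := by
      ext γ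
      constructor
      · intro h
        have hσ := σ.2
        obtain ⟨σ, hσ'⟩ := σ
        simp only at *
        clear hsum ih
        cases γ with
        | down _ i' h' =>
          obtain rfl : i' = i := h
          exact absurd hσ (not_crit_of_mem hτ)
        | step _ i' h' τ' j' hj' hM' _ γ =>
          obtain rfl : i' = i := h
          have hM2 := hM'
          rw [hj'] at hM2
          obtain rfl : τ' = τ := by
            have := matching_isMatching.bot_unique _ _ _ hM2 hτ
            obtain ⟨-, h5⟩ := Sigma.mk.inj_iff.1 this
            exact eq_of_heq h5
          obtain rfl : j' = j := τ'.facet_inj h2 h3 (hj'.trans h4.symm)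
          exact ⟨γ, rfl⟩
      · rintro ⟨γ, rfl⟩
        rfl
    rw [hrange]
    refine ⟨Set.finite_range g, ?_⟩
    rw [finsum_mem_range hg]
    have h5 : ∀ γ, 𝓑.pathCo (g γ) =
        ((-1 : ℤ) ^ (i : ℕ) * -(-1 : ℤ) ^ (j : ℕ)) • (𝓑.facetCo η i * 𝓑.pathCo γ) := fun γ => rfl
    simp only [h5]
    rw [← smul_finsum' _ (Set.toFinite _), ← mul_finsum' _ _ (Set.toFinite _), hsum]
    have h6 : ∀ l, ((⟨n + 1, τ⟩ : AnyCell μ), (⟨n, τ.facet l⟩ : AnyCell μ)) ∉ matching ord μ ↔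
        l ≠ j := by
      intro l
      refine not_congr ⟨fun h => ?_, fun h => by rw [h]; exact hτ'⟩
      exact τ.facet_inj h2 h3
        (matched_unique ((mem_matching ord).1 h) ((mem_matching ord).1 hτ'))
    simp only [h6]
    -- Since `proj` kills the boundary of `τ`, the facets other than `j` sum to minus the term of
    -- `j`; the sign of the upward step compensates for this.
    have h7 : ∑ᶠ (l : Fin (n + 2)) (_ : l ≠ j), (-1 : ℤ) ^ (l : ℕ) • (𝓑.facetCo τ l *
          (𝓑.morse hord).proj n (Finsupp.single (τ.facet l) 1) σ) =
        -((-1 : ℤ) ^ (j : ℕ) • (𝓑.idem (η.facet i) *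
          (𝓑.morse hord).proj n (Finsupp.single (η.facet i) 1) σ)) := by
      have h8 : (𝓑.morse hord).proj n (𝓑.barD τ) = 0 := by
        have h9 : ((𝓑.morse hord).up (η.facet i) hU) = τ := by
          refine Cell.ext_word ?_ ?_
          · exact (exists_up hord hU).choose_spec.choose_spec.1.1.trans h1.1.symm
          · exact (exists_up hord hU).choose_spec.choose_spec.1.2.trans h1.2.symm
        rw [← h9]
        exact ((𝓑.morse hord).isProj_proj n).d_up _ hU
      have h9 := DFunLike.congr_fun h8 σ
      rw [barD, map_sum, Finsupp.finsetSum_apply] at h9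
      have h10 : ∀ l : Fin (n + 2), (𝓑.morse hord).proj n (Finsupp.single (τ.facet l)
          ((-1 : ℤ) ^ (l : ℕ) • 𝓑.facetCo τ l)) σ = (-1 : ℤ) ^ (l : ℕ) • (𝓑.facetCo τ l *
          (𝓑.morse hord).proj n (Finsupp.single (τ.facet l) 1) σ) := by
        intro l
        rw [← smul_mul_assoc, ← smul_eq_mul, ← Finsupp.smul_apply, ← map_smul, Finsupp.smul_single,
          smul_eq_mul, mul_one]
      simp only [h10] at h9
      rw [← Finset.add_sum_erase _ _ (Finset.mem_univ j), h4, 𝓑.facetCo_of_ne τ h2 h3,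
        ← 𝓑.idem_facet τ h2 h3, h4, Finsupp.zero_apply] at h9
      rw [neg_eq_of_add_eq_zero_right h9, finsum_eq_sum_of_fintype, ← Finset.filter_ne',
        Finset.sum_filter]
      exact Finset.sum_congr rfl fun l _ => finsum_eq_if
    have hs : (-1 : ℤ) ^ (j : ℕ) * (-1 : ℤ) ^ (j : ℕ) = 1 := by
      rw [← mul_pow]; simp
    rw [h7, mul_neg (𝓑.facetCo η i), mul_smul_comm, ← mul_assoc (𝓑.facetCo η i), facetCo_mul_idem,
      smul_neg, smul_smul, ← neg_smul]
    congr 1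
    linear_combination (-1 : ℤ) ^ (i : ℕ) * hs
  -- No upward edge starts at a facet that is not a bottom, so the path ends there.
  · have hstep : ∀ (τ : Cell μ (n + 1)),
        ((⟨n + 1, τ⟩ : AnyCell μ), (⟨n, η.facet i⟩ : AnyCell μ)) ∉ matching ord μ :=
      fun τ h => hU ((mem_matching ord).1 h).1
    clear ih
    by_cases hσ : η.facet i = σ.1
    · have hset : ∀ (θ : Cell μ n) (hθ : η.facet i = θ) (γ : GradPath (matching ord μ) η θ),
          γ.idx = i → γ = hθ ▸ .down η i hM := by
        intro θ hθ γ h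
        cases γ with
        | down _ i' h' => obtain rfl : i' = i := h; rfl
        | step _ i' h' τ' j' hj' hM' _ γ =>
          obtain rfl : i' = i := h
          rw [hj'] at hM'
          exact absurd hM' (hstep τ')
      obtain ⟨σ, hσ'⟩ := σ
      obtain rfl : η.facet i = σ := hσ
      have hset' : {γ : GradPath (matching ord μ) η (η.facet i) | γ.idx = i} = {.down η i hM} := by
        ext γ
        refine ⟨fun h => hset _ rfl γ h, ?_⟩
        rintro rfl
        rfl
      dsimp only
      rw [hset']
      refine ⟨Set.finite_singleton _, ?_⟩
      rw [finsum_mem_singleton, pathCo]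
      rw [((𝓑.morse hord).isProj_proj n).crit ⟨η.facet i, hσ'⟩, Finsupp.single_eq_same, mul_one]
    · have hset : {γ : GradPath (matching ord μ) η σ.1 | γ.idx = i} = ∅ := by
        rw [Set.eq_empty_iff_forall_notMem]
        intro γ h
        obtain ⟨σ, hσ'⟩ := σ
        simp only at *
        cases γ with
        | down _ i' h' => obtain rfl : i' = i := h; exact hσ rfl
        | step _ i' h' τ' j' hj' hM' _ γ =>
          obtain rfl : i' = i := h
          rw [hj'] at hM'
          exact hstep τ' hM'
      rw [hset]
      refine ⟨Set.finite_empty, ?_⟩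
      rw [finsum_mem_empty]
      by_cases hC : IsCritical (matching ord μ) ⟨n, η.facet i⟩
      · rw [((𝓑.morse hord).isProj_proj n).crit ⟨η.facet i, hC⟩, Finsupp.single_eq_of_ne,
          mul_zero, smul_zero]
        intro h
        exact hσ (congrArg Subtype.val h).symm
      · rw [((𝓑.morse hord).isProj_proj n).top _ _ hC hU, Finsupp.zero_apply, mul_zero, smul_zero]

/-- By induction on the potential: the partner of a bottom facet has the potential of that facet,
which is smaller than that of `η` unless `η` is the partner. -/
lemma finite_gradPath_and_finsum (σ : (𝓑.morse hord).Critical n) (η : Cell μ (n + 1))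
    (hη : ¬ η.IsBot ord) :
    Finite (GradPath (matching ord μ) η σ.1) ∧
      ∑ᶠ γ : GradPath (matching ord μ) η σ.1, 𝓑.pathCo γ =
        ∑ᶠ (l : Fin (n + 2)) (_ : ((⟨n + 1, η⟩ : AnyCell μ), (⟨n, η.facet l⟩ : AnyCell μ)) ∉
          matching ord μ), (-1 : ℤ) ^ (l : ℕ) • (𝓑.facetCo η l *
          (𝓑.morse hord).proj n (Finsupp.single (η.facet l) 1) σ) := by
  induction hp : η.pot ord using Nat.strong_induction_on generalizing η with
  | _ m ih =>
    subst hp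
    have key := fun (i : Fin (n + 2)) (hi : ((⟨n + 1, η⟩ : AnyCell μ),
      (⟨n, η.facet i⟩ : AnyCell μ)) ∉ matching ord μ) => 𝓑.finsum_idx hord η i σ hi (by
        intro τ hτ
        have h1 := (mem_matching ord).1 hτ
        refine ih _ ?_ τ (matched_top h1).2 rfl
        rw [matched_pot h1]
        by_contra! hc
        exact hi (facet_bot hord.inj hη h1.1 hc))
    have hempty : ∀ i : Fin (n + 2), ((⟨n + 1, η⟩ : AnyCell μ), (⟨n, η.facet i⟩ : AnyCell μ)) ∈
        matching ord μ → {γ : GradPath (matching ord μ) η σ.1 | γ.idx = i} = ∅ := by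
      intro i hi
      rw [Set.eq_empty_iff_forall_notMem]
      intro γ h
      obtain ⟨σ, hσ'⟩ := σ
      simp only at *
      clear key ih
      cases γ with
      | down _ i' h' => obtain rfl : i' = i := h; exact h' hi
      | step _ i' h' τ' j' hj' hM' _ γ => obtain rfl : i' = i := h; exact h' hi
    have hfin : ∀ i : Fin (n + 2), {γ : GradPath (matching ord μ) η σ.1 | γ.idx = i}.Finite := by
      intro i
      by_cases hi : ((⟨n + 1, η⟩ : AnyCell μ), (⟨n, η.facet i⟩ : AnyCell μ)) ∈ matching ord μ
      · rw [hempty i hi]; exact Set.finite_empty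
      · exact (key i hi).1
    have hunion : (Set.univ : Set (GradPath (matching ord μ) η σ.1)) =
        ⋃ i, {γ : GradPath (matching ord μ) η σ.1 | γ.idx = i} := by
      ext γ; simp
    refine ⟨Set.finite_univ_iff.1 (hunion ▸ Set.finite_iUnion hfin), ?_⟩
    rw [← finsum_mem_univ, hunion, finsum_mem_iUnion ?_ hfin]
    · refine finsum_congr fun i => ?_
      by_cases hi : ((⟨n + 1, η⟩ : AnyCell μ), (⟨n, η.facet i⟩ : AnyCell μ)) ∈ matching ord μ
      · rw [hempty i hi, finsum_mem_empty]
        simp [hi]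
      · rw [(key i hi).2]
        simp [hi]
    · intro i j hij
      refine Set.disjoint_left.2 fun γ h h' => hij ?_
      exact h.symm.trans h'

/-- A critical cell is matched with none of its facets, so every first step is allowed and the whole
boundary is projected. -/
lemma finsum_pathCo (σ : (𝓑.morse hord).Critical n) (η : (𝓑.morse hord).Critical (n + 1)) :
    ∑ᶠ γ : GradPath (matching ord μ) η.1 σ.1, 𝓑.pathCo γ =
      (𝓑.morse hord).proj n (𝓑.barD η.1) σ := by
  have hη : ¬ Cell.IsBot ord η.1 := fun h => h.not_crit ((hord.isCritical_iff _).1 η.2)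
  rw [(𝓑.finite_gradPath_and_finsum hord σ η.1 hη).2]
  have h1 : ∀ l, ((⟨n + 1, η.1⟩ : AnyCell μ), (⟨n, Cell.facet η.1 l⟩ : AnyCell μ)) ∉
      matching ord μ :=
    fun l h => (η.2 _).1 h
  simp only [h1, not_false_eq_true, finsum_true]
  rw [finsum_eq_sum_of_fintype, barD, map_sum, Finsupp.finsetSum_apply]
  refine Finset.sum_congr rfl fun l _ => ?_
  rw [← smul_mul_assoc, ← smul_eq_mul, ← Finsupp.smul_apply, ← map_smul, Finsupp.smul_single,
    smul_eq_mul, mul_one]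

/-- Coefficients of gradient paths are homogeneous. -/
lemma pathCo_mem (𝓡 : ℕ → AddSubgroup R) (hmul : ∀ m n, ∀ a ∈ 𝓡 m, ∀ b ∈ 𝓡 n, a * b ∈ 𝓡 (m + n))
    (hco : ∀ n (η : Cell μ (n + 1)) i m, ((η.facet i).p (Fin.last n)).degree + m =
      (η.p (Fin.last (n + 1))).degree → 𝓑.facetCo η i ∈ 𝓡 m)
    {η : Cell μ (n + 1)} {σ : Cell μ n} (γ : GradPath (matching ord μ) η σ) :
    ∃ m, (σ.p (Fin.last n)).degree + m = (η.p (Fin.last (n + 1))).degree ∧ 𝓑.pathCo γ ∈ 𝓡 m := by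
  have hle : ∀ (η : Cell μ (n + 1)) i, ∃ m, ((η.facet i).p (Fin.last n)).degree + m =
      (η.p (Fin.last (n + 1))).degree := by
    intro η i
    have h : ((η.facet i).p (Fin.last n)).degree ≤ (η.p (Fin.last (n + 1))).degree := by
      by_cases h : i = 0 ∨ i = Fin.last _
      · exact (η.degree_facet_lt h).le
      · rw [not_or] at h
        rw [η.facet_p_last h.1 h.2]
    exact ⟨_, Nat.add_sub_of_le h⟩
  induction γ with
  | down η i h =>
    obtain ⟨m, hm⟩ := hle η i
    exact ⟨m, hm, zsmul_mem (hco _ η i m hm) _⟩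
  | step η i h τ j hj hM σ γ ih =>
    obtain ⟨m, hm, hγ⟩ := ih
    obtain ⟨m', hm'⟩ := hle η i
    -- The upward step keeps the total degree, so the degrees lost on the downward steps add up.
    obtain ⟨l, h1, h2, h3⟩ := matched_facet ((mem_matching ord).1 hM)
    have h4 := τ.facet_p_last h1 h2
    rw [h3, hj] at h4
    rw [h4] at hm'
    exact ⟨m' + m, by omega, zsmul_mem (hmul _ _ _ (hco _ η i m' (by rw [h4]; exact hm')) _ hγ) _⟩

end RightData

end BondalRuan

namespace MorseData

variable {R : Type*} [Ring R] {X : ℕ → Type*} (𝓜 : MorseData R X)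

/-- The idempotents split `⨁ R e_x` off the free module. -/
lemma projective_critSub (n : ℕ) : Module.Projective R (𝓜.critSub n) := by
  let i : 𝓜.critSub n →ₗ[R] (𝓜.Critical n →₀ R) := (𝓜.critSub n).subtype
  let s : (𝓜.Critical n →₀ R) →ₗ[R] 𝓜.critSub n :=
    Finsupp.linearCombination R fun x => ⟨Finsupp.single x (𝓜.e x.1), 𝓜.critSingle_mem x⟩
  refine Module.Projective.of_split i s (LinearMap.ext fun x => Subtype.ext ?_)
  conv_rhs => rw [LinearMap.id_apply, 𝓜.critSub_eq_sum x.2]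
  rw [LinearMap.comp_apply, Finsupp.linearCombination_apply, Finsupp.sum, Finsupp.sum,
    AddSubmonoidClass.coe_finsetSum]
  rfl

end MorseData

namespace BondalRuan

namespace RightData

/-! ### The augmented Morse complex -/

section Augmented

variable {k : Type*} [CommRing k] {N : ℕ} {Γ : Type*} [AddCommGroup Γ]
    {μ : (Fin N → ℤ) →+ Γ} {B R : Type*} [Ring B] [Algebra k B] [Ring R] [Algebra k R]
    (𝓑 : RightData k μ B R) {n : ℕ} {ord : Fin N → ℕ} (hord : IsDirected μ ord)
    {E : Type*} [AddCommGroup E] [Module R E] (ε : (Cell μ 0 →₀ R) →ₗ[R] E)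
    (q : (Cell μ 0 →₀ R) → (Cell μ 0 →₀ R))
    (hq : ∀ x ∈ (𝓑.morse hord).sub 0, (𝓑.morse hord).D 0 (𝓑.htpy 0 x) + q x = x)
    (hεq : ∀ x, ε x = 0 → q x = 0) (hεD : ∀ η : Cell μ 1, ε (𝓑.barD η) = 0)

include hεD in
lemma ε_D (x : Cell μ 1 →₀ R) : ε ((𝓑.morse hord).D 0 x) = 0 := by
  induction x using Finsupp.induction_linear with
  | zero => simp
  | add x y hx hy => rw [map_add, map_add, hx, hy, add_zero]
  | single η r =>
    rw [MorseData.D_single, map_smul]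
    change r • ε (𝓑.barD η) = 0
    rw [hεD, smul_zero]

include hq hεq hεD

lemma exact_morseD {x : (𝓑.morse hord).Critical (n + 1) →₀ R}
    (hx : x ∈ (𝓑.morse hord).critSub (n + 1)) : (𝓑.morse hord).morseD n x = 0 ↔
      ∃ y ∈ (𝓑.morse hord).critSub (n + 2), (𝓑.morse hord).morseD (n + 1) y = x := by
  have hdd := 𝓑.D_D hord q hq fun x _ => hεq _ (𝓑.ε_D hord ε hεD x)
  constructor
  · exact (𝓑.morse hord).morse_exact hdd (fun x hx h => 𝓑.bar_exact hord hx h) hx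
  · rintro ⟨y, hy, rfl⟩
    exact (𝓑.morse hord).morseD_morseD hdd hy

/-- Where `ε` vanishes so does `q`, and `hq` exhibits the element as a boundary in the bar complex.
All vertices are critical, so nothing is lost by projecting. -/
lemma exact_augmentation {x : (𝓑.morse hord).Critical 0 →₀ R}
    (hx : x ∈ (𝓑.morse hord).critSub 0) : ε ((𝓑.morse hord).incl 0 x) = 0 ↔
      ∃ y ∈ (𝓑.morse hord).critSub 1, (𝓑.morse hord).morseD 0 y = x := by
  have hdd := 𝓑.D_D hord q hq fun x _ => hεq _ (𝓑.ε_D hord ε hεD x)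
  constructor
  · intro h
    have h1 := hq _ ((𝓑.morse hord).incl_mem hx)
    rw [hεq _ h, add_zero] at h1
    have h2 := 𝓑.htpy_mem hord ((𝓑.morse hord).incl_mem hx)
    refine ⟨(𝓑.morse hord).proj 1 (𝓑.htpy 0 ((𝓑.morse hord).incl 0 x)),
      (𝓑.morse hord).proj_mem h2, ?_⟩
    rw [(𝓑.morse hord).morseD_proj hdd h2, h1, MorseData.proj_incl]
  · rintro ⟨y, hy, rfl⟩
    change ε ((𝓑.morse hord).incl 0 ((𝓑.morse hord).proj 0 _)) = 0
    rw [MorseData.proj_zero_eq]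
    exact 𝓑.ε_D hord ε hεD _

end Augmented

/-! ### The entries of the Morse differential. -/

section Matrix

variable {k : Type*} [CommRing k] {N : ℕ} {Γ : Type*} [AddCommGroup Γ]
    {μ : (Fin N → ℤ) →+ Γ} {B R : Type*} [Ring B] [Algebra k B] [Ring R] [Algebra k R]
    (𝓑 : RightData k μ B R) {n : ℕ} {ord : Fin N → ℕ} (hord : IsDirected μ ord)

lemma morseD_single_apply (η : (𝓑.morse hord).Critical (n + 1)) (r : R)
    (σ : (𝓑.morse hord).Critical n) :
    (𝓑.morse hord).morseD n (Finsupp.single η r) σ =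
      r * ∑ᶠ γ : GradPath (matching ord μ) η.1 σ.1, 𝓑.pathCo γ := by
  rw [MorseData.morseD_single, finsum_pathCo]
  rfl

/-- The components of the differential of the Morse complex are homogeneous of degree one. -/
lemma finsum_pathCo_mem (𝓡 : ℕ → AddSubgroup R)
    (hmul : ∀ m n, ∀ a ∈ 𝓡 m, ∀ b ∈ 𝓡 n, a * b ∈ 𝓡 (m + n))
    (hco : ∀ n (η : Cell μ (n + 1)) i m, ((η.facet i).p (Fin.last n)).degree + m =
      (η.p (Fin.last (n + 1))).degree → 𝓑.facetCo η i ∈ 𝓡 m)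
    (η : (𝓑.morse hord).Critical (n + 1)) (σ : (𝓑.morse hord).Critical n) :
    ∑ᶠ γ : GradPath (matching ord μ) η.1 σ.1, 𝓑.pathCo γ ∈ 𝓡 1 := by
  have hdeg : ∀ {m : ℕ} (η : (𝓑.morse hord).Critical m),
      ((Cell.p η.1) (Fin.last m)).degree = m := by
    intro m η
    rw [← Cell.sum_word, CritWord.sum_degree ((hord.isCritical_iff η.1).1 η.2), Cell.length_word]
  refine finsum_induction (· ∈ 𝓡 1) (zero_mem _) (fun _ _ => add_mem) fun γ => ?_
  obtain ⟨m, hm, h⟩ := 𝓑.pathCo_mem 𝓡 hmul hco γ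
  rw [hdeg, hdeg] at hm
  obtain rfl : m = 1 := by omega
  exact h

end Matrix

end RightData

/-! ### Nontrivial monomials in the arrow ideal. -/

section ArrowIdeal

variable (k : Type*) [CommRing k] {N : ℕ} {Γ : Type*} [AddCommGroup Γ] {μ : (Fin N → ℤ) →+ Γ}
  {ord : Fin N → ℕ} (hord : IsDirected μ ord)

include hord

/-- The smallest variable of a monomial splits off as an arrow. -/
lemma exists_arrow_mul {D : Γ} {e : Fin N →₀ ℕ} (h : IsMor μ D e) (he : e ≠ 0) :
    ∃ a, IsArrow μ D a ∧ mono k μ D e = mono k μ D a * mono k μ (D - monDeg μ a) (e - a) := by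
  have h1 : IsMor μ D (headMon ord e) := ⟨h.1, hord.split D e h he⟩
  exact ⟨headMon ord e, isArrow_of_degree h1 (degree_headMon ord he),
    by rw [mono_mul k h1, headMon_add]⟩

lemma mono_tmul_mem {D : Γ} {e : Fin N →₀ ℕ} (he : e ≠ 0) (b : (Alg k μ)ᵐᵒᵖ) :
    mono k μ D e ⊗ₜ[k] b ∈ arrowIdeal k μ := by
  by_cases h : IsMor μ D e
  · obtain ⟨a, ha, h1⟩ := exists_arrow_mul k hord h he
    rw [h1, show (mono k μ D a * mono k μ (D - monDeg μ a) (e - a)) ⊗ₜ[k] b =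
      (mono k μ D a ⊗ₜ[k] 1) * (mono k μ (D - monDeg μ a) (e - a) ⊗ₜ[k] b) by
        rw [Algebra.TensorProduct.tmul_mul_tmul, one_mul]]
    exact TwoSidedIdeal.mul_mem_right _ _ _ (TwoSidedIdeal.subset_span ⟨D, a, ha, Or.inl rfl⟩)
  · rw [mono_eq_zero k h, TensorProduct.zero_tmul]
    exact zero_mem _

/-- In the opposite algebra the first arrow of the monomial becomes the right factor, so the element
is a left multiple of a generator. -/
lemma tmul_mono_mem {D : Γ} {e : Fin N →₀ ℕ} (he : e ≠ 0) (a : Alg k μ) :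
    a ⊗ₜ[k] MulOpposite.op (mono k μ D e) ∈ arrowIdeal k μ := by
  by_cases h : IsMor μ D e
  · obtain ⟨c, hc, h1⟩ := exists_arrow_mul k hord h he
    rw [h1, MulOpposite.op_mul, show a ⊗ₜ[k] (MulOpposite.op (mono k μ (D - monDeg μ c) (e - c)) *
      MulOpposite.op (mono k μ D c)) = (a ⊗ₜ[k] MulOpposite.op (mono k μ (D - monDeg μ c) (e - c))) *
      (1 ⊗ₜ[k] MulOpposite.op (mono k μ D c)) by
        rw [Algebra.TensorProduct.tmul_mul_tmul, mul_one]]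
    exact TwoSidedIdeal.mul_mem_left _ _ _ (TwoSidedIdeal.subset_span ⟨D, c, hc, Or.inr rfl⟩)
  · rw [mono_eq_zero k h, MulOpposite.op_zero, TensorProduct.tmul_zero]
    exact zero_mem _

end ArrowIdeal

/-! ### The resolution of the diagonal bimodule -/

section Bimodule

variable (k : Type*) [CommRing k] {N : ℕ} {Γ : Type*} [AddCommGroup Γ] (μ : (Fin N → ℤ) →+ Γ)

variable {μ} in
lemma Cell.facet_vertex {n : ℕ} (η : Cell μ (n + 1)) (i : Fin (n + 2)) (j : Fin (n + 1)) :
    (η.facet i).src - monDeg μ ((η.facet i).p j) = η.src - monDeg μ (η.p (i.succAbove j)) := by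
  simp only [facet]
  rw [sub_sub, ← map_add, add_tsub_cancel_of_le]
  exact η.strictMono.monotone ((Fin.strictMono_succAbove i).monotone (Fin.zero_le j))

/-- The coefficients of the bar resolution of the diagonal bimodule. -/
def envData : RightData k μ (Alg k μ)ᵐᵒᵖ (Env k μ) where
  Θ := AlgEquiv.refl
  f η := MulOpposite.op (mono k μ η.tgt 0)
  rc {n} η i := MulOpposite.op (mono k μ (η.src - monDeg μ (η.p (i.succAbove (Fin.last n))))
      (η.p (Fin.last (n + 1)) - η.p (i.succAbove (Fin.last n))))
  f_mul_f η := by rw [← MulOpposite.op_mul, mono_zero_mul]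
  f_mul_rc η i := by
    rw [← MulOpposite.op_mul, mono_mul_zero]
    rw [sub_sub, ← map_add, add_tsub_cancel_of_le (η.strictMono.monotone (Fin.le_last _))]
    rfl
  rc_mul_f η i := by
    rw [← MulOpposite.op_mul]
    simp only [Cell.tgt]
    rw [Cell.facet_vertex, mono_zero_mul]
  rc_of_ne η i hi := by
    rw [Fin.succAbove_ne_last_last hi, tsub_self]
    rfl
  f_facet η i hi := by
    simp only [Cell.tgt]
    rw [Cell.facet_vertex, Fin.succAbove_ne_last_last hi]
  rc_cons {n} D a η hD ha h i := by
    rw [← Fin.succ_last (n + 1), Cell.cons_p_succ, ← Fin.succ_last n, Fin.succ_succAbove_succ,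
      Cell.cons_p_succ, Fin.succ_last, add_tsub_add_eq_tsub_left, map_add, ← sub_sub,
      show (Cell.cons D a η hD ha h).src = D from rfl, h]

end Bimodule

section VertexCell

variable {N : ℕ} {Γ : Type*} [AddCommGroup Γ] {μ : (Fin N → ℤ) →+ Γ}

/-- The vertex `D` as a cell. -/
def Cell.ofVertex (D : Vertex μ) : Cell μ 0 where
  src := D
  p _ := 0
  zero := rfl
  strictMono i j h := absurd h (by rw [Subsingleton.elim (α := Fin 1) i j]; exact lt_irrefl _)
  vertex _ := by rw [map_zero, sub_zero]; exact D.2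

lemma Cell.eq_ofVertex (η : Cell μ 0) : η = Cell.ofVertex ⟨η.src, η.src_mem⟩ :=
  Cell.ext rfl (funext fun i => by rw [Subsingleton.elim (α := Fin 1) i 0]; exact η.zero)

end VertexCell

namespace RightData

/-! ### Bimodule resolutions, over a ring that is isomorphic to the enveloping algebra -/

section Bimodule

variable {k : Type*} [CommRing k] {N : ℕ} {Γ : Type*} [AddCommGroup Γ] {μ : (Fin N → ℤ) →+ Γ}
  {R : Type*} [Ring R] [Algebra k R] (𝓑 : RightData k μ (Alg k μ)ᵐᵒᵖ R)
  {ord : Fin N → ℕ} (hord : IsDirected μ ord)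

/-- The element `a ⊗ b` of the enveloping algebra. -/
abbrev bm (a b : Alg k μ) : R := 𝓑.tm a (MulOpposite.op b)

lemma bm_mul (a b a' b' : Alg k μ) : 𝓑.bm a b * 𝓑.bm a' b' = 𝓑.bm (a * a') (b' * b) := by
  rw [bm, bm, tm_mul, ← MulOpposite.op_mul]

/-- The section of the augmentation of the bar complex. -/
def barSec (a : Alg k μ) : Cell μ 0 →₀ R :=
  ∑ D : Vertex μ, Finsupp.single (Cell.ofVertex D)
    (𝓑.bm (mono k μ (D : Γ) 0) (mono k μ (D : Γ) 0 * a))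

lemma barSec_add (a b : Alg k μ) : 𝓑.barSec (a + b) = 𝓑.barSec a + 𝓑.barSec b := by
  simp only [barSec, mul_add, MulOpposite.op_add, bm, tm, TensorProduct.tmul_add, map_add,
    Finsupp.single_add, Finset.sum_add_distrib]

lemma barSec_zero : 𝓑.barSec (0 : Alg k μ) = 0 := by
  simp [barSec, bm, tm]

lemma barSec_mono_mul {D : Γ} {e : Fin N →₀ ℕ} (h : IsMor μ D e) (b : Alg k μ) :
    𝓑.barSec (mono k μ D e * b) = Finsupp.single (Cell.ofVertex ⟨D, h.1⟩)
      (𝓑.bm (mono k μ D 0) (mono k μ D e * b)) := by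
  rw [barSec, Finset.sum_eq_single ⟨D, h.1⟩]
  · rw [← mul_assoc, mono_zero_mul]
  · intro D' _ hD'
    rw [← mul_assoc, mono_mul_of_ne, zero_mul, bm, MulOpposite.op_zero, tm,
      TensorProduct.tmul_zero, map_zero, Finsupp.single_zero]
    rw [map_zero, sub_zero]
    exact fun h => hD' (Subtype.ext h)
  · simp

variable [Module R (Alg k μ)] (hsmul : ∀ a b c : Alg k μ, 𝓑.bm a b • c = a * c * b)
  (hf : ∀ {n} (η : Cell μ n), 𝓑.f η = MulOpposite.op (mono k μ η.tgt 0))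
  (hrc : ∀ η : Cell μ 1, 𝓑.rc η 1 = MulOpposite.op (mono k μ η.src (η.p 1)))

variable (k μ R) in
/-- The augmentation of the bar complex. -/
def barAug : (Cell μ 0 →₀ R) →ₗ[R] Alg k μ :=
  Finsupp.linearCombination R (fun _ => (1 : Alg k μ))

include hsmul in
lemma barAug_single (η : Cell μ 0) (a b : Alg k μ) :
    barAug k μ R (Finsupp.single η (𝓑.bm a b)) = a * b := by
  rw [barAug, Finsupp.linearCombination_single, hsmul, mul_one]

include hf hrc in
omit [Module R (Alg k μ)] in
lemma barD_one (η : Cell μ 1) : 𝓑.barD η =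
    Finsupp.single (η.facet 0) (𝓑.bm (mono k μ η.src (η.p 1)) (mono k μ η.tgt 0)) -
    Finsupp.single (η.facet 1) (𝓑.bm (mono k μ η.src 0) (mono k μ η.src (η.p 1))) := by
  rw [barD, Fin.sum_univ_two]
  have h0 : (0 : Fin 2).succAbove (0 : Fin 1) = 1 := rfl
  have h1 : (1 : Fin 2).succAbove (0 : Fin 1) = 0 := rfl
  have h2 : 𝓑.facetCo η 0 = 𝓑.bm (mono k μ η.src (η.p 1)) (mono k μ η.tgt 0) := by
    rw [facetCo, rc_of_ne _ _ _ (by simp), h0, hf]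
  have h3 : 𝓑.facetCo η 1 = 𝓑.bm (mono k μ η.src 0) (mono k μ η.src (η.p 1)) := by
    rw [facetCo, hrc, h1, η.zero]
  rw [h2, h3]
  simp [sub_eq_add_neg, Finsupp.single_neg]

include hsmul hf hrc in
lemma barAug_barD (η : Cell μ 1) : barAug k μ R (𝓑.barD η) = 0 := by
  rw [𝓑.barD_one hf hrc, map_sub, 𝓑.barAug_single hsmul, 𝓑.barAug_single hsmul, mono_zero_mul,
    mono_mul_zero, sub_self]
  rfl

include hsmul hf hrc in
-- On a nontrivial monomial the second facet of the prepended edge cancels `barSec`; on an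
-- idempotent the homotopy vanishes and `barSec` returns the element.
lemma D_htpy_zero {x : Cell μ 0 →₀ R} (hx : x ∈ (𝓑.morse hord).sub 0) :
    (𝓑.morse hord).D 0 (𝓑.htpy 0 x) + 𝓑.barSec (barAug k μ R x) = x := by
  refine 𝓑.sub_induction hord
    (P := fun x => (𝓑.morse hord).D 0 (𝓑.htpy 0 x) + 𝓑.barSec (barAug k μ R x) = x) ?_ ?_ ?_ hx
  · rw [map_zero (barAug k μ R), barSec_zero, map_zero, map_zero, add_zero]
  · intro x y hx hy
    rw [map_add (barAug k μ R), barSec_add, map_add, map_add, add_add_add_comm, hx, hy]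
  · intro η D e b he h hb
    obtain ⟨b, rfl⟩ := MulOpposite.op_surjective b
    have htgt : η.tgt = η.src := by
      rw [Cell.tgt, Subsingleton.elim (α := Fin 1) (Fin.last 0) 0, η.zero, map_zero, sub_zero]
    have hb' : mono k μ η.src 0 * b = b := by
      rw [hf, ← MulOpposite.op_mul, htgt] at hb
      exact MulOpposite.op_injective hb
    rw [𝓑.barAug_single hsmul, barSec_mono_mul 𝓑 he]
    by_cases he0 : e = 0
    · subst he0
      rw [map_zero, sub_zero] at h
      subst h
      rw [𝓑.htpy_single_zero η he.1, map_zero, zero_add, hb', ← η.eq_ofVertex]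
    · rw [𝓑.htpy_single _ he.1 he0 h, MorseData.D_single]
      change _ • 𝓑.barD _ + _ = _
      set θ := Cell.cons D e η he.1 he0 h with hθ
      have h1 : θ.p 1 = e := by
        rw [← Fin.succ_zero_eq_one, hθ, Cell.cons_p_succ, η.zero, add_zero]
      have h2 : θ.facet 1 = Cell.ofVertex ⟨D, he.1⟩ := by
        rw [(θ.facet 1).eq_ofVertex]
        congr 2
        change D - monDeg μ (θ.p 0) = D
        rw [θ.zero, map_zero, sub_zero]
      have h3 : θ.tgt = η.src := by
        change D - monDeg μ (θ.p 1) = _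
        rw [h1, h]
      have hsrc : θ.src = D := rfl
      rw [𝓑.barD_one hf hrc, h1, h2, h3, hsrc, hθ, Cell.cons_facet_zero, smul_sub,
        Finsupp.smul_single, Finsupp.smul_single, smul_eq_mul, smul_eq_mul, bm_mul, bm_mul,
        mono_zero_mul, mono_zero_mul, hb', sub_add_cancel]

include hsmul in
lemma barAug_barSec (a : Alg k μ) : barAug k μ R (𝓑.barSec a) = a := by
  rw [barSec, map_sum]
  simp only [𝓑.barAug_single hsmul, ← mul_assoc, mono_zero_mul]
  rw [← Finset.sum_mul, sum_mono_zero, one_mul]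

include hf in
omit [Module R (Alg k μ)] in
lemma barSec_mem (a : Alg k μ) : 𝓑.barSec a ∈ (𝓑.morse hord).sub 0 := by
  refine Submodule.sum_mem _ fun D _ => 𝓑.single_tm_mem hord ?_ ?_
  · rw [map_zero, sub_zero]; rfl
  · rw [hf, ← MulOpposite.op_mul, ← mul_assoc]
    congr 2
    change mono k μ ((D : Γ) - monDeg μ 0) 0 * _ = _
    rw [map_zero, sub_zero, mono_zero_mul]

lemma linearCombination_one (x : Crit (matching ord μ) 0 →₀ R) :
    Finsupp.linearCombination R (fun _ => (1 : Alg k μ)) x =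
      barAug k μ R ((𝓑.morse hord).incl 0 x) :=
  (Finsupp.linearCombination_mapDomain R (v' := fun _ : Cell μ 0 => (1 : Alg k μ))
    Subtype.val x).symm

include hsmul hf hrc in
lemma exact_bimodule {n : ℕ} {x : Crit (matching ord μ) (n + 1) →₀ R}
    (hx : x ∈ (𝓑.morse hord).critSub (n + 1)) : (𝓑.morse hord).morseD n x = 0 ↔
      ∃ y ∈ (𝓑.morse hord).critSub (n + 2), (𝓑.morse hord).morseD (n + 1) y = x :=
  𝓑.exact_morseD hord (barAug k μ R) (fun x => 𝓑.barSec (barAug k μ R x))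
    (fun _ hx => 𝓑.D_htpy_zero hord hsmul hf hrc hx) (fun x h => by rw [h, barSec_zero])
    (𝓑.barAug_barD hsmul hf hrc) hx

include hsmul hf hrc in
lemma exact_zero_bimodule {x : Crit (matching ord μ) 0 →₀ R}
    (hx : x ∈ (𝓑.morse hord).critSub 0) :
    Finsupp.linearCombination R (fun _ => (1 : Alg k μ)) x = 0 ↔
      ∃ y ∈ (𝓑.morse hord).critSub 1, (𝓑.morse hord).morseD 0 y = x := by
  rw [𝓑.linearCombination_one hord]
  exact 𝓑.exact_augmentation hord (barAug k μ R) (fun x => 𝓑.barSec (barAug k μ R x))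
    (fun _ hx => 𝓑.D_htpy_zero hord hsmul hf hrc hx) (fun x h => by rw [h, barSec_zero])
    (𝓑.barAug_barD hsmul hf hrc) hx

include hsmul hf in
lemma surjective_bimodule (a : Alg k μ) : ∃ x ∈ (𝓑.morse hord).critSub 0,
    Finsupp.linearCombination R (fun _ => (1 : Alg k μ)) x = a := by
  refine ⟨(𝓑.morse hord).proj 0 (𝓑.barSec a), MorseData.proj_mem _ (𝓑.barSec_mem hord hf a), ?_⟩
  rw [𝓑.linearCombination_one hord, MorseData.proj_zero_eq, 𝓑.barAug_barSec hsmul]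

end Bimodule

section Matrix

variable {k : Type*} [CommRing k] {N : ℕ} {Γ : Type*} [AddCommGroup Γ]
    {μ : (Fin N → ℤ) →+ Γ} {B R : Type*} [Ring B] [Algebra k B] [Ring R] [Algebra k R]
    (𝓑 : RightData k μ B R) {ord : Fin N → ℕ} (hord : IsDirected μ ord)

lemma linearCombination_pathCo {n : ℕ} (x : Crit (matching ord μ) (n + 1) →₀ R) :
    Finsupp.linearCombination R (fun (η : Crit (matching ord μ) (n + 1))
      (σ : Crit (matching ord μ) n) => ∑ᶠ γ : GradPath (matching ord μ) η.1 σ.1, 𝓑.pathCo γ) x =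
      ⇑((𝓑.morse hord).morseD n x) := by
  induction x using Finsupp.induction_linear with
  | zero => simp
  | add x y hx hy => rw [map_add, map_add, Finsupp.coe_add, hx, hy]
  | single η r =>
    funext σ
    rw [morseD_single_apply, Finsupp.linearCombination_single]
    rfl

/-- For an idempotent `e`, the left ideal `R e` consists of the `x` with `x e = x`. -/
lemma submodule_span_eq (n : ℕ) : (Finsupp.submodule fun η : Crit (matching ord μ) n =>
    Submodule.span R {𝓑.idem η.1}) = (𝓑.morse hord).critSub n := by
  ext x
  refine forall_congr' fun η => ?_
  refine Submodule.mem_span_singleton.trans ⟨?_, fun h => ⟨x η, h⟩⟩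
  rintro ⟨a, ha⟩
  rw [← ha, smul_eq_mul, mul_assoc, 𝓑.idem_mul_idem]

end Matrix

end RightData

/-! ### The Morse resolution over the enveloping algebra. -/

section Bimodule

variable (k : Type*) [CommRing k] {N : ℕ} {Γ : Type*} [AddCommGroup Γ] {μ : (Fin N → ℤ) →+ Γ}
  {ord : Fin N → ℕ} (hord : IsDirected μ ord)

attribute [local instance] instModuleTensorProductMop

lemma coeff_eq_pathCo {M : Set (AnyCell μ × AnyCell μ)} {n : ℕ} {η : Cell μ (n + 1)}
    {σ : Cell μ n} (γ : GradPath M η σ) : γ.coeff k = (envData k μ).pathCo γ := by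
  induction γ with
  | down => rfl
  | step η i h τ j hj hM σ γ ih => rw [GradPath.coeff, ih]; rfl

lemma morseDiff_eq {n : ℕ} (x : Crit (matching ord μ) (n + 1) →₀ Env k μ) :
    morseDiff k (matching ord μ) n x = ⇑(((envData k μ).morse hord).morseD n x) := by
  refine Eq.trans ?_ ((envData k μ).linearCombination_pathCo hord x)
  rw [morseDiff]
  simp only [morseCoeff, coeff_eq_pathCo]

lemma env_smul (a b c : Alg k μ) : (envData k μ).bm a b • c = a * c * b := by
  change (a ⊗ₜ[k] MulOpposite.op b : Env k μ) • c = _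
  rw [TensorProduct.Algebra.smul_def]
  simp [mul_assoc]

lemma env_rc (η : Cell μ 1) :
    (envData k μ).rc η 1 = MulOpposite.op (mono k μ η.src (η.p 1)) := by
  change MulOpposite.op (mono k μ (η.src - monDeg μ (η.p 0)) (η.p 1 - η.p 0)) = _
  rw [η.zero, map_zero, sub_zero, tsub_zero]

lemma morseTerm_eq (n : ℕ) :
    morseTerm k (matching ord μ) n = ((envData k μ).morse hord).critSub n :=
  (envData k μ).submodule_span_eq hord n

include hord in
lemma matching_isProjectiveResolution : IsProjectiveResolution k (matching ord μ) where
  projective n := by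
    rw [morseTerm_eq k hord]
    exact ((envData k μ).morse hord).projective_critSub n
  mapsTo n x _ := by
    refine ⟨((envData k μ).morse hord).morseD n x, ?_, (morseDiff_eq k hord x).symm⟩
    rw [morseTerm_eq k hord]
    exact ((envData k μ).morse hord).morseD_mem x
  exact n x hx := by
    rw [morseTerm_eq k hord] at hx ⊢
    have h1 := (envData k μ).exact_bimodule hord (env_smul k) (fun _ => rfl) (env_rc k) hx
    simp only [morseDiff_eq k hord]
    refine Iff.trans ?_ (h1.trans ?_)
    · exact DFunLike.coe_fn_eq (g := 0)
    · exact exists_congr fun y => and_congr_right fun _ => DFunLike.coe_fn_eq.symm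
  exact_zero x hx := by
    rw [morseTerm_eq k hord] at hx ⊢
    have h1 := (envData k μ).exact_zero_bimodule hord (env_smul k) (fun _ => rfl) (env_rc k) hx
    simp only [morseDiff_eq k hord]
    refine h1.trans ?_
    exact exists_congr fun y => and_congr_right fun _ => DFunLike.coe_fn_eq.symm
  surjective a := by
    rw [morseTerm_eq k hord]
    exact (envData k μ).surjective_bimodule hord (env_smul k) (fun _ => rfl) a

open Classical in
include hord in
lemma matching_isMinimal : IsMinimal k (matching ord μ) := by
  intro n η σ
  -- The degree argument needs only a multiplicative family of subgroups; with the arrow ideal in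
  -- all positive degrees, degree one means membership in that ideal.
  let 𝓡 : ℕ → AddSubgroup (Env k μ) := fun m => if m = 0 then ⊤ else
    { carrier := {x | x ∈ arrowIdeal k μ}
      add_mem' := fun ha hb => (arrowIdeal k μ).add_mem ha hb
      zero_mem' := (arrowIdeal k μ).zero_mem
      neg_mem' := fun ha => (arrowIdeal k μ).neg_mem ha }
  have h𝓡 : ∀ {m x}, m ≠ 0 → (x ∈ 𝓡 m ↔ x ∈ arrowIdeal k μ) := by
    intro m x hm
    simp only [𝓡, if_neg hm]
    exact Iff.rfl
  have h0 : ∀ x, x ∈ 𝓡 0 := fun x => by simp [𝓡]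
  rw [morseCoeff]
  simp only [coeff_eq_pathCo]
  refine (h𝓡 one_ne_zero).1 ((envData k μ).finsum_pathCo_mem hord 𝓡 ?_ ?_ η σ)
  · intro m n a ha b hb
    rcases Nat.eq_zero_or_pos m with rfl | hm
    · rcases Nat.eq_zero_or_pos n with rfl | hn
      · exact h0 _
      · rw [h𝓡 (by omega)] at hb ⊢
        exact TwoSidedIdeal.mul_mem_left _ _ _ hb
    · rw [h𝓡 (by omega)] at ha ⊢
      exact TwoSidedIdeal.mul_mem_right _ _ _ ha
  · intro n η i m hm
    rcases Nat.eq_zero_or_pos m with rfl | hm0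
    · exact h0 _
    rw [h𝓡 hm0.ne']
    by_cases hi : i = 0
    · subst hi
      refine mono_tmul_mem k hord ?_ _
      rw [Cell.p_succAbove_zero_zero]
      exact η.p_one_ne_zero
    by_cases hi' : i = Fin.last _
    · subst hi'
      refine tmul_mono_mem k hord ?_ _
      rw [Fin.succAbove_last]
      exact (tsub_pos_of_lt (η.strictMono (Fin.castSucc_lt_last _))).ne'
    -- An inner facet loses no degree, which contradicts `0 < m`.
    · rw [η.facet_p_last hi hi'] at hm
      omega

end Bimodule

/-- A criterion for internal direct sums, in terms of projections. -/
lemma isInternal_of_projections {M M' S : Type*} [AddCommMonoid M] [AddCommMonoid M'] [SetLike S M]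
    [AddSubmonoidClass S M] {G : ℕ → S} (π : ℕ → M →+ M')
    (hself : ∀ n, ∀ x ∈ G n, ∀ y ∈ G n, π n x = π n y → x = y) (hne : ∀ m n, m ≠ n → ∀ x ∈ G n, π m x = 0)
    (htop : ∀ T : AddSubmonoid M, (∀ n, ∀ x ∈ G n, x ∈ T) → ∀ x, x ∈ T) :
    DirectSum.IsInternal G := by
  classical
  constructor
  · intro x y hxy
    refine DFinsupp.ext fun n => Subtype.ext (hself n _ (x n).2 _ (y n).2 ?_)
    have h1 : ∀ x : DirectSum ℕ fun i => G i,
        π n (DirectSum.coeAddMonoidHom G x) = π n (x n) := by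
      intro x
      induction x using DirectSum.induction_on with
      | zero => simp
      | add x y hx hy => rw [map_add, map_add, hx, hy, DirectSum.add_apply,
          AddMemClass.coe_add, map_add]
      | of i x =>
        rw [DirectSum.coeAddMonoidHom_of]
        by_cases hi : n = i
        · subst hi; rw [DirectSum.of_eq_same]
        · rw [hne _ _ hi _ x.2, DirectSum.of_eq_of_ne _ _ _ hi, ZeroMemClass.coe_zero, map_zero]
    rw [← h1, ← h1, hxy]
  · intro x
    exact htop (AddMonoidHom.mrange (DirectSum.coeAddMonoidHom G))
      (fun n x hx => ⟨DirectSum.of (fun i => G i) n ⟨x, hx⟩, DirectSum.coeAddMonoidHom_of _ _ _⟩) x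

end BondalRuan

namespace MorseData

variable {R : Type*} [Ring R] {X : ℕ → Type*} (𝓜 : MorseData R X) {n : ℕ}

/-! ### The terms of the Morse complex as modules -/

/-- The `n`-th term of the Morse complex. -/
def CritMod (n : ℕ) : Type _ := ↥(𝓜.critSub n)

instance (n : ℕ) : AddCommGroup (𝓜.CritMod n) := inferInstanceAs (AddCommGroup ↥(𝓜.critSub n))

instance (n : ℕ) : Module R (𝓜.CritMod n) := inferInstanceAs (Module R ↥(𝓜.critSub n))

instance (n : ℕ) : Module.Projective R (𝓜.CritMod n) := 𝓜.projective_critSub n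

/-- The inclusion into the free module. -/
def critVal (n : ℕ) : 𝓜.CritMod n →ₗ[R] (𝓜.Critical n →₀ R) := (𝓜.critSub n).subtype

lemma critVal_mem (x : 𝓜.CritMod n) : 𝓜.critVal n x ∈ 𝓜.critSub n := x.2

lemma critVal_injective : Function.Injective (𝓜.critVal n) := Subtype.val_injective

lemma exists_critVal {x : 𝓜.Critical n →₀ R} (hx : x ∈ 𝓜.critSub n) : ∃ y, 𝓜.critVal n y = x :=
  ⟨⟨x, hx⟩, rfl⟩

/-- The generator of a critical cell. -/
def gen (y : 𝓜.Critical n) : 𝓜.CritMod n := ⟨Finsupp.single y (𝓜.e y.1), 𝓜.critSingle_mem y⟩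

lemma critVal_gen (y : 𝓜.Critical n) : 𝓜.critVal n (𝓜.gen y) = Finsupp.single y (𝓜.e y.1) := rfl

lemma eq_sum_gen (x : 𝓜.CritMod n) : x = (𝓜.critVal n x).sum fun y r => r • 𝓜.gen y := by
  refine 𝓜.critVal_injective ?_
  rw [map_finsuppSum]
  conv_lhs => rw [𝓜.critSub_eq_sum (𝓜.critVal_mem x)]
  simp only [map_smul, critVal_gen]

/-- The differential of the Morse complex. -/
def critD (n : ℕ) : 𝓜.CritMod (n + 1) →ₗ[R] 𝓜.CritMod n :=
  (𝓜.morseD n ∘ₗ 𝓜.critVal (n + 1)).codRestrict (𝓜.critSub n) fun _ => 𝓜.morseD_mem _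

lemma critVal_critD (x : 𝓜.CritMod (n + 1)) :
    𝓜.critVal n (𝓜.critD n x) = 𝓜.morseD n (𝓜.critVal (n + 1) x) := rfl

lemma exact_critD (h : ∀ x ∈ 𝓜.critSub (n + 1), 𝓜.morseD n x = 0 ↔
    ∃ y ∈ 𝓜.critSub (n + 2), 𝓜.morseD (n + 1) y = x) :
    Function.Exact (𝓜.critD (n + 1)) (𝓜.critD n) := by
  intro x
  have h1 : 𝓜.critD n x = 0 ↔ 𝓜.morseD n (𝓜.critVal (n + 1) x) = 0 := by
    rw [← critVal_critD, ← map_zero (𝓜.critVal n), 𝓜.critVal_injective.eq_iff]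
  rw [h1, h _ (𝓜.critVal_mem x)]
  constructor
  · rintro ⟨y, hy, hyx⟩
    obtain ⟨y, rfl⟩ := 𝓜.exists_critVal hy
    exact ⟨y, 𝓜.critVal_injective hyx⟩
  · rintro ⟨y, rfl⟩
    exact ⟨_, 𝓜.critVal_mem y, rfl⟩

lemma exact_critD_zero {E : Type*} [AddCommGroup E] [Module R E]
    (ε : (𝓜.Critical 0 →₀ R) →ₗ[R] E) (h : ∀ x ∈ 𝓜.critSub 0, ε x = 0 ↔
    ∃ y ∈ 𝓜.critSub 1, 𝓜.morseD 0 y = x) :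
    Function.Exact (𝓜.critD 0) (ε ∘ₗ 𝓜.critVal 0) := by
  intro x
  rw [LinearMap.comp_apply, h _ (𝓜.critVal_mem x)]
  constructor
  · rintro ⟨y, hy, hyx⟩
    obtain ⟨y, rfl⟩ := 𝓜.exists_critVal hy
    exact ⟨y, 𝓜.critVal_injective hyx⟩
  · rintro ⟨y, rfl⟩
    exact ⟨_, 𝓜.critVal_mem y, rfl⟩

/-- The elements with all components in `G`. -/
def critGr (n : ℕ) (G : AddSubgroup R) : AddSubgroup (𝓜.CritMod n) where
  carrier := {x | ∀ y, 𝓜.critVal n x y ∈ G}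
  add_mem' hx hy z := by rw [map_add, Finsupp.add_apply]; exact add_mem (hx z) (hy z)
  zero_mem' z := by rw [map_zero]; exact zero_mem _
  neg_mem' hx z := by rw [map_neg, Finsupp.neg_apply]; exact neg_mem (hx z)

lemma smul_gen_mem_critGr {G : AddSubgroup R} {r : R} (y : 𝓜.Critical n)
    (h : r * 𝓜.e y.1 ∈ G) : r • 𝓜.gen y ∈ 𝓜.critGr n G := by
  classical
  intro z
  rw [map_smul, critVal_gen, Finsupp.smul_single, smul_eq_mul, Finsupp.single_apply]
  split_ifs
  · exact h
  · exact zero_mem _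

lemma span_critGr {G : AddSubgroup R} (he : ∀ y : 𝓜.Critical n, 𝓜.e y.1 ∈ G) :
    Submodule.span R (𝓜.critGr n G : Set (𝓜.CritMod n)) = ⊤ := by
  rw [eq_top_iff]
  rintro x -
  rw [𝓜.eq_sum_gen x]
  refine Submodule.sum_mem _ fun y _ => Submodule.smul_mem _ _ (Submodule.subset_span ?_)
  rw [← one_smul R (𝓜.gen y)]
  exact 𝓜.smul_gen_mem_critGr y (by rw [one_mul]; exact he y)

lemma smul_mem_critGr {G G' : AddSubgroup R} {a : R} (h : ∀ b ∈ G, a * b ∈ G')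
    {x : 𝓜.CritMod n} (hx : x ∈ 𝓜.critGr n G) : a • x ∈ 𝓜.critGr n G' := by
  intro y
  rw [map_smul, Finsupp.smul_apply]
  exact h _ (hx y)

lemma critD_mem_critGr {G G' : AddSubgroup R}
    (h : ∀ η, ∀ r ∈ G, ∀ σ, 𝓜.morseD n (Finsupp.single η r) σ ∈ G')
    {x : 𝓜.CritMod (n + 1)} (hx : x ∈ 𝓜.critGr (n + 1) G) : 𝓜.critD n x ∈ 𝓜.critGr n G' := by
  intro σ
  rw [critVal_critD, ← Finsupp.sum_single (𝓜.critVal (n + 1) x), map_finsuppSum, Finsupp.sum,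
    Finsupp.finsetSum_apply]
  exact sum_mem fun η _ => h η _ (hx η) σ

/-- Right multiplication by the idempotents preserves degrees, so the decomposition of `R` restricts
to each summand `R e_y`. -/
lemma critGr_isInternal {M' : Type*} [AddCommMonoid M'] {G : ℕ → AddSubgroup R} (π : ℕ → R →+ M')
    (hself : ∀ n, ∀ x ∈ G n, ∀ y ∈ G n, π n x = π n y → x = y)
    (hne : ∀ m n, m ≠ n → ∀ x ∈ G n, π m x = 0)
    (htop : ∀ T : AddSubmonoid R, (∀ n, ∀ x ∈ G n, x ∈ T) → ∀ x, x ∈ T)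
    (he : ∀ m, ∀ a ∈ G m, ∀ y : 𝓜.Critical n, a * 𝓜.e y.1 ∈ G m) :
    DirectSum.IsInternal fun m => 𝓜.critGr n (G m) := by
  refine BondalRuan.isInternal_of_projections
    (fun m => (Finsupp.mapRange.addMonoidHom (π m)).comp (𝓜.critVal n).toAddMonoidHom) ?_ ?_ ?_
  · intro m x hx y hy hxy
    refine 𝓜.critVal_injective (Finsupp.ext fun z => hself m _ (hx z) _ (hy z) ?_)
    exact DFunLike.congr_fun hxy z
  · intro m m' hm x hx
    exact Finsupp.ext fun z => hne _ _ hm _ (hx z)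
  · intro T hT x
    rw [𝓜.eq_sum_gen x]
    refine sum_mem fun y _ => ?_
    exact htop (T.comap ((AddMonoidHom.flip (smulAddHom R (𝓜.CritMod n))) (𝓜.gen y)))
      (fun m a ha => hT m _ (𝓜.smul_gen_mem_critGr y (he m a ha y))) _

end MorseData

namespace BondalRuan

/-! ### The grading by path length -/

section Grading

variable (k : Type*) [CommRing k] {N : ℕ} {Γ : Type*} [AddCommGroup Γ] {μ : (Fin N → ℤ) →+ Γ}
  {ord : Fin N → ℕ} (hord : IsDirected μ ord)

include hord in
lemma IsPath.degree_sum {D : Γ} {w : List (Fin N →₀ ℕ)} (h : IsPath μ D w) :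
    w.sum.degree = w.length := by
  induction w generalizing D with
  | nil => simp
  | cons e w ih => rw [List.sum_cons, map_add, ih h.2, hord.arrow _ _ h.1, List.length_cons, add_comm]

include hord in
-- All arrows have degree one, so the length of a path is the degree of its monomial.
lemma pathGrading_eq (n : ℕ) : pathGrading k μ n =
    Submodule.span k {a | ∃ D e, IsMor μ D e ∧ e.degree = n ∧ a = mono k μ D e} := by
  rw [pathGrading]
  congr 1
  ext a
  constructor
  · rintro ⟨D, w, hw, hn, rfl⟩
    exact ⟨D, w.sum, hw.isMor, by rw [hw.degree_sum hord, hn], hw.pathElem_eq k⟩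
  · rintro ⟨D, e, he, hn, rfl⟩
    obtain ⟨w, hw, rfl⟩ := he.exists_path
    exact ⟨D, w, hw, by rw [← hn, hw.degree_sum hord], (hw.pathElem_eq k).symm⟩

include hord in
lemma mono_mem_pathGrading (D : Γ) (e : Fin N →₀ ℕ) :
    mono k μ D e ∈ pathGrading k μ e.degree := by
  by_cases h : IsMor μ D e
  · rw [pathGrading_eq k hord]
    exact Submodule.subset_span ⟨D, e, h, rfl, rfl⟩
  · rw [mono_eq_zero k h]
    exact zero_mem _

include hord in
lemma pathGrading_gradedMonoid : SetLike.GradedMonoid (pathGrading k μ) where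
  one_mem := by
    rw [← sum_mono_zero]
    refine Submodule.sum_mem _ fun D _ => ?_
    have := mono_mem_pathGrading k hord (D : Γ) 0
    rwa [map_zero] at this
  mul_mem m n a b ha hb := by
    have h : pathGrading k μ m * pathGrading k μ n ≤ pathGrading k μ (m + n) := by
      rw [pathGrading_eq k hord m, pathGrading_eq k hord n, Submodule.span_mul_span,
        Submodule.span_le]
      rintro _ ⟨_, ⟨D, e, he, rfl, rfl⟩, _, ⟨D', e', he', rfl, rfl⟩, rfl⟩
      dsimp only
      by_cases hD : D - monDeg μ e = D'
      · rw [mono_mul_eq k he hD, ← map_add]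
        exact mono_mem_pathGrading k hord _ _
      · rw [mono_mul_of_ne k hD]
        exact zero_mem _
    exact h (Submodule.mul_mem_mul ha hb)

variable (μ) in
/-- The projection to the part of degree `m`. -/
def degProj (m : ℕ) : Alg k μ →ₗ[k] Alg k μ :=
  (monoBasis k μ).constr k fun x => if x.1.2.degree = m then mono k μ x.1.1 x.1.2 else 0

lemma degProj_mono {D : Γ} {e : Fin N →₀ ℕ} (h : IsMor μ D e) (m : ℕ) :
    degProj k μ m (mono k μ D e) = if e.degree = m then mono k μ D e else 0 := by
  rw [degProj, ← monoBasis_apply k ⟨(D, e), h⟩, Module.Basis.constr_basis]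
  simp only [monoBasis_apply]

include hord in
lemma degProj_of_mem {m n : ℕ} {a : Alg k μ} (ha : a ∈ pathGrading k μ n) :
    degProj k μ m a = if n = m then a else 0 := by
  rw [pathGrading_eq k hord] at ha
  induction ha using Submodule.span_induction with
  | mem x hx =>
    obtain ⟨D, e, he, rfl, rfl⟩ := hx
    exact degProj_mono k he m
  | zero => simp
  | add x y _ _ hx hy => rw [map_add, hx, hy]; split_ifs <;> simp
  | smul c x _ hx => rw [map_smul, hx]; split_ifs <;> simp

include hord in
lemma pathGrading_isInternal : DirectSum.IsInternal (pathGrading k μ) := by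
  refine isInternal_of_projections (fun m => (degProj k μ m).toAddMonoidHom) ?_ ?_ ?_
  · intro n x hx y hy h
    have h1 := degProj_of_mem k hord (m := n) hx
    have h2 := degProj_of_mem k hord (m := n) hy
    rw [if_pos rfl] at h1 h2
    exact h1.symm.trans (h.trans h2)
  · intro m n hmn x hx
    have := degProj_of_mem k hord (m := m) hx
    rwa [if_neg hmn.symm] at this
  · intro T hT x
    induction x using mono_induction with
    | h0 => exact zero_mem _
    | hadd a b ha hb => exact add_mem ha hb
    | hmono c D e he =>
      exact hT _ _ (Submodule.smul_mem _ c (mono_mem_pathGrading k hord D e))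

include hord in
/-- The ideal of elements of positive degree is spanned by the nontrivial monomials. -/
lemma posIdeal_subset {a : Alg k μ} (ha : a ∈ posIdeal (pathGrading k μ)) :
    a ∈ Submodule.span k {a | ∃ D e, IsMor μ D e ∧ e ≠ 0 ∧ a = mono k μ D e} := by
  rw [posIdeal] at ha
  induction ha using Submodule.span_induction with
  | mem x hx =>
    obtain ⟨n, hn, hx⟩ := hx
    rw [pathGrading_eq k hord] at hx
    refine Submodule.span_mono ?_ hx
    rintro _ ⟨D, e, he, rfl, rfl⟩
    exact ⟨D, e, he, by rintro rfl; simp at hn, rfl⟩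
  | zero => exact zero_mem _
  | add x y _ _ hx hy => exact add_mem hx hy
  | smul b x h hx =>
    clear h
    rw [smul_eq_mul]
    induction hx using Submodule.span_induction with
    | mem x hx =>
      obtain ⟨D, e, he, he0, rfl⟩ := hx
      induction b using mono_induction with
      | h0 => rw [zero_mul]; exact zero_mem _
      | hadd a b ha hb => rw [add_mul]; exact add_mem ha hb
      | hmono c D' e' he' =>
        rw [smul_mul_assoc]
        refine Submodule.smul_mem _ _ ?_
        by_cases hD : D' - monDeg μ e' = D
        · subst hD
          rw [mono_mul k he']
          exact Submodule.subset_span ⟨_, _, he'.add he, fun h => he0 (add_eq_zero.1 h).2, rfl⟩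
        · rw [mono_mul_of_ne k hD]
          exact zero_mem _
    | zero => rw [mul_zero]; exact zero_mem _
    | add x y _ _ hx hy => rw [mul_add]; exact add_mem hx hy
    | smul c x _ hx => rw [mul_smul_comm]; exact Submodule.smul_mem _ _ hx

end Grading

/-! ### The linear resolution -/

section Left

variable (k : Type*) [CommRing k] {N : ℕ} {Γ : Type*} [AddCommGroup Γ] (μ : (Fin N → ℤ) →+ Γ)

open Classical in
/-- The coefficients of the bar resolution of the left module `A₀`. -/
def leftData : RightData k μ k (Alg k μ) where
  Θ := (Algebra.TensorProduct.rid k k (Alg k μ))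
  f _ := 1
  -- The last facet drops a nontrivial monomial on the right, which acts on `A₀` by zero.
  rc _ i := if i = Fin.last _ then 0 else 1
  f_mul_f _ := one_mul 1
  f_mul_rc _ _ := one_mul _
  rc_mul_f _ _ := mul_one _
  rc_of_ne _ _ hi := if_neg hi
  f_facet _ _ _ := rfl
  rc_cons D a η hD ha h i := by simp only [← Fin.succ_last, Fin.succ_inj]

lemma leftData_tm (a : Alg k μ) (c : k) : (leftData k μ).tm a c = c • a :=
  Algebra.TensorProduct.rid_tmul k c a

variable {μ}

lemma leftData_idem {n : ℕ} (η : Cell μ n) : (leftData k μ).idem η = mono k μ η.src 0 := by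
  rw [RightData.idem, leftData_tm]
  exact one_smul _ _

lemma leftData_facetCo_last {n : ℕ} (η : Cell μ (n + 1)) :
    (leftData k μ).facetCo η (Fin.last _) = 0 := by
  rw [RightData.facetCo, leftData_tm, show (leftData k μ).rc η (Fin.last _) = 0 from if_pos rfl,
    zero_smul]

lemma leftData_facetCo {n : ℕ} (η : Cell μ (n + 1)) {i : Fin (n + 2)} (hi : i ≠ Fin.last _) :
    (leftData k μ).facetCo η i = mono k μ η.src (η.p (i.succAbove 0)) := by
  rw [RightData.facetCo, leftData_tm, show (leftData k μ).rc η i = 1 from if_neg hi, one_smul]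

variable {ord : Fin N → ℕ} (hord : IsDirected μ ord)

/-- The augmentation of the left bar complex. -/
def leftAug : (Cell μ 0 →₀ Alg k μ) →ₗ[Alg k μ] Alg k μ ⧸ posIdeal (pathGrading k μ) :=
  (posIdeal (pathGrading k μ)).mkQ ∘ₗ Finsupp.linearCombination _ fun _ => (1 : Alg k μ)

/-- The section of the augmentation of the left bar complex. -/
def leftSec : Alg k μ →ₗ[k] (Cell μ 0 →₀ Alg k μ) :=
  open Classical in
  (monoBasis k μ).constr k fun x => if x.1.2 = 0 then
    Finsupp.single (Cell.ofVertex ⟨x.1.1, x.2.1⟩) (mono k μ x.1.1 0) else 0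

lemma leftSec_mono_zero (D : Vertex μ) : leftSec k (mono k μ (D : Γ) 0) =
    Finsupp.single (Cell.ofVertex D) (mono k μ (D : Γ) 0) := by
  rw [leftSec]
  conv_lhs => rw [← monoBasis_apply k ⟨((D : Γ), 0), isMor_zero D.2⟩]
  rw [Module.Basis.constr_basis, if_pos rfl]

lemma leftSec_mono {D : Γ} {e : Fin N →₀ ℕ} (h : IsMor μ D e) (he : e ≠ 0) :
    leftSec k (mono k μ D e) = 0 := by
  rw [leftSec, ← monoBasis_apply k ⟨(D, e), h⟩, Module.Basis.constr_basis, if_neg he]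

include hord in
lemma leftSec_of_mem {a : Alg k μ} (ha : a ∈ posIdeal (pathGrading k μ)) :
    leftSec k a = 0 := by
  have h : Submodule.span k {a | ∃ D e, IsMor μ D e ∧ e ≠ 0 ∧ a = mono k μ D e} ≤
      LinearMap.ker (leftSec k) := by
    rw [Submodule.span_le]
    rintro _ ⟨D, e, he, he0, rfl⟩
    exact leftSec_mono k he he0
  exact h (posIdeal_subset k hord ha)

include hord in
lemma mono_mem_posIdeal (D : Γ) {e : Fin N →₀ ℕ} (he : e ≠ 0) :
    mono k μ D e ∈ posIdeal (pathGrading k μ) :=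
  Submodule.subset_span ⟨_, degree_pos he, mono_mem_pathGrading k hord D e⟩

lemma left_smul_barD_one (a : Alg k μ) (η : Cell μ 1) : a • (leftData k μ).barD η =
    Finsupp.single (η.facet 0) (a * mono k μ η.src (η.p 1)) := by
  have h0 : (0 : Fin 2).succAbove (0 : Fin 1) = 1 := rfl
  have h1 : (leftData k μ).facetCo η 1 = 0 := leftData_facetCo_last k η
  rw [RightData.barD, Fin.sum_univ_two, h1, leftData_facetCo k η (by simp), h0]
  simp

include hord in
lemma leftAug_barD (η : Cell μ 1) : leftAug k ((leftData k μ).barD η) = 0 := by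
  rw [← one_smul (Alg k μ) ((leftData k μ).barD η), left_smul_barD_one, one_mul, leftAug,
    LinearMap.comp_apply, Finsupp.linearCombination_single, smul_eq_mul, mul_one,
    Submodule.mkQ_apply, Submodule.Quotient.mk_eq_zero]
  exact mono_mem_posIdeal k hord _ η.p_one_ne_zero

/-- The second facet of an edge has coefficient zero, so on nontrivial monomials the homotopy alone
gives the identity; the idempotents are recovered by `leftSec`. -/
lemma left_D_htpy_zero {x : Cell μ 0 →₀ Alg k μ} (hx : x ∈ ((leftData k μ).morse hord).sub 0) :
    ((leftData k μ).morse hord).D 0 ((leftData k μ).htpy 0 x) +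
      leftSec k (Finsupp.linearCombination (Alg k μ) (fun _ => (1 : Alg k μ)) x) = x := by
  refine (leftData k μ).sub_induction hord
    (P := fun x => ((leftData k μ).morse hord).D 0 ((leftData k μ).htpy 0 x) +
      leftSec k (Finsupp.linearCombination (Alg k μ) (fun _ => (1 : Alg k μ)) x) = x) ?_ ?_ ?_ hx
  · simp
  · intro x y hx hy
    rw [map_add (Finsupp.linearCombination (Alg k μ) _), map_add, map_add, map_add,
      add_add_add_comm, hx, hy]
  · intro η D e c he h _
    rw [Finsupp.linearCombination_single, smul_eq_mul, mul_one]
    by_cases he0 : e = 0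
    · subst he0
      rw [map_zero, sub_zero] at h
      subst h
      rw [(leftData k μ).htpy_single_zero η he.1, map_zero, zero_add, leftData_tm, map_smul,
        leftSec_mono_zero k ⟨η.src, he.1⟩, ← η.eq_ofVertex, Finsupp.smul_single]
    · rw [(leftData k μ).htpy_single _ he.1 he0 h, MorseData.D_single]
      change _ • (leftData k μ).barD _ + _ = _
      have h1 : (Cell.cons D e η he.1 he0 h).p 1 = e := by
        rw [← Fin.succ_zero_eq_one, Cell.cons_p_succ, η.zero, add_zero]
      rw [left_smul_barD_one, h1, Cell.cons_facet_zero, leftData_tm, leftData_tm, map_smul,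
        leftSec_mono k he he0, smul_zero, add_zero, smul_mul_assoc,
        show (Cell.cons D e η he.1 he0 h).src = D from rfl, mono_zero_mul]

lemma left_exact {n : ℕ} {x : Crit (matching ord μ) (n + 1) →₀ Alg k μ}
    (hx : x ∈ ((leftData k μ).morse hord).critSub (n + 1)) :
    ((leftData k μ).morse hord).morseD n x = 0 ↔
      ∃ y ∈ ((leftData k μ).morse hord).critSub (n + 2),
        ((leftData k μ).morse hord).morseD (n + 1) y = x :=
  (leftData k μ).exact_morseD hord (leftAug k)
    (fun x => leftSec k (Finsupp.linearCombination (Alg k μ) (fun _ => (1 : Alg k μ)) x))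
    (fun _ hx => left_D_htpy_zero k hord hx)
    (fun _ h => leftSec_of_mem k hord ((Submodule.Quotient.mk_eq_zero _).1 h))
    (leftAug_barD k hord) hx

lemma left_exact_zero {x : Crit (matching ord μ) 0 →₀ Alg k μ}
    (hx : x ∈ ((leftData k μ).morse hord).critSub 0) :
    leftAug k (((leftData k μ).morse hord).incl 0 x) = 0 ↔
      ∃ y ∈ ((leftData k μ).morse hord).critSub 1,
        ((leftData k μ).morse hord).morseD 0 y = x :=
  (leftData k μ).exact_augmentation hord (leftAug k)
    (fun x => leftSec k (Finsupp.linearCombination (Alg k μ) (fun _ => (1 : Alg k μ)) x))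
    (fun _ hx => left_D_htpy_zero k hord hx)
    (fun _ h => leftSec_of_mem k hord ((Submodule.Quotient.mk_eq_zero _).1 h))
    (leftAug_barD k hord) hx

lemma left_surjective (z : Alg k μ ⧸ posIdeal (pathGrading k μ)) :
    ∃ x ∈ ((leftData k μ).morse hord).critSub 0,
      leftAug k (((leftData k μ).morse hord).incl 0 x) = z := by
  obtain ⟨a, rfl⟩ := Submodule.Quotient.mk_surjective _ z
  have hmem : ∑ D : Vertex μ, a • Finsupp.single (Cell.ofVertex D) (mono k μ (D : Γ) 0) ∈
      ((leftData k μ).morse hord).sub 0 := by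
    refine Submodule.sum_mem _ fun D _ => Submodule.smul_mem _ _ ?_
    have h := ((leftData k μ).morse hord).single_mem (Cell.ofVertex D)
    rwa [show ((leftData k μ).morse hord).e (Cell.ofVertex D) = mono k μ (D : Γ) 0 from
      leftData_idem k _] at h
  refine ⟨_, MorseData.proj_mem _ hmem, ?_⟩
  rw [MorseData.proj_zero_eq, leftAug, LinearMap.comp_apply, map_sum]
  simp only [map_smul, Finsupp.linearCombination_single, smul_eq_mul, mul_one]
  rw [← Finset.mul_sum, sum_mono_zero, mul_one]
  rfl

/-! ### The grading of the resolution -/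

/-- The grading of `A`, shifted by `i`. -/
def shiftGrading (μ : (Fin N → ℤ) →+ Γ) (i n : ℕ) : AddSubgroup (Alg k μ) :=
  if i ≤ n then (pathGrading k μ (n - i)).toAddSubgroup else ⊥

lemma mem_shiftGrading {i n : ℕ} {a : Alg k μ} : a ∈ shiftGrading k μ i n ↔
    a = 0 ∨ ∃ m, n = i + m ∧ a ∈ pathGrading k μ m := by
  rw [shiftGrading]
  split_ifs with h
  · obtain ⟨m, rfl⟩ := Nat.exists_eq_add_of_le h
    rw [Nat.add_sub_cancel_left]
    constructor
    · exact fun ha => Or.inr ⟨m, rfl, ha⟩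
    · rintro (rfl | ⟨m', hm, ha⟩)
      · exact zero_mem _
      · rwa [Nat.add_left_cancel hm]
  · rw [AddSubgroup.mem_bot]
    exact ⟨Or.inl, fun h' => h'.elim id fun ⟨m, hm, _⟩ => absurd (hm ▸ Nat.le_add_right i m) h⟩

variable (μ) in
/-- The projection to the part of degree `n` of the grading shifted by `i`. -/
def shiftProj (i n : ℕ) : Alg k μ →+ Alg k μ :=
  if i ≤ n then (degProj k μ (n - i)).toAddMonoidHom else 0

include hord

lemma shiftProj_of_mem {i m n : ℕ} {a : Alg k μ} (ha : a ∈ shiftGrading k μ i n) :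
    shiftProj k μ i m a = if n = m then a else 0 := by
  rcases (mem_shiftGrading k).1 ha with rfl | ⟨n, rfl, ha'⟩
  · simp
  · rw [shiftProj]
    split_ifs with h1 h2 h2
    · subst h2
      have := degProj_of_mem k hord (m := n) ha'
      rw [if_pos rfl] at this
      rwa [Nat.add_sub_cancel_left]
    · have := degProj_of_mem k hord (m := m - i) ha'
      rwa [if_neg (by omega)] at this
    · omega
    · rfl

lemma crit_mul_mem {i n : ℕ} {a : Alg k μ} (ha : a ∈ shiftGrading k μ i n) (D : Γ) :
    a * mono k μ D 0 ∈ shiftGrading k μ i n := by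
  rw [mem_shiftGrading] at ha ⊢
  rcases ha with rfl | ⟨m, rfl, ha⟩
  · exact Or.inl (zero_mul _)
  · have := (pathGrading_gradedMonoid k hord).mul_mem ha (mono_mem_pathGrading k hord D 0)
    rw [map_zero, add_zero] at this
    exact Or.inr ⟨m, rfl, this⟩

lemma mul_mem_shiftGrading {i m n : ℕ} {a b : Alg k μ} (ha : a ∈ pathGrading k μ m)
    (hb : b ∈ shiftGrading k μ i n) : a * b ∈ shiftGrading k μ i (m + n) := by
  rw [mem_shiftGrading] at hb ⊢
  rcases hb with rfl | ⟨n, rfl, hb⟩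
  · exact Or.inl (mul_zero _)
  · exact Or.inr ⟨m + n, by omega, (pathGrading_gradedMonoid k hord).mul_mem ha hb⟩

lemma mul_mem_shiftGrading_of_one {i n : ℕ} {a b : Alg k μ} (ha : a ∈ shiftGrading k μ (i + 1) n)
    (hb : b ∈ pathGrading k μ 1) : a * b ∈ shiftGrading k μ i n := by
  rw [mem_shiftGrading] at ha ⊢
  rcases ha with rfl | ⟨n, rfl, ha⟩
  · exact Or.inl (zero_mul _)
  · exact Or.inr ⟨n + 1, by omega, (pathGrading_gradedMonoid k hord).mul_mem ha hb⟩

lemma left_isInternal (i : ℕ) : DirectSum.IsInternal fun n =>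
    ((leftData k μ).morse hord).critGr i (shiftGrading k μ i n) := by
  refine MorseData.critGr_isInternal _ (shiftProj k μ i) ?_ ?_ ?_ ?_
  · intro n x hx y hy h
    have h1 := shiftProj_of_mem k hord (m := n) hx
    have h2 := shiftProj_of_mem k hord (m := n) hy
    rw [if_pos rfl] at h1 h2
    exact h1.symm.trans (h.trans h2)
  · intro m n hmn x hx
    have := shiftProj_of_mem k hord (m := m) hx
    rwa [if_neg hmn.symm] at this
  · intro T hT x
    induction x using mono_induction with
    | h0 => exact zero_mem _
    | hadd a b ha hb => exact add_mem ha hb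
    | hmono c D e he =>
      exact hT (i + e.degree) _ ((mem_shiftGrading k).2 (Or.inr
        ⟨_, rfl, Submodule.smul_mem _ c (mono_mem_pathGrading k hord D e)⟩))
  · intro n a ha y
    rw [show ((leftData k μ).morse hord).e y.1 = _ from leftData_idem k _]
    exact crit_mul_mem k hord ha _

/-- Generators of the `i`-th term sit in degree `i`; the entries of degree one compensate for the
change of shift. -/
lemma left_morseD_mem {i n : ℕ} (η : ((leftData k μ).morse hord).Critical (i + 1)) {r : Alg k μ}
    (hr : r ∈ shiftGrading k μ (i + 1) n) (σ : ((leftData k μ).morse hord).Critical i) :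
    ((leftData k μ).morse hord).morseD i (Finsupp.single η r) σ ∈ shiftGrading k μ i n := by
  rw [RightData.morseD_single_apply]
  refine mul_mem_shiftGrading_of_one k hord hr ?_
  refine (leftData k μ).finsum_pathCo_mem hord (fun m => (pathGrading k μ m).toAddSubgroup)
    (fun m n a ha b hb => (pathGrading_gradedMonoid k hord).mul_mem ha hb) ?_ η σ
  intro n η i m hm
  by_cases hi : i = Fin.last _
  · subst hi
    rw [leftData_facetCo_last]
    exact zero_mem _
  · rw [leftData_facetCo k η hi]
    have h := mono_mem_pathGrading k hord η.src (η.p (i.succAbove 0))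
    have h1 : (η.p (i.succAbove 0)) ≤ η.p (Fin.last _) := η.strictMono.monotone (Fin.le_last _)
    have h2 : (η.facet i).p (Fin.last n) + η.p (i.succAbove 0) = η.p (Fin.last _) := by
      change η.p (i.succAbove (Fin.last n)) - η.p (i.succAbove 0) + _ = _
      rw [Fin.succAbove_ne_last_last hi, tsub_add_cancel_of_le h1]
    rw [← h2, map_add] at hm
    rw [Nat.add_left_cancel hm]
    exact h

theorem pathGrading_isKoszul : IsKoszul (pathGrading k μ) where
  graded := pathGrading_gradedMonoid k hord
  internal := pathGrading_isInternal k hord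
  linear_resolution := by
    let 𝓜 := (leftData k μ).morse hord
    refine ⟨𝓜.CritMod, fun i => inferInstance, fun i => inferInstance,
      fun i n => 𝓜.critGr i (shiftGrading k μ i n), 𝓜.critD,
      (leftAug k ∘ₗ 𝓜.incl 0) ∘ₗ 𝓜.critVal 0, fun i => inferInstance,
      fun i => left_isInternal k hord i, ?_, ?_, ?_, ?_, ?_, ?_⟩
    · intro i m n a ha x hx
      exact 𝓜.smul_mem_critGr (fun b hb => mul_mem_shiftGrading k hord ha hb) hx
    · intro i
      refine 𝓜.span_critGr fun y => (mem_shiftGrading k).2 (Or.inr ⟨0, rfl, ?_⟩)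
      rw [show 𝓜.e y.1 = _ from leftData_idem k _]
      have h := mono_mem_pathGrading k hord y.1.src 0
      rwa [map_zero] at h
    · intro i n x hx
      exact 𝓜.critD_mem_critGr (fun η r hr σ => left_morseD_mem k hord η hr σ) hx
    · intro i
      exact 𝓜.exact_critD fun x hx => left_exact k hord hx
    · exact 𝓜.exact_critD_zero _ fun x hx => left_exact_zero k hord hx
    · intro z
      obtain ⟨x, hx, h⟩ := left_surjective k hord z
      obtain ⟨x, rfl⟩ := 𝓜.exists_critVal hx
      exact ⟨x, h⟩

end Left

/-! ### The trivial coefficient ring -/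

section Subsingleton

variable (k : Type*) [CommRing k] [Subsingleton k] {N : ℕ} {Γ : Type*} [AddCommGroup Γ]
  (μ : (Fin N → ℤ) →+ Γ)

lemma subsingleton_alg : Subsingleton (Alg k μ) :=
  ⟨fun a b => by rw [← one_smul k a, ← one_smul k b, Subsingleton.elim (1 : k) 0, zero_smul, zero_smul]⟩

lemma subsingleton_env : Subsingleton (Env k μ) :=
  ⟨fun a b => by rw [← one_smul k a, ← one_smul k b, Subsingleton.elim (1 : k) 0, zero_smul, zero_smul]⟩

lemma isInternal_of_subsingleton {M S : Type*} [AddCommMonoid M] [SetLike S M]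
    [AddSubmonoidClass S M] [Subsingleton M] (G : ℕ → S) : DirectSum.IsInternal G :=
  isInternal_of_projections (fun _ => AddMonoidHom.id M) (fun _ _ _ _ _ _ => Subsingleton.elim _ _)
    (fun _ _ _ _ _ => Subsingleton.elim _ _)
    (fun T _ x => by rw [Subsingleton.elim x 0]; exact zero_mem T)

lemma isKoszul_of_subsingleton : IsKoszul (pathGrading k μ) := by
  have := subsingleton_alg k μ
  have hmem : ∀ n (a : Alg k μ), a ∈ pathGrading k μ n := fun n a => by
    rw [Subsingleton.elim a 0]; exact zero_mem _
  refine ⟨{ one_mem := hmem 0 1, mul_mem := fun _ _ _ _ _ _ => hmem _ _ }, isInternal_of_subsingleton _,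
    fun _ => Alg k μ, fun _ => inferInstance, fun _ => inferInstance, fun _ _ => ⊤, fun _ => 0, 0,
    fun _ => inferInstance, fun _ => isInternal_of_subsingleton _, ?_, ?_, ?_, ?_, ?_, ?_⟩
  · exact fun _ _ _ _ _ _ _ => AddSubgroup.mem_top _
  · exact fun _ => Subsingleton.elim _ _
  · exact fun _ _ _ _ => AddSubgroup.mem_top _
  · exact fun _ x => ⟨fun _ => ⟨0, Subsingleton.elim _ _⟩, fun _ => Subsingleton.elim _ _⟩
  · exact fun x => ⟨fun _ => ⟨0, Subsingleton.elim _ _⟩, fun _ => rfl⟩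
  · intro z
    obtain ⟨a, rfl⟩ := Submodule.Quotient.mk_surjective _ z
    exact ⟨0, by rw [Subsingleton.elim a 0]; rfl⟩

variable {μ} in
lemma isAcyclic_empty : IsAcyclic (∅ : Set (AnyCell μ × AnyCell μ)) := by
  have h : ∀ x y : AnyCell μ, Relation.TransGen (HasseStep ∅) x y → y.1 < x.1 := by
    intro x y hxy
    have hstep : ∀ x y : AnyCell μ, HasseStep ∅ x y → y.1 < x.1 := by
      rintro x y (⟨⟨n, η, i, rfl, rfl⟩, -⟩ | h)
      · exact Nat.lt_succ_self n
      · exact absurd h (Set.notMem_empty _)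
    induction hxy with
    | single h => exact hstep _ _ h
    | tail _ h ih => exact (hstep _ _ h).trans ih
  exact fun x hx => lt_irrefl _ (h x x hx)

lemma isProjectiveResolution_of_subsingleton (M : Set (AnyCell μ × AnyCell μ)) :
    IsProjectiveResolution k M := by
  have h1 := subsingleton_alg k μ
  have h2 := subsingleton_env k μ
  have h3 : ∀ n, Subsingleton (Crit M n →₀ Env k μ) := fun n =>
    ⟨fun a b => Finsupp.ext fun _ => Subsingleton.elim _ _⟩
  refine ⟨fun n => ?_, fun n x hx => ⟨0, zero_mem _, Subsingleton.elim _ _⟩,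
    fun n x hx => ⟨fun _ => ⟨0, zero_mem _, Subsingleton.elim _ _⟩, fun _ => Subsingleton.elim _ _⟩,
    fun x hx => ⟨fun _ => ⟨0, zero_mem _, Subsingleton.elim _ _⟩, fun _ => Subsingleton.elim _ _⟩,
    fun a => ⟨0, zero_mem _, Subsingleton.elim _ _⟩⟩
  have : Subsingleton (morseTerm k M n) := ⟨fun a b => Subtype.ext (Subsingleton.elim _ _)⟩
  infer_instance

lemma isMinimal_of_subsingleton (M : Set (AnyCell μ × AnyCell μ)) : IsMinimal k M := by
  have := subsingleton_env k μ
  intro n η σ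
  rw [Subsingleton.elim (morseCoeff k M η.1 σ.1) 0]
  exact zero_mem _

end Subsingleton

end BondalRuan

end

theorem mainTheorem7 {k : Type*} [CommRing k] [IsNoetherianRing k]
    {N : ℕ} {Γ : Type*} [AddCommGroup Γ] (μ : (Fin N → ℤ) →+ Γ)
    (hμ : Function.Surjective μ)
    (hproper : BondalRuan.CohomologicallyProper μ)
    (hweights : ∀ i : Fin N, BondalRuan.muR μ (Pi.single i 1) ≠ 0)
    (hdir : BondalRuan.Directable k μ) :
    BondalRuan.IsKoszul (BondalRuan.pathGrading k μ) ∧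
    ∃ M : Set (BondalRuan.AnyCell μ × BondalRuan.AnyCell μ),
      BondalRuan.IsMatching M ∧ BondalRuan.IsInternal M ∧ BondalRuan.IsAcyclic M ∧
      BondalRuan.IsProjectiveResolution k M ∧ BondalRuan.IsMinimal k M := by
  -- Over the zero ring directability gives no equalities of monomials, but there all modules vanish
  -- and the empty matching suffices.
  rcases subsingleton_or_nontrivial k with hk | hk
  · refine ⟨BondalRuan.isKoszul_of_subsingleton k μ, ∅, ⟨?_, ?_, ?_, ?_⟩, ⟨?_, ?_, ?_⟩,
      BondalRuan.isAcyclic_empty, BondalRuan.isProjectiveResolution_of_subsingleton k μ ∅,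
      BondalRuan.isMinimal_of_subsingleton k μ ∅⟩
    all_goals simp [BondalRuan.IsCritical]
  · obtain ⟨ord, hord⟩ := hdir.exists_isDirected k
    exact ⟨BondalRuan.pathGrading_isKoszul k hord, BondalRuan.matching ord μ,
      BondalRuan.matching_isMatching,
      BondalRuan.matching_isInternal hord.inj hord.lt hord.split hord.arrow,
      BondalRuan.matching_isAcyclic hord.inj,
      BondalRuan.matching_isProjectiveResolution k hord,
      BondalRuan.matching_isMinimal k hord⟩
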